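/- Let $\mathbf k$ be a field and let $(H,\Delta,\epsilon,\phi,S,\alpha,\beta)$ be a finite dimensional quasi-Hopf algebra over $\mathbf k$ with invertible antipode $S$, reassociator $\phi=X\otimes Y\otimes Z$ satisfying $(\mathrm{id}\otimes\Delta)(\Delta(a))\,\phi=\phi\,(\Delta\otimes\mathrm{id})(\Delta(a))$, and $\phi^{-1}=\bar X\otimes\bar Y\otimes\bar Z$ (summations suppressed). Let $\mu:H\to\mathbf k$ be the modulus of $H$, i.e. the algebra map with $la=\mu(a)\,l$ for all $a\in H$ and every left integral $l$. For $a\in H$ put $a\leftharpoonup\mu:=\mu(a_{(1)})a_{(2)}$, and put $$q_R=X\otimes S^{-1}(\alpha Z)Y,\quad p_R=\bar X\otimes\bar Y\beta S(\bar Z),\quad q_L=S(\bar X)\alpha\bar Y\otimes\bar Z,\quad p_L=Y S^{-1}(X\beta)\otimes Z .$$ Left cointegrals. Let $\gamma=S(U^i)\alpha V^i\otimes S(T^i)\alpha W^i$, where $T^i\otimes U^i\otimes V^i\otimes W^i=(\mathbf 1\otimes\phi^{-1})(\mathrm{id}\otimes\mathrm{id}\otimes\Delta)(\phi)$, let $f=(S\otimes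 S)(\Delta^{op}(\bar X))\,\gamma\,\Delta(\bar Y\beta S(\bar Z))$ (Drinfeld's twist, which is invertible), $h=(S^{-1}\otimes S^{-1})(f^{21})$, $U=f^{-1}(S\otimes S)(q_R^{21})$ and $V=(S^{-1}\otimes S^{-1})(p_R^{21})\,h$. The dual $H^*=\mathrm{Hom}_{\mathbf k}(H,\mathbf k)$ is an $H$-bimodule by $(a\cdot\psi\cdot b)(c)=\psi(S^{-1}(a)\,c\,S(b))$, and has the right coaction $\rho:H^*\to H^*\otimes H\cong\mathrm{Hom}_{\mathbf k}(H,H)$, $\rho(\psi)(c)=(\mathrm{id}\otimes\psi)(V\Delta(c)U)$. Writing $\rho(\psi)=\psi_{(0)}\otimes\psi_{(1)}$, the space $\mathcal L$ of left cointegrals consists of the $\lambda\in H^*$ with $E(\lambda)=\lambda$, where $E(\psi)=q_R^1\cdot\psi_{(0)}\cdot\beta S(q_R^2\psi_{(1)})$. Cocentral biinvariant forms. Let $H_\mu$ be $H$ with bimodule structure $a\cdot x\cdot b=(a\leftharpoonup\mu)xb$ and right coaction $\rho_\mu(x)=T_\mu\Delta(x)$, where $T_\mu=\mu(\bar X)\bar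 Y\otimes\bar Z$; regard the first factor $H$ as an $H$-bimodule by multiplication, with left coaction $\Delta$. A linear form $\Sigma:H\otimes H_\mu\to\mathbf k$ is biinvariant if $$\Sigma\big((x\otimes m)\cdot\Delta(a)\big)=\epsilon(a)\Sigma(x\otimes m)=\Sigma\big(\Delta(a)\cdot(x\otimes m)\big)$$ and cocentral if $$(\mathrm{id}\otimes\Sigma)\big(\phi\cdot[\Delta(x)\otimes m]\cdot\phi^{-1}\big)=(\Sigma\otimes\mathrm{id})\big(\phi^{-1}\cdot[x\otimes\rho_\mu(m)]\cdot\phi\big)$$ for all $a,x\in H$ and $m\in H_\mu$, where the dots denote the slotwise bimodule actions. Then $\lambda\mapsto\Sigma_\lambda$, $$\Sigma_\lambda(a\otimes b):=\lambda\big(S^{-1}(\alpha)\,a\,\beta\,S(b)\big),$$ is a (linear) bijection from $\mathcal L$ onto the space of cocentral biinvariant forms $\Sigma:H\otimes H_\mu\to\mathbf k$. Its inverse is $\Sigma\mapsto\lambda_\Sigma$, where, putting $p_\mu:=p^1\otimes(p^2\leftharpoonup\mu)$, $$\lambda_\Sigma(a):=\Sigma\big(p_\mu\,(a\otimes\mathbf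 1)\,q\big),$$ with the products formed in the algebra $H\otimes H$; this holds for, and $\lambda_\Sigma$ is independent of, each of the choices $p\in\{p_L,p_R\}$ and $q\in\{q_L,q_R\}$. Consequently the space of cocentral biinvariant forms $\Sigma:H\otimes H_\mu\to\mathbf k$ is one-dimensional. -/

import Mathlib

open scoped TensorProduct

noncomputable section

/-- A quasi-bialgebra structure on a unital `k`-algebra `H`.  Threefold and fourfold tensor powers
are bracketed to the right. -/
structure QuasiBialgebra (k H : Type*) [Field k] [Ring H] [Algebra k H] where
  /-- the coproduct `Δ` -/
  comul : H →ₐ[k] H ⊗[k] H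
  /-- the counit `ε` -/
  counit : H →ₐ[k] k
  /-- the reassociator `φ`, an invertible element -/
  reassoc : (H ⊗[k] (H ⊗[k] H))ˣ
  /-- `(id ⊗ Δ)(Δ a) φ = φ (Δ ⊗ id)(Δ a)` -/
  quasi_coassoc : ∀ a : H,
    Algebra.TensorProduct.map (AlgHom.id k H) comul (comul a) * (reassoc : H ⊗[k] (H ⊗[k] H)) =
      (reassoc : H ⊗[k] (H ⊗[k] H)) *
        TensorProduct.assoc k H H H
          (Algebra.TensorProduct.map comul (AlgHom.id k H) (comul a))
  /-- `(id ⊗ id ⊗ Δ)(φ) (Δ ⊗ id ⊗ id)(φ) = (1 ⊗ φ) (id ⊗ Δ ⊗ id)(φ) (φ ⊗ 1)` -/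
  pentagon :
    TensorProduct.map LinearMap.id (TensorProduct.map LinearMap.id comul.toLinearMap)
        (reassoc : H ⊗[k] (H ⊗[k] H)) *
      TensorProduct.assoc k H H (H ⊗[k] H)
        (TensorProduct.map comul.toLinearMap LinearMap.id (reassoc : H ⊗[k] (H ⊗[k] H))) =
    ((1 : H) ⊗ₜ[k] (reassoc : H ⊗[k] (H ⊗[k] H))) *
      TensorProduct.map LinearMap.id (TensorProduct.assoc k H H H).toLinearMap
        (TensorProduct.map LinearMap.id (TensorProduct.map comul.toLinearMap LinearMap.id)
          (reassoc : H ⊗[k] (H ⊗[k] H))) *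
      TensorProduct.map LinearMap.id (TensorProduct.assoc k H H H).toLinearMap
        (TensorProduct.assoc k H (H ⊗[k] H) H
          ((reassoc : H ⊗[k] (H ⊗[k] H)) ⊗ₜ[k] (1 : H)))
  /-- `(ε ⊗ id) ∘ Δ = id` -/
  counit_left : ∀ a : H,
    TensorProduct.lid k H (TensorProduct.map counit.toLinearMap LinearMap.id (comul a)) = a
  /-- `(id ⊗ ε) ∘ Δ = id` -/
  counit_right : ∀ a : H,
    TensorProduct.rid k H (TensorProduct.map LinearMap.id counit.toLinearMap (comul a)) = a
  /-- `(id ⊗ ε ⊗ id)(φ) = 1 ⊗ 1` -/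
  counit_middle :
    TensorProduct.map LinearMap.id
      ((TensorProduct.lid k H).toLinearMap ∘ₗ
        TensorProduct.map counit.toLinearMap LinearMap.id)
      (reassoc : H ⊗[k] (H ⊗[k] H)) = (1 : H) ⊗ₜ[k] (1 : H)

/-- The linear map `x ⊗ y ↦ S(x) c y`. -/
def sandwichLeft {k H : Type*} [Field k] [Ring H] [Algebra k H] (S : H →ₗ[k] H) (c : H) :
    H ⊗[k] H →ₗ[k] H :=
  TensorProduct.lift ((LinearMap.mul k H) ∘ₗ (LinearMap.mulRight k c) ∘ₗ S)

/-- The linear map `x ⊗ y ↦ x c S(y)`. -/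
def sandwichRight {k H : Type*} [Field k] [Ring H] [Algebra k H] (S : H →ₗ[k] H) (c : H) :
    H ⊗[k] H →ₗ[k] H :=
  TensorProduct.lift ((LinearMap.mul k H).compl₂ S ∘ₗ (LinearMap.mulRight k c))

/-- A quasi-Hopf algebra structure (with invertible antipode) on a unital `k`-algebra `H`. -/
structure QuasiHopfAlgebra (k H : Type*) [Field k] [Ring H] [Algebra k H]
    extends QuasiBialgebra k H where
  /-- the antipode `S`, a bijective antimorphism of algebras -/
  antipode : H ≃ₗ[k] H
  antipode_one : antipode 1 = 1
  antipode_mul : ∀ a b : H, antipode (a * b) = antipode b * antipode a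
  alpha : H
  beta : H
  /-- `S(a₍₁₎) α a₍₂₎ = ε(a) α` -/
  antipode_left : ∀ a : H,
    sandwichLeft antipode.toLinearMap alpha (comul a) = counit a • alpha
  /-- `a₍₁₎ β S(a₍₂₎) = ε(a) β` -/
  antipode_right : ∀ a : H,
    sandwichRight antipode.toLinearMap beta (comul a) = counit a • beta
  /-- `X β S(Y) α Z = 1`, where `φ = X ⊗ Y ⊗ Z` -/
  reassoc_antipode :
    TensorProduct.lift ((LinearMap.mul k H) ∘ₗ (LinearMap.mulRight k beta))
      (TensorProduct.map LinearMap.id (sandwichLeft antipode.toLinearMap alpha)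
        (reassoc : H ⊗[k] (H ⊗[k] H))) = 1
  /-- `S(X') α Y' β S(Z') = 1`, where `φ⁻¹ = X' ⊗ Y' ⊗ Z'` -/
  reassoc_inv_antipode :
    sandwichLeft antipode.toLinearMap alpha
      (TensorProduct.map LinearMap.id (sandwichRight antipode.toLinearMap beta)
        (↑reassoc⁻¹ : H ⊗[k] (H ⊗[k] H))) = 1

/-- An `H`-bimodule structure on a `k`-space `M`: `left a m = a · m` and `right b m = m · b`. -/
structure BimoduleStr (k H M : Type*) [Field k] [Ring H] [Algebra k H]
    [AddCommGroup M] [Module k M] where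
  left : H →ₗ[k] M →ₗ[k] M
  right : H →ₗ[k] M →ₗ[k] M
  left_one : ∀ m, left 1 m = m
  left_mul : ∀ a b m, left (a * b) m = left a (left b m)
  right_one : ∀ m, right 1 m = m
  right_mul : ∀ a b m, right (a * b) m = right b (right a m)
  left_right_comm : ∀ a b m, right b (left a m) = left a (right b m)

/-- The slotwise action of `A ⊗ B` on `M ⊗ N` built from an action of `A` on `M` and an action of
`B` on `N`: `(a ⊗ b) · (m ⊗ n) = (a · m) ⊗ (b · n)`.  It is used for left and for right actions. -/
def slotAct {k A B M N : Type*} [Field k] [AddCommGroup A] [Module k A] [AddCommGroup B]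
    [Module k B] [AddCommGroup M] [Module k M] [AddCommGroup N] [Module k N]
    (f : A →ₗ[k] M →ₗ[k] M) (g : B →ₗ[k] N →ₗ[k] N) :
    (A ⊗[k] B) →ₗ[k] (M ⊗[k] N) →ₗ[k] (M ⊗[k] N) :=
  TensorProduct.map₂ f g

/-- `H` as an `H`-bimodule by multiplication. -/
def BimoduleStr.regular (k H : Type*) [Field k] [Ring H] [Algebra k H] : BimoduleStr k H H where
  left := LinearMap.mul k H
  right := (LinearMap.mul k H).flip
  left_one := by intro m; simp
  left_mul := by intro a b m; simp [mul_assoc]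
  right_one := by intro m; simp
  right_mul := by intro a b m; simp [mul_assoc]
  left_right_comm := by intro a b m; simp [mul_assoc]

namespace QuasiHopfAlgebra

variable {k H : Type*} [Field k] [Ring H] [Algebra k H] (Q : QuasiHopfAlgebra k H)

/-- `φ` -/
def phi : H ⊗[k] (H ⊗[k] H) := ↑Q.reassoc

/-- `φ⁻¹` -/
def phiInv : H ⊗[k] (H ⊗[k] H) := ↑Q.reassoc⁻¹

/-- the antipode as a linear map -/
def S : H →ₗ[k] H := Q.antipode.toLinearMap

/-- the inverse of the antipode as a linear map -/
def Sinv : H →ₗ[k] H := Q.antipode.symm.toLinearMap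

/-- the coproduct as a linear map -/
def Delta : H →ₗ[k] H ⊗[k] H := Q.comul.toLinearMap

/-- the flip `x ↦ x²¹` of `H ⊗ H` -/
def flip (x : H ⊗[k] H) : H ⊗[k] H := TensorProduct.comm k H H x

/-- `q_R = X ⊗ S⁻¹(α Z) Y` -/
def qR : H ⊗[k] H :=
  TensorProduct.map LinearMap.id
    (TensorProduct.lift ((LinearMap.mul k H) ∘ₗ Q.Sinv ∘ₗ (LinearMap.mulLeft k Q.alpha)) ∘ₗ
      (TensorProduct.comm k H H).toLinearMap) Q.phi

/-- `p_R = X' ⊗ Y' β S(Z')` -/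
def pR : H ⊗[k] H :=
  TensorProduct.map LinearMap.id (sandwichRight Q.S Q.beta) Q.phiInv

/-- `q_L = S(X') α Y' ⊗ Z'` -/
def qL : H ⊗[k] H :=
  TensorProduct.map (sandwichLeft Q.S Q.alpha) LinearMap.id
    ((TensorProduct.assoc k H H H).symm Q.phiInv)

/-- `p_L = Y S⁻¹(X β) ⊗ Z` -/
def pL : H ⊗[k] H :=
  TensorProduct.map
    (TensorProduct.lift ((LinearMap.mul k H).flip ∘ₗ Q.Sinv ∘ₗ (LinearMap.mulRight k Q.beta)))
    LinearMap.id ((TensorProduct.assoc k H H H).symm Q.phi)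

/-- `γ = S(U) α V ⊗ S(T) α W`, where `T ⊗ U ⊗ V ⊗ W = (1 ⊗ φ⁻¹) (id ⊗ id ⊗ Δ)(φ)` -/
def gamma : H ⊗[k] H :=
  TensorProduct.map LinearMap.id (sandwichLeft Q.S Q.alpha)
    (TensorProduct.leftComm k H H H
      (TensorProduct.map LinearMap.id
        (TensorProduct.map (sandwichLeft Q.S Q.alpha) LinearMap.id ∘ₗ
          (TensorProduct.assoc k H H H).symm.toLinearMap)
        (((1 : H) ⊗ₜ[k] Q.phiInv) *
          TensorProduct.map LinearMap.id (TensorProduct.map LinearMap.id Q.Delta) Q.phi)))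

/-- Drinfeld's twist `f = (S ⊗ S)(Δᵒᵖ(X')) γ Δ(Y' β S(Z'))` -/
def twist : H ⊗[k] H :=
  TensorProduct.lift
    ((LinearMap.mul k (H ⊗[k] H)).compl₂ Q.Delta ∘ₗ LinearMap.mulRight k Q.gamma ∘ₗ
      TensorProduct.map Q.S Q.S ∘ₗ (TensorProduct.comm k H H).toLinearMap ∘ₗ Q.Delta)
    Q.pR

/-- `h = (S⁻¹ ⊗ S⁻¹)(f²¹)` -/
def twistH : H ⊗[k] H := TensorProduct.map Q.Sinv Q.Sinv (flip Q.twist)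

/-- `U = f⁻¹ (S ⊗ S)(q_R²¹)`; the twist `f` is invertible in `H ⊗ H`. -/
def U : H ⊗[k] H := Ring.inverse Q.twist * TensorProduct.map Q.S Q.S (flip Q.qR)

/-- `V = (S⁻¹ ⊗ S⁻¹)(p_R²¹) h` -/
def V : H ⊗[k] H := TensorProduct.map Q.Sinv Q.Sinv (flip Q.pR) * Q.twistH

section Bimodules

variable {K M : Type*} [AddCommGroup K] [Module k K] [AddCommGroup M] [Module k M]

/-- The bimodule `K^*`: `⟨a · ψ · b, m⟩ = ⟨ψ, S⁻¹(a) · m · S(b)⟩`. -/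
def dualBimodule (B : BimoduleStr k H K) : BimoduleStr k H (Module.Dual k K) where
  left := Module.Dual.transpose (R := k) ∘ₗ B.left ∘ₗ Q.Sinv
  right := Module.Dual.transpose (R := k) ∘ₗ B.right ∘ₗ Q.S
  left_one := by
    intro ψ
    have h : Q.antipode.symm 1 = 1 := by rw [LinearEquiv.symm_apply_eq, Q.antipode_one]
    ext m
    simp [Module.Dual.transpose_apply, Sinv, h, B.left_one]
  left_mul := by
    intro a b ψ
    have h : Q.antipode.symm (a * b) = Q.antipode.symm b * Q.antipode.symm a := by
      rw [LinearEquiv.symm_apply_eq, Q.antipode_mul]; simp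
    ext m
    simp [Module.Dual.transpose_apply, Sinv, h, B.left_mul]
  right_one := by
    intro ψ
    ext m
    simp [Module.Dual.transpose_apply, S, Q.antipode_one, B.right_one]
  right_mul := by
    intro a b ψ
    ext m
    simp [Module.Dual.transpose_apply, S, Q.antipode_mul, B.right_mul]
  left_right_comm := by
    intro a b ψ
    ext m
    simp [Module.Dual.transpose_apply, S, Sinv, B.left_right_comm]

/-- The deformed left coaction `m ↦ V · Λ(m) · U`. -/
def deformedCoaction (B : BimoduleStr k H K) (Lam : K →ₗ[k] H ⊗[k] K) : K →ₗ[k] H ⊗[k] K :=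
  slotAct (LinearMap.mul k H) B.left Q.V ∘ₗ slotAct (LinearMap.mul k H).flip B.right Q.U ∘ₗ Lam

/-- The right coaction on `K^*` dual to a left coaction `Λ` on `K`: under the identification
`K^* ⊗ H = Hom(K, H)` the element `ρ(ψ)` is `m ↦ (id ⊗ ψ)(V · Λ(m) · U)`. -/
def dualCoaction [Module.Finite k K] (B : BimoduleStr k H K) (Lam : K →ₗ[k] H ⊗[k] K) :
    Module.Dual k K →ₗ[k] Module.Dual k K ⊗[k] H where
  toFun ψ := (dualTensorHomEquiv k K H).symm
    ((TensorProduct.rid k H).toLinearMap ∘ₗ TensorProduct.map LinearMap.id ψ ∘ₗ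
      Q.deformedCoaction B Lam)
  map_add' ψ χ := by
    rw [← map_add, TensorProduct.map_add_right, LinearMap.add_comp, LinearMap.comp_add]
  map_smul' c ψ := by
    rw [RingHom.id_apply, ← map_smul, TensorProduct.map_smul_right, LinearMap.smul_comp,
      LinearMap.comp_smul]

/-- `E(m) = q_R¹ · m₍₀₎ · β S(q_R² m₍₁₎)` for a bimodule `M` with right coaction `ρ`. -/
def coinvProj (B : BimoduleStr k H M) (ρ : M →ₗ[k] M ⊗[k] H) : M →ₗ[k] M :=
  TensorProduct.lift ((B.right ∘ₗ LinearMap.mulLeft k Q.beta ∘ₗ Q.S).flip) ∘ₗ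
    slotAct B.left (LinearMap.mul k H) Q.qR ∘ₗ ρ

/-- The coinvariants of a bimodule `M` with right coaction `ρ`: the `n` with `E(n) = n`. -/
def coinvariants (B : BimoduleStr k H M) (ρ : M →ₗ[k] M ⊗[k] H) : Submodule k M :=
  LinearMap.eqLocus (Q.coinvProj B ρ) LinearMap.id

/-- `H`-biinvariance of a bilinear form `Σ : K ⊗ M → k`:
`Σ((x ⊗ m) · Δ(a)) = ε(a) Σ(x ⊗ m) = Σ(Δ(a) · (x ⊗ m))`. -/
def IsBiinvariant (BK : BimoduleStr k H K) (BM : BimoduleStr k H M)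
    (Sig : Module.Dual k (K ⊗[k] M)) : Prop :=
  ∀ (a : H) (x : K) (m : M),
    Sig (slotAct BK.right BM.right (Q.comul a) (x ⊗ₜ[k] m)) = Q.counit a * Sig (x ⊗ₜ[k] m) ∧
    Sig (slotAct BK.left BM.left (Q.comul a) (x ⊗ₜ[k] m)) = Q.counit a * Sig (x ⊗ₜ[k] m)

/-- `H`-cocentrality of a bilinear form `Σ : K ⊗ M → k`, for a left coaction `Λ` on `K` and a right
coaction `ρ` on `M`:
`(id ⊗ Σ)(φ · [Λ(x) ⊗ m] · φ⁻¹) = (Σ ⊗ id)(φ⁻¹ · [x ⊗ ρ(m)] · φ)`. -/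
def IsCocentral (BK : BimoduleStr k H K) (Lam : K →ₗ[k] H ⊗[k] K)
    (BM : BimoduleStr k H M) (ρ : M →ₗ[k] M ⊗[k] H)
    (Sig : Module.Dual k (K ⊗[k] M)) : Prop :=
  ∀ (x : K) (m : M),
    TensorProduct.rid k H (TensorProduct.map LinearMap.id Sig
      (slotAct (LinearMap.mul k H) (slotAct BK.left BM.left) Q.phi
        (slotAct (LinearMap.mul k H).flip (slotAct BK.right BM.right) Q.phiInv
          (TensorProduct.assoc k H K M (Lam x ⊗ₜ[k] m))))) =
    TensorProduct.lid k H (TensorProduct.map Sig LinearMap.id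
      ((TensorProduct.assoc k K M H).symm
        (slotAct BK.left (slotAct BM.left (LinearMap.mul k H)) Q.phiInv
          (slotAct BK.right (slotAct BM.right (LinearMap.mul k H).flip) Q.phi
            (x ⊗ₜ[k] ρ m)))))

/-- The space of cocentral biinvariant forms on `K ⊗ M`. -/
def cocentralBiinvariantForms (BK : BimoduleStr k H K) (Lam : K →ₗ[k] H ⊗[k] K)
    (BM : BimoduleStr k H M) (ρ : M →ₗ[k] M ⊗[k] H) :
    Submodule k (Module.Dual k (K ⊗[k] M)) where
  carrier := {Sig | Q.IsBiinvariant BK BM Sig ∧ Q.IsCocentral BK Lam BM ρ Sig}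
  add_mem' := by
    rintro s t ⟨hs, hs'⟩ ⟨ht, ht'⟩
    refine ⟨fun a x m => ⟨?_, ?_⟩, fun x m => ?_⟩
    · rw [LinearMap.add_apply, LinearMap.add_apply, (hs a x m).1, (ht a x m).1, mul_add]
    · rw [LinearMap.add_apply, LinearMap.add_apply, (hs a x m).2, (ht a x m).2, mul_add]
    · rw [TensorProduct.map_add_right, TensorProduct.map_add_left, LinearMap.add_apply,
        LinearMap.add_apply, map_add, map_add, hs' x m, ht' x m]
  zero_mem' := by
    refine ⟨fun a x m => ?_, fun x m => ?_⟩
    · simp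
    · rw [TensorProduct.map_zero_right, TensorProduct.map_zero_left]; simp
  smul_mem' := by
    rintro c s ⟨hs, hs'⟩
    refine ⟨fun a x m => ⟨?_, ?_⟩, fun x m => ?_⟩
    · rw [LinearMap.smul_apply, LinearMap.smul_apply, (hs a x m).1, smul_eq_mul, smul_eq_mul]
      ring
    · rw [LinearMap.smul_apply, LinearMap.smul_apply, (hs a x m).2, smul_eq_mul, smul_eq_mul]
      ring
    · rw [TensorProduct.map_smul_right, TensorProduct.map_smul_left, LinearMap.smul_apply,
        LinearMap.smul_apply, map_smul, map_smul, hs' x m]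

end Bimodules

/-- The space of left cointegrals: the coinvariants of the quasi-Hopf bimodule `H^*` dual to the
left quasi-Hopf bimodule `(H, Δ)`. -/
def leftCointegrals [Module.Finite k H] : Submodule k (Module.Dual k H) :=
  Q.coinvariants (Q.dualBimodule (BimoduleStr.regular k H))
    (Q.dualCoaction (BimoduleStr.regular k H) Q.Delta)

/-- `a ↼ γ = γ(a₍₁₎) a₍₂₎`, for a one-dimensional representation `γ` of `H`. -/
def hit (γ : H →ₐ[k] k) : H →ₐ[k] H :=
  ((Algebra.TensorProduct.lid k H).toAlgHom.comp
    (Algebra.TensorProduct.map γ (AlgHom.id k H))).comp Q.comul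

/-- The bimodule `H_γ`: the space `H` with `a · x · b = (a ↼ γ) x b`. -/
def twistedBimodule (γ : H →ₐ[k] k) : BimoduleStr k H H where
  left := LinearMap.mul k H ∘ₗ (Q.hit γ).toLinearMap
  right := (LinearMap.mul k H).flip
  left_one := by intro m; simp
  left_mul := by intro a b m; simp [mul_assoc]
  right_one := by intro m; simp
  right_mul := by intro a b m; simp [mul_assoc]
  left_right_comm := by intro a b m; simp [mul_assoc]

/-- `T_γ = γ(X') Y' ⊗ Z'` -/
def T (γ : H →ₐ[k] k) : H ⊗[k] H :=
  TensorProduct.lid k (H ⊗[k] H)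
    (TensorProduct.map γ.toLinearMap LinearMap.id Q.phiInv)

/-- The right coaction `ρ_γ(x) = T_γ Δ(x)` on `H_γ`. -/
def twistedCoaction (γ : H →ₐ[k] k) : H →ₗ[k] H ⊗[k] H :=
  LinearMap.mulLeft k (Q.T γ) ∘ₗ Q.Delta

/-- `μ` is a modulus of `H`: some nonzero left integral `l` satisfies `l a = μ(a) l` for all `a`.
For `H` finite dimensional there is exactly one such `μ`, since the left integrals form a
one-dimensional space. -/
def IsModulus (μ : H →ₐ[k] k) : Prop :=
  ∃ l : H, l ≠ 0 ∧ (∀ a, a * l = Q.counit a • l) ∧ ∀ a, l * a = μ a • l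

open Classical in
/-- The modulus of `H` (the counit when there is none, which does not happen for finite dimensional
`H`). -/
def modulus : H →ₐ[k] k :=
  if h : ∃ μ : H →ₐ[k] k, Q.IsModulus μ then h.choose else Q.counit

/-- The cocentral biinvariant forms on `H ⊗ H_μ`, where `μ` is the modulus of `H`. -/
def modularForms : Submodule k (Module.Dual k (H ⊗[k] H)) :=
  Q.cocentralBiinvariantForms (BimoduleStr.regular k H) Q.Delta
    (Q.twistedBimodule Q.modulus) (Q.twistedCoaction Q.modulus)

/-- `p_μ = p¹ ⊗ (p² ↼ μ)`, where `μ` is the modulus of `H`. -/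
def modularTwist (p : H ⊗[k] H) : H ⊗[k] H :=
  TensorProduct.map LinearMap.id (Q.hit Q.modulus).toLinearMap p

end QuasiHopfAlgebra

end

/-!
# Left cointegrals and cocentral biinvariant forms

The dual `H^*`, with the actions and the coaction given by `U` and `V`, is a quasi-Hopf bimodule
(`isHopfBimodule_dual`).  This is a statement about `U` and `V` alone: they intertwine `Δ` with
the antipode in the right way (`explicitU_cov`, `V_cov`), and they are coassociative up to the
reassociator (`explicitU_coassoc`, `V_coassoc`).  To prove it, both are rewritten without the
twist: `U = Δ(q_L¹) p_R (1 ⊗ S(q_L²))` (`U_eq`) and `V = (1 ⊗ S⁻¹(p_L²)) q_R Δ(p_L¹)` (`V_eq`),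
after which every identity is an instance of the pentagon, contracted by the antipode so that some
of its five factors collapse to a counit.

By the structure theorem (`bijective_contract`) a quasi-Hopf bimodule is free over its coinvariants,
so the left cointegrals form a line (`finrank_leftCointegrals`).  On this line `H` acts through a
character, which has to be the modulus `μ`: it is the convolution inverse of `μ ∘ S`, by evaluation
at the left integral dual to a cointegral.  Together with the reconstruction formula
`E(m₀) · m₁ = m` this characterizes left cointegrals by two equations free of the projection `E`
(`mem_leftCointegrals_iff`),

* `c · λ = λ · (c ↼ μ)` for all `c`,
* `ρ(λ) = λ · T_μ¹ ⊗ T_μ²`.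

Under `λ ↦ Σ_λ` the first equation becomes left invariance and the second one cocentrality
(`form_cocentral`), while right invariance is automatic.  In the other direction, modulo
biinvariance every `a ⊗ b` in `H ⊗ H_μ` can be moved into the first factor by means of `p_L` and
`q_L` (`apply_hitSnd_pL_alpha_mul`, `apply_mul_beta_mul_qL`), so `Σ` is the form of
`a ↦ Σ(p_μ (a ⊗ 1) q)`, and cocentrality, evaluated at `p_μ (c ⊗ 1) q`, is the formula for the
coaction (`dualRho_cointegralOf`).  That `λ` is recovered by any of the choices of `p` and `q` only
needs `S(p¹) α p² = 1` and `q¹ β S(q²) = 1`.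

Tensors are contracted by `f ⊛ g : a ⊗ b ↦ f a * g b` and `f ⊚ g : a ⊗ b ↦ g b * f a`; the notation
`f ◂ c` and `c ▸▸ f` inserts a constant.  In the comments `φ = X ⊗ Y ⊗ Z`, `φ⁻¹ = x ⊗ y ⊗ z` and
`Δ(a) = a₁ ⊗ a₂`.
-/

noncomputable section

set_option maxSynthPendingDepth 8

/-! ### Contractions of tensors by products -/

section Chain

variable {k : Type*} [Field k] {M N P A : Type*} [AddCommGroup M] [Module k M]
  [AddCommGroup N] [Module k N] [AddCommGroup P] [Module k P] [Ring A] [Algebra k A]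

/-- The contraction `a ⊗ b ↦ f a * g b`. -/
def chain (f : M →ₗ[k] A) (g : N →ₗ[k] A) : M ⊗[k] N →ₗ[k] A :=
  LinearMap.mul' k A ∘ₗ TensorProduct.map f g

/-- The contraction `a ⊗ b ↦ g b * f a`. -/
def rchain (f : M →ₗ[k] A) (g : N →ₗ[k] A) : M ⊗[k] N →ₗ[k] A :=
  LinearMap.mul' k A ∘ₗ TensorProduct.map g f ∘ₗ (TensorProduct.comm k M N).toLinearMap

infixr:70 " ⊛ " => chain
infixr:70 " ⊚ " => rchain

@[simp] lemma chain_tmul (f : M →ₗ[k] A) (g : N →ₗ[k] A) (a : M) (b : N) :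
    (f ⊛ g) (a ⊗ₜ[k] b) = f a * g b := by simp [chain]

@[simp] lemma rchain_tmul (f : M →ₗ[k] A) (g : N →ₗ[k] A) (a : M) (b : N) :
    (f ⊚ g) (a ⊗ₜ[k] b) = g b * f a := by simp [rchain]

lemma chain_assoc (f : M →ₗ[k] A) (g : N →ₗ[k] A) (h : P →ₗ[k] A) (d : M ⊗[k] N) (c : P) :
    (f ⊛ g ⊛ h) (TensorProduct.assoc k M N P (d ⊗ₜ[k] c)) = (f ⊛ g) d * h c := by
  induction d using TensorProduct.induction_on with
  | zero => simp
  | tmul a b => simp [mul_assoc]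
  | add x y hx hy => simp only [TensorProduct.add_tmul, map_add, hx, hy, add_mul]

lemma rchain_assoc (f : M →ₗ[k] A) (g : N →ₗ[k] A) (h : P →ₗ[k] A) (d : M ⊗[k] N) (c : P) :
    (f ⊚ g ⊚ h) (TensorProduct.assoc k M N P (d ⊗ₜ[k] c)) = h c * (f ⊚ g) d := by
  induction d using TensorProduct.induction_on with
  | zero => simp
  | tmul a b => simp [mul_assoc]
  | add x y hx hy => simp only [TensorProduct.add_tmul, map_add, hx, hy, mul_add]

lemma tensor3_induction {p : M ⊗[k] (N ⊗[k] P) → Prop}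
    (tmul : ∀ a b c, p (a ⊗ₜ[k] (b ⊗ₜ[k] c))) (add : ∀ x y, p x → p y → p (x + y)) (x) : p x := by
  induction x using TensorProduct.induction_on with
  | zero => simpa using tmul 0 0 0
  | add x y hx hy => exact add x y hx hy
  | tmul a s =>
    induction s using TensorProduct.induction_on with
    | zero => simpa using tmul 0 0 0
    | tmul b c => exact tmul a b c
    | add x y hx hy => rw [TensorProduct.tmul_add]; exact add _ _ hx hy

lemma tensor4_induction {R : Type*} [AddCommGroup R] [Module k R]
    {p : M ⊗[k] (N ⊗[k] (P ⊗[k] R)) → Prop}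
    (tmul : ∀ a b c d, p (a ⊗ₜ[k] (b ⊗ₜ[k] (c ⊗ₜ[k] d))))
    (add : ∀ x y, p x → p y → p (x + y)) (x) : p x := by
  induction x using TensorProduct.induction_on with
  | zero => simpa using tmul 0 0 0 0
  | add x y hx hy => exact add x y hx hy
  | tmul a s =>
    induction s using tensor3_induction with
    | tmul b c d => exact tmul a b c d
    | add x y hx hy => rw [TensorProduct.tmul_add]; exact add _ _ hx hy

lemma assoc_mul {A B C : Type*} [Ring A] [Algebra k A] [Ring B] [Algebra k B] [Ring C] [Algebra k C]
    (x y : (A ⊗[k] B) ⊗[k] C) :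
    TensorProduct.assoc k A B C (x * y) =
      TensorProduct.assoc k A B C x * TensorProduct.assoc k A B C y :=
  map_mul (Algebra.TensorProduct.assoc k k k A B C) x y

end Chain

namespace QuasiHopfAlgebra

variable {k H : Type*} [Field k] [Ring H] [Algebra k H] (Q : QuasiHopfAlgebra k H)

/-! ### The pentagon and its rearrangements -/

/-- `Δ ⊗ id` on `H ⊗ H`. -/
def comulFst : H ⊗[k] H →ₐ[k] H ⊗[k] (H ⊗[k] H) :=
  (Algebra.TensorProduct.assoc k k k H H H).toAlgHom.comp
    (Algebra.TensorProduct.map Q.comul (AlgHom.id k H))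

/-- `id ⊗ Δ` on `H ⊗ H`. -/
def comulSnd : H ⊗[k] H →ₐ[k] H ⊗[k] (H ⊗[k] H) :=
  Algebra.TensorProduct.map (AlgHom.id k H) Q.comul

/-- `Δ ⊗ id ⊗ id`. -/
def d1 : H ⊗[k] (H ⊗[k] H) →ₐ[k] H ⊗[k] (H ⊗[k] (H ⊗[k] H)) :=
  (Algebra.TensorProduct.assoc k k k H H (H ⊗[k] H)).toAlgHom.comp
    (Algebra.TensorProduct.map Q.comul (AlgHom.id k (H ⊗[k] H)))

/-- `id ⊗ Δ ⊗ id`. -/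
def d2 : H ⊗[k] (H ⊗[k] H) →ₐ[k] H ⊗[k] (H ⊗[k] (H ⊗[k] H)) :=
  Algebra.TensorProduct.map (AlgHom.id k H) Q.comulFst

/-- `id ⊗ id ⊗ Δ`. -/
def d3 : H ⊗[k] (H ⊗[k] H) →ₐ[k] H ⊗[k] (H ⊗[k] (H ⊗[k] H)) :=
  Algebra.TensorProduct.map (AlgHom.id k H) Q.comulSnd

variable (k H) in
/-- `x ↦ 1 ⊗ x`. -/
def padLeft : H ⊗[k] (H ⊗[k] H) →ₐ[k] H ⊗[k] (H ⊗[k] (H ⊗[k] H)) :=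
  Algebra.TensorProduct.includeRight

variable (k H) in
/-- `x ↦ x ⊗ 1`. -/
def padRight : H ⊗[k] (H ⊗[k] H) →ₐ[k] H ⊗[k] (H ⊗[k] (H ⊗[k] H)) :=
  Algebra.TensorProduct.map (AlgHom.id k H)
    (Algebra.TensorProduct.map (AlgHom.id k H) Algebra.TensorProduct.includeLeft)

lemma comulFst_tmul (a b : H) :
    Q.comulFst (a ⊗ₜ[k] b) = TensorProduct.assoc k H H H (Q.comul a ⊗ₜ[k] b) := rfl

lemma comulSnd_tmul (a b : H) : Q.comulSnd (a ⊗ₜ[k] b) = a ⊗ₜ[k] Q.comul b := rfl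

lemma d1_tmul (a : H) (t : H ⊗[k] H) :
    Q.d1 (a ⊗ₜ[k] t) = TensorProduct.assoc k H H (H ⊗[k] H) (Q.comul a ⊗ₜ[k] t) := rfl

lemma d2_tmul (a : H) (t : H ⊗[k] H) : Q.d2 (a ⊗ₜ[k] t) = a ⊗ₜ[k] Q.comulFst t := rfl

lemma d3_tmul (a : H) (t : H ⊗[k] H) : Q.d3 (a ⊗ₜ[k] t) = a ⊗ₜ[k] Q.comulSnd t := rfl

@[simp] lemma padLeft_apply (x : H ⊗[k] (H ⊗[k] H)) : padLeft k H x = 1 ⊗ₜ[k] x := rfl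

@[simp] lemma padRight_tmul (a b c : H) :
    padRight k H (a ⊗ₜ[k] (b ⊗ₜ[k] c)) = a ⊗ₜ[k] (b ⊗ₜ[k] (c ⊗ₜ[k] 1)) := rfl

lemma phi_mul_phiInv : Q.phi * Q.phiInv = 1 := Q.reassoc.mul_inv

lemma phiInv_mul_phi : Q.phiInv * Q.phi = 1 := Q.reassoc.inv_mul

lemma comulSnd_comul (a : H) :
    Q.comulSnd (Q.comul a) * Q.phi = Q.phi * Q.comulFst (Q.comul a) := Q.quasi_coassoc a

lemma phiInv_mul_comulSnd (a : H) :
    Q.phiInv * Q.comulSnd (Q.comul a) = Q.comulFst (Q.comul a) * Q.phiInv := by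
  have h := congrArg (fun z => Q.phiInv * z * Q.phiInv) (Q.comulSnd_comul a)
  simpa only [mul_assoc, phi_mul_phiInv, mul_one, ← mul_assoc Q.phiInv Q.phi,
    phiInv_mul_phi, one_mul] using h

/-- The pentagon, with the threefold coproducts and the inclusions as algebra maps. -/
lemma pentagon' : Q.d3 Q.phi * Q.d1 Q.phi =
    padLeft k H Q.phi * Q.d2 Q.phi * padRight k H Q.phi := by
  have h2 : ∀ x : H ⊗[k] (H ⊗[k] H),
      TensorProduct.map LinearMap.id (TensorProduct.assoc k H H H).toLinearMap
        (TensorProduct.map LinearMap.id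
          (TensorProduct.map Q.comul.toLinearMap LinearMap.id) x) = Q.d2 x := by
    intro x
    induction x using tensor3_induction with
    | tmul a b c => rfl
    | add x y hx hy => simp only [map_add, hx, hy]
  have hr : ∀ x : H ⊗[k] (H ⊗[k] H),
      TensorProduct.map LinearMap.id (TensorProduct.assoc k H H H).toLinearMap
        (TensorProduct.assoc k H (H ⊗[k] H) H (x ⊗ₜ[k] (1 : H))) = padRight k H x := by
    intro x
    induction x using tensor3_induction with
    | tmul a b c => rfl
    | add x y hx hy => simp only [map_add, TensorProduct.add_tmul, hx, hy]
  have h := Q.pentagon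
  rw [h2, hr] at h
  exact h

/-- The rearrangements of a pentagon, for five algebra maps applied to `φ` and `φ⁻¹`. -/
lemma units_pentagon (F : Fin 5 → (H ⊗[k] (H ⊗[k] H)) →ₐ[k] H ⊗[k] (H ⊗[k] (H ⊗[k] H)))
    (h : F 0 Q.phi * F 1 Q.phi = F 2 Q.phi * F 3 Q.phi * F 4 Q.phi) :
    F 2 Q.phiInv * F 0 Q.phi = F 3 Q.phi * F 4 Q.phi * F 1 Q.phiInv ∧
    F 1 Q.phi * F 4 Q.phiInv = F 0 Q.phiInv * F 2 Q.phi * F 3 Q.phi ∧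
    F 4 Q.phi * F 1 Q.phiInv = F 3 Q.phiInv * F 2 Q.phiInv * F 0 Q.phi ∧
    F 4 Q.phiInv * F 3 Q.phiInv * F 2 Q.phiInv = F 1 Q.phiInv * F 0 Q.phiInv ∧
    F 0 Q.phiInv * F 2 Q.phi = F 1 Q.phi * F 4 Q.phiInv * F 3 Q.phiInv := by
  let u : Fin 5 → (H ⊗[k] (H ⊗[k] (H ⊗[k] H)))ˣ := fun i => Units.map (F i).toMonoidHom Q.reassoc
  have hu : u 0 * u 1 = u 2 * u 3 * u 4 := Units.ext h
  have e1 : (u 2)⁻¹ * u 0 = u 3 * u 4 * (u 1)⁻¹ := by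
    rw [inv_mul_eq_iff_eq_mul, eq_comm, ← mul_assoc, mul_inv_eq_iff_eq_mul, hu, mul_assoc]
  have e2 : u 1 * (u 4)⁻¹ = (u 0)⁻¹ * u 2 * u 3 := by
    rw [mul_inv_eq_iff_eq_mul, mul_assoc, mul_assoc, eq_inv_mul_iff_mul_eq, hu, mul_assoc]
  have e3 : u 4 * (u 1)⁻¹ = (u 3)⁻¹ * (u 2)⁻¹ * u 0 := by
    rw [mul_inv_eq_iff_eq_mul, mul_assoc, mul_assoc, hu]; group
  have e4 : (u 4)⁻¹ * (u 3)⁻¹ * (u 2)⁻¹ = (u 1)⁻¹ * (u 0)⁻¹ := by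
    rw [← mul_inv_rev (u 0), hu]; group
  have e5 : (u 0)⁻¹ * u 2 = u 1 * (u 4)⁻¹ * (u 3)⁻¹ := by
    rw [e2]; group
  exact ⟨congrArg Units.val e1, congrArg Units.val e2, congrArg Units.val e3,
    congrArg Units.val e4, congrArg Units.val e5⟩

lemma padLeft_inv_mul_d3 : padLeft k H Q.phiInv * Q.d3 Q.phi =
    Q.d2 Q.phi * padRight k H Q.phi * Q.d1 Q.phiInv :=
  (Q.units_pentagon ![Q.d3, Q.d1, padLeft k H, Q.d2, padRight k H] Q.pentagon').1

lemma d1_mul_padRight_inv : Q.d1 Q.phi * padRight k H Q.phiInv =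
    Q.d3 Q.phiInv * padLeft k H Q.phi * Q.d2 Q.phi :=
  (Q.units_pentagon ![Q.d3, Q.d1, padLeft k H, Q.d2, padRight k H] Q.pentagon').2.1

lemma padRight_mul_d1_inv : padRight k H Q.phi * Q.d1 Q.phiInv =
    Q.d2 Q.phiInv * padLeft k H Q.phiInv * Q.d3 Q.phi :=
  (Q.units_pentagon ![Q.d3, Q.d1, padLeft k H, Q.d2, padRight k H] Q.pentagon').2.2.1

lemma padRight_inv_mul_d2_inv : padRight k H Q.phiInv * Q.d2 Q.phiInv * padLeft k H Q.phiInv =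
    Q.d1 Q.phiInv * Q.d3 Q.phiInv :=
  (Q.units_pentagon ![Q.d3, Q.d1, padLeft k H, Q.d2, padRight k H] Q.pentagon').2.2.2.1

lemma d3_inv_mul_padLeft : Q.d3 Q.phiInv * padLeft k H Q.phi =
    Q.d1 Q.phi * padRight k H Q.phiInv * Q.d2 Q.phiInv :=
  (Q.units_pentagon ![Q.d3, Q.d1, padLeft k H, Q.d2, padRight k H] Q.pentagon').2.2.2.2

/-! ### Counits on the legs of the reassociator -/

/-- `ε ⊗ id`. -/
def counitFst (A : Type*) [Ring A] [Algebra k A] : H ⊗[k] A →ₐ[k] A :=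
  (Algebra.TensorProduct.lid k A).toAlgHom.comp
    (Algebra.TensorProduct.map Q.counit (AlgHom.id k A))

/-- `id ⊗ ε`. -/
def counitSnd : H ⊗[k] H →ₐ[k] H :=
  (Algebra.TensorProduct.rid k k H).toAlgHom.comp
    (Algebra.TensorProduct.map (AlgHom.id k H) Q.counit)

@[simp] lemma counitFst_tmul {A : Type*} [Ring A] [Algebra k A] (a : H) (b : A) :
    Q.counitFst A (a ⊗ₜ[k] b) = Q.counit a • b := by simp [counitFst]

@[simp] lemma counitSnd_tmul (a b : H) : Q.counitSnd (a ⊗ₜ[k] b) = Q.counit b • a := by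
  simp [counitSnd]

@[simp] lemma counitFst_comul (a : H) : Q.counitFst H (Q.comul a) = a := Q.counit_left a

@[simp] lemma counitSnd_comul (a : H) : Q.counitSnd (Q.comul a) = a := Q.counit_right a

/-- `ε ⊗ id ⊗ id`. -/
def e1 : H ⊗[k] (H ⊗[k] H) →ₐ[k] H ⊗[k] H := Q.counitFst (H ⊗[k] H)

/-- `id ⊗ ε ⊗ id`. -/
def e2 : H ⊗[k] (H ⊗[k] H) →ₐ[k] H ⊗[k] H :=
  Algebra.TensorProduct.map (AlgHom.id k H) (Q.counitFst H)

/-- `id ⊗ id ⊗ ε`. -/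
def e3 : H ⊗[k] (H ⊗[k] H) →ₐ[k] H ⊗[k] H :=
  Algebra.TensorProduct.map (AlgHom.id k H) Q.counitSnd

@[simp] lemma e1_tmul (a : H) (t : H ⊗[k] H) : Q.e1 (a ⊗ₜ[k] t) = Q.counit a • t := by simp [e1]

@[simp] lemma e2_tmul (a : H) (t : H ⊗[k] H) : Q.e2 (a ⊗ₜ[k] t) = a ⊗ₜ[k] Q.counitFst H t := rfl

@[simp] lemma e3_tmul (a : H) (t : H ⊗[k] H) : Q.e3 (a ⊗ₜ[k] t) = a ⊗ₜ[k] Q.counitSnd t := rfl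

lemma e2_phi : Q.e2 Q.phi = 1 := Q.counit_middle

lemma map_phiInv_eq_one {A : Type*} [Ring A] [Algebra k A] (F : H ⊗[k] (H ⊗[k] H) →ₐ[k] A)
    (h : F Q.phi = 1) : F Q.phiInv = 1 := by
  have := congrArg F Q.phi_mul_phiInv
  rwa [map_mul, h, one_mul, map_one] at this

lemma e1_phi : Q.e1 Q.phi = 1 := by
  -- Apply `ε` to the second leg of the pentagon.
  let F : H ⊗[k] (H ⊗[k] (H ⊗[k] H)) →ₐ[k] H ⊗[k] (H ⊗[k] H) :=
    Algebra.TensorProduct.map (AlgHom.id k H) (Q.counitFst (H ⊗[k] H))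
  have h3 : ∀ x, F (Q.d3 x) = Q.comulSnd (Q.e2 x) := by
    intro x
    induction x using tensor3_induction with
    | tmul a b c => simp [F, d3_tmul, comulSnd_tmul]
    | add x y hx hy => simp only [map_add, hx, hy]
  have h1 : ∀ x, F (Q.d1 x) = x := by
    have : ∀ (d : H ⊗[k] H) (t : H ⊗[k] H),
        F (TensorProduct.assoc k H H (H ⊗[k] H) (d ⊗ₜ[k] t)) = Q.counitSnd d ⊗ₜ[k] t := by
      intro d t
      induction d using TensorProduct.induction_on with
      | zero => simp
      | tmul a b => simp [F, TensorProduct.smul_tmul]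
      | add x y hx hy => simp only [TensorProduct.add_tmul, map_add, hx, hy]
    intro x
    induction x using TensorProduct.induction_on with
    | zero => simp
    | tmul a t => rw [d1_tmul, this, counitSnd_comul]
    | add x y hx hy => simp only [map_add, hx, hy]
  have h2 : ∀ x, F (Q.d2 x) = x := by
    have : ∀ (d : H ⊗[k] H) (t : H),
        Q.counitFst (H ⊗[k] H) (TensorProduct.assoc k H H H (d ⊗ₜ[k] t)) =
          Q.counitFst H d ⊗ₜ[k] t := by
      intro d t
      induction d using TensorProduct.induction_on with
      | zero => simp
      | tmul a b => simp [TensorProduct.smul_tmul']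
      | add x y hx hy => simp only [TensorProduct.add_tmul, map_add, hx, hy]
    intro x
    induction x using tensor3_induction with
    | tmul a b c => simp [F, d2_tmul, comulFst_tmul, this]
    | add x y hx hy => simp only [map_add, hx, hy]
  have hr : ∀ x, F (padRight k H x) =
      Algebra.TensorProduct.map (AlgHom.id k H) Algebra.TensorProduct.includeLeft (Q.e2 x) := by
    intro x
    induction x using tensor3_induction with
    | tmul a b c => simp [F]
    | add x y hx hy => simp only [map_add, hx, hy]
  have h := congrArg F Q.pentagon'
  simp only [map_mul, h3, h1, h2, hr, e2_phi, map_one, one_mul, mul_one] at h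
  have h' := congrArg (fun z => Q.counitFst (H ⊗[k] H) (z * Q.phiInv)) h
  simp only [mul_assoc, phi_mul_phiInv, mul_one, map_one] at h'
  simpa [F, e1] using h'.symm

lemma e3_phi : Q.e3 Q.phi = 1 := by
  -- Apply `ε` to the third leg of the pentagon.
  let F : H ⊗[k] (H ⊗[k] (H ⊗[k] H)) →ₐ[k] H ⊗[k] (H ⊗[k] H) :=
    Algebra.TensorProduct.map (AlgHom.id k H)
      (Algebra.TensorProduct.map (AlgHom.id k H) (Q.counitFst H))
  have h3 : ∀ x, F (Q.d3 x) = x := by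
    intro x
    induction x using tensor3_induction with
    | tmul a b c => simp [F, d3_tmul, comulSnd_tmul]
    | add x y hx hy => simp only [map_add, hx, hy]
  have h1 : ∀ x, F (Q.d1 x) = Q.comulFst (Q.e2 x) := by
    have : ∀ (d : H ⊗[k] H) (b c : H),
        F (TensorProduct.assoc k H H (H ⊗[k] H) (d ⊗ₜ[k] (b ⊗ₜ[k] c))) =
          TensorProduct.assoc k H H H (d ⊗ₜ[k] (Q.counit b • c)) := by
      intro d b c
      induction d using TensorProduct.induction_on with
      | zero => simp
      | tmul a b => simp [F]
      | add x y hx hy => simp only [TensorProduct.add_tmul, map_add, hx, hy]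
    intro x
    induction x using tensor3_induction with
    | tmul a b c => simp only [d1_tmul, this, e2_tmul, counitFst_tmul, comulFst_tmul]
    | add x y hx hy => simp only [map_add, hx, hy]
  have h2 : ∀ x, F (Q.d2 x) = x := by
    have : ∀ (d : H ⊗[k] H) (t : H),
        Algebra.TensorProduct.map (AlgHom.id k H) (Q.counitFst H)
          (TensorProduct.assoc k H H H (d ⊗ₜ[k] t)) = Q.counitSnd d ⊗ₜ[k] t := by
      intro d t
      induction d using TensorProduct.induction_on with
      | zero => simp
      | tmul a b => simp [TensorProduct.smul_tmul]
      | add x y hx hy => simp only [TensorProduct.add_tmul, map_add, hx, hy]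
    intro x
    induction x using tensor3_induction with
    | tmul a b c => simp [F, d2_tmul, comulFst_tmul, this]
    | add x y hx hy => simp only [map_add, hx, hy]
  have hl : ∀ x, F (padLeft k H x) = 1 ⊗ₜ[k] Q.e2 x := by intro x; simp [F, e2]
  have hr : ∀ x, F (padRight k H x) =
      Algebra.TensorProduct.map (AlgHom.id k H) Algebra.TensorProduct.includeLeft (Q.e3 x) := by
    intro x
    induction x using tensor3_induction with
    | tmul a b c => simp [F]
    | add x y hx hy => simp only [map_add, hx, hy]
  have h := congrArg F Q.pentagon'
  simp only [map_mul, h3, h1, h2, hl, hr, e2_phi, map_one, mul_one] at h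
  have h' := congrArg (fun z => Algebra.TensorProduct.map (AlgHom.id k H)
    Q.counitSnd (Q.phiInv * z)) h
  rw [← Algebra.TensorProduct.one_def, one_mul] at h'
  simp only [← mul_assoc, phiInv_mul_phi, one_mul, map_one] at h'
  have hi : ∀ z : H ⊗[k] H, Algebra.TensorProduct.map (AlgHom.id k H) Q.counitSnd
      (Algebra.TensorProduct.map (AlgHom.id k H) Algebra.TensorProduct.includeLeft z) = z := by
    intro z
    induction z using TensorProduct.induction_on with
    | zero => simp
    | tmul a b => simp
    | add x y hx hy => simp only [map_add, hx, hy]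
  rw [hi] at h'
  exact h'.symm

lemma e1_phiInv : Q.e1 Q.phiInv = 1 := Q.map_phiInv_eq_one Q.e1 Q.e1_phi

lemma e2_phiInv : Q.e2 Q.phiInv = 1 := Q.map_phiInv_eq_one Q.e2 Q.e2_phi

lemma e3_phiInv : Q.e3 Q.phiInv = 1 := Q.map_phiInv_eq_one Q.e3 Q.e3_phi

end QuasiHopfAlgebra

/-! ### Scaled maps and the two tensor factors -/

section Scale
variable {k : Type*} [Field k] {M A : Type*} [AddCommGroup M] [Module k M] [Ring A] [Algebra k A]

/-- `x ↦ f x * c`. -/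
def rmul (f : M →ₗ[k] A) (c : A) : M →ₗ[k] A := LinearMap.mulRight k c ∘ₗ f

/-- `x ↦ c * f x`. -/
def lmul (c : A) (f : M →ₗ[k] A) : M →ₗ[k] A := LinearMap.mulLeft k c ∘ₗ f

infixl:75 " ◂ " => rmul
infixr:75 " ▸▸ " => lmul

@[simp] lemma rmul_apply (f : M →ₗ[k] A) (c : A) (x : M) : (f ◂ c) x = f x * c := rfl

@[simp] lemma lmul_apply (f : M →ₗ[k] A) (c : A) (x : M) : (c ▸▸ f) x = c * f x := rfl

variable (k) in
/-- `a ↦ a ⊗ 1`. -/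
def inl (A B : Type*) [Ring A] [Algebra k A] [Ring B] [Algebra k B] : A →ₗ[k] A ⊗[k] B :=
  (Algebra.TensorProduct.includeLeft : A →ₐ[k] A ⊗[k] B).toLinearMap

variable (k) in
/-- `b ↦ 1 ⊗ b`. -/
def inr (A B : Type*) [Ring A] [Algebra k A] [Ring B] [Algebra k B] : B →ₗ[k] A ⊗[k] B :=
  (Algebra.TensorProduct.includeRight : B →ₐ[k] A ⊗[k] B).toLinearMap

@[simp] lemma inl_apply {A B : Type*} [Ring A] [Algebra k A] [Ring B] [Algebra k B] (a : A) :
    inl k A B a = a ⊗ₜ[k] 1 := rfl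

@[simp] lemma inr_apply {A B : Type*} [Ring A] [Algebra k A] [Ring B] [Algebra k B] (b : B) :
    inr k A B b = 1 ⊗ₜ[k] b := rfl

end Scale

namespace QuasiHopfAlgebra

variable {k H : Type*} [Field k] [Ring H] [Algebra k H] (Q : QuasiHopfAlgebra k H)

/-! ### The antipode -/

@[simp] lemma Delta_apply (a : H) : Q.Delta a = Q.comul a := rfl

@[simp] lemma S_mul (a b : H) : Q.S (a * b) = Q.S b * Q.S a := Q.antipode_mul a b

@[simp] lemma S_one : Q.S 1 = 1 := Q.antipode_one

@[simp] lemma S_Sinv (a : H) : Q.S (Q.Sinv a) = a := Q.antipode.apply_symm_apply a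

@[simp] lemma Sinv_S (a : H) : Q.Sinv (Q.S a) = a := Q.antipode.symm_apply_apply a

lemma S_injective : Function.Injective Q.S := Q.antipode.injective

@[simp] lemma Sinv_one : Q.Sinv 1 = 1 := Q.S_injective (by simp)

@[simp] lemma Sinv_mul (a b : H) : Q.Sinv (a * b) = Q.Sinv b * Q.Sinv a :=
  Q.S_injective (by simp)

@[simp] lemma sandwichLeft_tmul (S : H →ₗ[k] H) (c a b : H) :
    sandwichLeft S c (a ⊗ₜ[k] b) = S a * c * b := by simp [sandwichLeft]

@[simp] lemma sandwichRight_tmul (S : H →ₗ[k] H) (c a b : H) :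
    sandwichRight S c (a ⊗ₜ[k] b) = a * c * S b := by simp [sandwichRight]

lemma sandwichLeft_comul (a : H) :
    sandwichLeft Q.S Q.alpha (Q.comul a) = Q.counit a • Q.alpha := Q.antipode_left a

lemma sandwichRight_comul (a : H) :
    sandwichRight Q.S Q.beta (Q.comul a) = Q.counit a • Q.beta := Q.antipode_right a

/-- The contraction `x ⊗ y ⊗ z ↦ x β S(y) α z`. -/
def zigzag : H ⊗[k] (H ⊗[k] H) →ₗ[k] H :=
  (LinearMap.id ◂ Q.beta) ⊛ (Q.S ◂ Q.alpha) ⊛ LinearMap.id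

/-- The contraction `x ⊗ y ⊗ z ↦ S(x) α y β S(z)`. -/
def zigzag' : H ⊗[k] (H ⊗[k] H) →ₗ[k] H :=
  (Q.S ◂ Q.alpha) ⊛ (LinearMap.id ◂ Q.beta) ⊛ Q.S

@[simp] lemma zigzag_tmul (a b c : H) :
    Q.zigzag (a ⊗ₜ[k] (b ⊗ₜ[k] c)) = a * Q.beta * (Q.S b * Q.alpha * c) := by simp [zigzag]

@[simp] lemma zigzag'_tmul (a b c : H) :
    Q.zigzag' (a ⊗ₜ[k] (b ⊗ₜ[k] c)) = Q.S a * Q.alpha * (b * Q.beta * Q.S c) := by simp [zigzag']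

lemma zigzag_phi : Q.zigzag Q.phi = 1 := by
  rw [← Q.reassoc_antipode]
  change _ = TensorProduct.lift _ (TensorProduct.map _ (sandwichLeft Q.S Q.alpha) Q.phi)
  generalize Q.phi = x
  induction x using tensor3_induction with
  | tmul a b c => simp
  | add x y hx hy => simp only [map_add, hx, hy]

lemma zigzag'_phiInv : Q.zigzag' Q.phiInv = 1 := by
  rw [← Q.reassoc_inv_antipode]
  change _ = sandwichLeft Q.S Q.alpha
    (TensorProduct.map _ (sandwichRight Q.S Q.beta) Q.phiInv)
  generalize Q.phiInv = x
  induction x using tensor3_induction with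
  | tmul a b c => simp
  | add x y hx hy => simp only [map_add, hx, hy]

/-- A character to a commutative ring takes invertible values on `α` and `β`, because it takes the
value `1` on `X β S(Y) α Z`. -/
lemma exists_mul_alpha_mul_beta {R : Type*} [CommRing R] [Algebra k R] (χ : H →ₐ[k] R) :
    ∃ c, c * (χ Q.alpha * χ Q.beta) = 1 := by
  have h : ∀ x, ∃ c, χ (Q.zigzag x) = c * (χ Q.alpha * χ Q.beta) := by
    intro x
    induction x using tensor3_induction with
    | tmul a b c => exact ⟨χ a * χ (Q.S b) * χ c, by simp only [zigzag_tmul, map_mul]; ring⟩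
    | add x y hx hy =>
      obtain ⟨c, hc⟩ := hx
      obtain ⟨d, hd⟩ := hy
      exact ⟨c + d, by rw [map_add, map_add, hc, hd, add_mul]⟩
  obtain ⟨c, hc⟩ := h Q.phi
  exact ⟨c, by rw [← hc, zigzag_phi, map_one]⟩

lemma map_alpha_ne_zero (χ : H →ₐ[k] k) : χ Q.alpha ≠ 0 := by
  obtain ⟨c, hc⟩ := Q.exists_mul_alpha_mul_beta χ
  rintro h
  simp [h] at hc

@[simp] lemma counit_S (a : H) : Q.counit (Q.S a) = Q.counit a := by
  have h : ∀ d : H ⊗[k] H, Q.counit (sandwichLeft Q.S Q.alpha d) =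
      Q.counit Q.alpha * Q.counit (Q.S (Q.counitSnd d)) := by
    intro d
    induction d using TensorProduct.induction_on with
    | zero => simp
    | tmul a b => simp; ring
    | add x y hx hy => simp only [map_add, hx, hy, mul_add]
  have h' := h (Q.comul a)
  rw [sandwichLeft_comul, counitSnd_comul, map_smul, smul_eq_mul, mul_comm] at h'
  exact (mul_left_cancel₀ (Q.map_alpha_ne_zero Q.counit) h').symm

@[simp] lemma counit_Sinv (a : H) : Q.counit (Q.Sinv a) = Q.counit a := by
  rw [← counit_S, S_Sinv]

lemma counit_alpha_mul_beta : Q.counit Q.alpha * Q.counit Q.beta = 1 := by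
  have h : ∀ x, Q.counit (Q.zigzag x) =
      Q.counit Q.alpha * Q.counit Q.beta * Q.counit (Q.counitFst H (Q.e1 x)) := by
    intro x
    induction x using tensor3_induction with
    | tmul a b c => simp; ring
    | add x y hx hy => simp only [map_add, hx, hy, mul_add]
  have := h Q.phi
  rw [zigzag_phi, e1_phi] at this
  simpa using this.symm

/-! ### Collapsing coproducts inside contractions -/

section Collapse

variable {A : Type*} [Ring A] [Algebra k A]

/-- The contraction `B` collapses coproducts on the left: `B(Δ(a) t) = ε(a) B(t)`. -/
def LeftInv (B : H ⊗[k] H →ₗ[k] A) : Prop :=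
  ∀ a t, B (Q.comul a * t) = Q.counit a • B t

/-- The contraction `B` collapses coproducts on the right: `B(t Δ(a)) = ε(a) B(t)`. -/
def RightInv (B : H ⊗[k] H →ₗ[k] A) : Prop :=
  ∀ a t, B (t * Q.comul a) = Q.counit a • B t

variable {Q}

/-- If the contraction of the first two legs in `M` collapses coproducts on the left, then `M` does
not see a factor `(Δ ⊗ id ⊗ id)(x)` on the left when `(ε ⊗ id ⊗ id)(x) = 1`. For `x = φ` or
`x = φ⁻¹` this removes a factor from a pentagon. -/
lemma LeftInv.d1 {M : H ⊗[k] (H ⊗[k] (H ⊗[k] H)) →ₗ[k] A}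
    (h : ∀ s, Q.LeftInv (M ∘ₗ (TensorProduct.assoc k H H (H ⊗[k] H)).toLinearMap ∘ₗ
      (TensorProduct.mk k _ _).flip s)) {x} (hx : Q.e1 x = 1) (t) : M (Q.d1 x * t) = M t := by
  have key : ∀ x t, M (Q.d1 x * t) = M ((1 ⊗ₜ (1 ⊗ₜ Q.e1 x)) * t) := by
    intro x t
    induction x using TensorProduct.induction_on with
    | zero => simp
    | add x y hx hy => simp only [map_add, add_mul, TensorProduct.tmul_add, hx, hy]
    | tmul a u =>
      induction t using tensor4_induction with
      | add x y hx hy => simp only [map_add, mul_add, hx, hy]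
      | tmul t1 t2 t3 t4 =>
        have := h (u * t3 ⊗ₜ[k] t4) a (t1 ⊗ₜ t2)
        simp only [LinearMap.comp_apply, LinearMap.flip_apply, TensorProduct.mk_apply,
          LinearEquiv.coe_coe, TensorProduct.assoc_tmul] at this
        rw [d1_tmul, ← TensorProduct.assoc_tmul, ← assoc_mul,
          Algebra.TensorProduct.tmul_mul_tmul, this]
        simp
  rw [key, hx, ← Algebra.TensorProduct.one_def, ← Algebra.TensorProduct.one_def, one_mul]

lemma RightInv.d1 {M : H ⊗[k] (H ⊗[k] (H ⊗[k] H)) →ₗ[k] A}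
    (h : ∀ s, Q.RightInv (M ∘ₗ (TensorProduct.assoc k H H (H ⊗[k] H)).toLinearMap ∘ₗ
      (TensorProduct.mk k _ _).flip s)) {x} (hx : Q.e1 x = 1) (t) : M (t * Q.d1 x) = M t := by
  have key : ∀ x t, M (t * Q.d1 x) = M (t * (1 ⊗ₜ (1 ⊗ₜ Q.e1 x))) := by
    intro x t
    induction x using TensorProduct.induction_on with
    | zero => simp
    | add x y hx hy => simp only [map_add, mul_add, TensorProduct.tmul_add, hx, hy]
    | tmul a u =>
      induction t using tensor4_induction with
      | add x y hx hy => simp only [map_add, add_mul, hx, hy]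
      | tmul t1 t2 t3 t4 =>
        have := h (t3 ⊗ₜ[k] t4 * u) a (t1 ⊗ₜ t2)
        simp only [LinearMap.comp_apply, LinearMap.flip_apply, TensorProduct.mk_apply,
          LinearEquiv.coe_coe, TensorProduct.assoc_tmul] at this
        rw [d1_tmul, ← TensorProduct.assoc_tmul, ← assoc_mul,
          Algebra.TensorProduct.tmul_mul_tmul, this]
        simp
  rw [key, hx, ← Algebra.TensorProduct.one_def, ← Algebra.TensorProduct.one_def, mul_one]

lemma LeftInv.d2 {M : H ⊗[k] (H ⊗[k] (H ⊗[k] H)) →ₗ[k] A}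
    (h : ∀ r s, Q.LeftInv (M ∘ₗ TensorProduct.mk k _ _ r ∘ₗ
      (TensorProduct.assoc k H H H).toLinearMap ∘ₗ (TensorProduct.mk k _ _).flip s))
    {x} (hx : Q.e2 x = 1) (t) : M (Q.d2 x * t) = M t := by
  have key : ∀ x t, M (Q.d2 x * t) = M (Algebra.TensorProduct.map (AlgHom.id k H)
      (Algebra.TensorProduct.includeRight.comp Algebra.TensorProduct.includeRight) (Q.e2 x) * t) := by
    intro x t
    induction x using tensor3_induction with
    | add x y hx hy => simp only [map_add, add_mul, hx, hy]
    | tmul a b c =>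
      induction t using tensor4_induction with
      | add x y hx hy => simp only [map_add, mul_add, hx, hy]
      | tmul t1 t2 t3 t4 =>
        have := h (a * t1) (c * t4) b (t2 ⊗ₜ t3)
        simp only [LinearMap.comp_apply, LinearMap.flip_apply, TensorProduct.mk_apply,
          LinearEquiv.coe_coe, TensorProduct.assoc_tmul] at this
        rw [d2_tmul, comulFst_tmul, Algebra.TensorProduct.tmul_mul_tmul,
          ← TensorProduct.assoc_tmul, ← assoc_mul, Algebra.TensorProduct.tmul_mul_tmul, this]
        simp
  rw [key, hx, map_one, one_mul]

lemma RightInv.d2 {M : H ⊗[k] (H ⊗[k] (H ⊗[k] H)) →ₗ[k] A}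
    (h : ∀ r s, Q.RightInv (M ∘ₗ TensorProduct.mk k _ _ r ∘ₗ
      (TensorProduct.assoc k H H H).toLinearMap ∘ₗ (TensorProduct.mk k _ _).flip s))
    {x} (hx : Q.e2 x = 1) (t) : M (t * Q.d2 x) = M t := by
  have key : ∀ x t, M (t * Q.d2 x) = M (t * Algebra.TensorProduct.map (AlgHom.id k H)
      (Algebra.TensorProduct.includeRight.comp Algebra.TensorProduct.includeRight) (Q.e2 x)) := by
    intro x t
    induction x using tensor3_induction with
    | add x y hx hy => simp only [map_add, mul_add, hx, hy]
    | tmul a b c =>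
      induction t using tensor4_induction with
      | add x y hx hy => simp only [map_add, add_mul, hx, hy]
      | tmul t1 t2 t3 t4 =>
        have := h (t1 * a) (t4 * c) b (t2 ⊗ₜ t3)
        simp only [LinearMap.comp_apply, LinearMap.flip_apply, TensorProduct.mk_apply,
          LinearEquiv.coe_coe, TensorProduct.assoc_tmul] at this
        rw [d2_tmul, comulFst_tmul, Algebra.TensorProduct.tmul_mul_tmul,
          ← TensorProduct.assoc_tmul, ← assoc_mul, Algebra.TensorProduct.tmul_mul_tmul, this]
        simp
  rw [key, hx, map_one, mul_one]

lemma LeftInv.d3 {M : H ⊗[k] (H ⊗[k] (H ⊗[k] H)) →ₗ[k] A}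
    (h : ∀ r s, Q.LeftInv (M ∘ₗ TensorProduct.mk k _ _ r ∘ₗ TensorProduct.mk k _ _ s))
    {x} (hx : Q.e3 x = 1) (t) : M (Q.d3 x * t) = M t := by
  have key : ∀ x t, M (Q.d3 x * t) = M (Algebra.TensorProduct.map (AlgHom.id k H)
      Algebra.TensorProduct.includeLeft (Q.e3 x) * t) := by
    intro x t
    induction x using tensor3_induction with
    | add x y hx hy => simp only [map_add, add_mul, hx, hy]
    | tmul a b c =>
      induction t using tensor4_induction with
      | add x y hx hy => simp only [map_add, mul_add, hx, hy]
      | tmul t1 t2 t3 t4 =>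
        have := h (a * t1) (b * t2) c (t3 ⊗ₜ t4)
        simp only [LinearMap.comp_apply, TensorProduct.mk_apply] at this
        rw [d3_tmul, comulSnd_tmul, Algebra.TensorProduct.tmul_mul_tmul,
          Algebra.TensorProduct.tmul_mul_tmul, this]
        simp
  rw [key, hx, map_one, one_mul]

lemma RightInv.d3 {M : H ⊗[k] (H ⊗[k] (H ⊗[k] H)) →ₗ[k] A}
    (h : ∀ r s, Q.RightInv (M ∘ₗ TensorProduct.mk k _ _ r ∘ₗ TensorProduct.mk k _ _ s))
    {x} (hx : Q.e3 x = 1) (t) : M (t * Q.d3 x) = M t := by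
  have key : ∀ x t, M (t * Q.d3 x) = M (t * Algebra.TensorProduct.map (AlgHom.id k H)
      Algebra.TensorProduct.includeLeft (Q.e3 x)) := by
    intro x t
    induction x using tensor3_induction with
    | add x y hx hy => simp only [map_add, mul_add, hx, hy]
    | tmul a b c =>
      induction t using tensor4_induction with
      | add x y hx hy => simp only [map_add, add_mul, hx, hy]
      | tmul t1 t2 t3 t4 =>
        have := h (t1 * a) (t2 * b) c (t3 ⊗ₜ t4)
        simp only [LinearMap.comp_apply, TensorProduct.mk_apply] at this
        rw [d3_tmul, comulSnd_tmul, Algebra.TensorProduct.tmul_mul_tmul,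
          Algebra.TensorProduct.tmul_mul_tmul, this]
        simp
  rw [key, hx, map_one, mul_one]

section
variable {f₁ f₂ f₃ f₄ : H →ₗ[k] A} {g : H ⊗[k] H →ₗ[k] A}

lemma LeftInv.chain_d1 (h : Q.LeftInv (f₁ ⊛ f₂)) {x} (hx : Q.e1 x = 1) (t) :
    (f₁ ⊛ f₂ ⊛ g) (Q.d1 x * t) = (f₁ ⊛ f₂ ⊛ g) t :=
  LeftInv.d1 (fun s a t => by simp [chain_assoc, h a t]) hx t

lemma RightInv.chain_d1 (h : Q.RightInv (f₁ ⊛ f₂)) {x} (hx : Q.e1 x = 1) (t) :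
    (f₁ ⊛ f₂ ⊛ g) (t * Q.d1 x) = (f₁ ⊛ f₂ ⊛ g) t :=
  RightInv.d1 (fun s a t => by simp [chain_assoc, h a t]) hx t

lemma LeftInv.chain_d2 (h : Q.LeftInv (f₂ ⊛ f₃)) {x} (hx : Q.e2 x = 1) (t) :
    (f₁ ⊛ f₂ ⊛ f₃ ⊛ f₄) (Q.d2 x * t) = (f₁ ⊛ f₂ ⊛ f₃ ⊛ f₄) t :=
  LeftInv.d2 (fun r s a t => by simp [chain_assoc, h a t]) hx t

lemma RightInv.chain_d2 (h : Q.RightInv (f₂ ⊛ f₃)) {x} (hx : Q.e2 x = 1) (t) :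
    (f₁ ⊛ f₂ ⊛ f₃ ⊛ f₄) (t * Q.d2 x) = (f₁ ⊛ f₂ ⊛ f₃ ⊛ f₄) t :=
  RightInv.d2 (fun r s a t => by simp [chain_assoc, h a t]) hx t

lemma LeftInv.chain_d3 (h : Q.LeftInv (f₃ ⊛ f₄)) {x} (hx : Q.e3 x = 1) (t) :
    (f₁ ⊛ f₂ ⊛ f₃ ⊛ f₄) (Q.d3 x * t) = (f₁ ⊛ f₂ ⊛ f₃ ⊛ f₄) t :=
  LeftInv.d3 (fun r s a t => by simp [h a t]) hx t

lemma RightInv.chain_d3 (h : Q.RightInv (f₃ ⊛ f₄)) {x} (hx : Q.e3 x = 1) (t) :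
    (f₁ ⊛ f₂ ⊛ f₃ ⊛ f₄) (t * Q.d3 x) = (f₁ ⊛ f₂ ⊛ f₃ ⊛ f₄) t :=
  RightInv.d3 (fun r s a t => by simp [h a t]) hx t

lemma LeftInv.rchain_d1 (h : Q.LeftInv (f₁ ⊚ f₂)) {x} (hx : Q.e1 x = 1) (t) :
    (f₁ ⊚ f₂ ⊚ g) (Q.d1 x * t) = (f₁ ⊚ f₂ ⊚ g) t :=
  LeftInv.d1 (fun s a t => by simp [rchain_assoc, h a t]) hx t

lemma RightInv.rchain_d1 (h : Q.RightInv (f₁ ⊚ f₂)) {x} (hx : Q.e1 x = 1) (t) :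
    (f₁ ⊚ f₂ ⊚ g) (t * Q.d1 x) = (f₁ ⊚ f₂ ⊚ g) t :=
  RightInv.d1 (fun s a t => by simp [rchain_assoc, h a t]) hx t

lemma LeftInv.rchain_d2 (h : Q.LeftInv (f₂ ⊚ f₃)) {x} (hx : Q.e2 x = 1) (t) :
    (f₁ ⊚ f₂ ⊚ f₃ ⊚ f₄) (Q.d2 x * t) = (f₁ ⊚ f₂ ⊚ f₃ ⊚ f₄) t :=
  LeftInv.d2 (fun r s a t => by simp [rchain_assoc, h a t]) hx t

lemma RightInv.rchain_d2 (h : Q.RightInv (f₂ ⊚ f₃)) {x} (hx : Q.e2 x = 1) (t) :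
    (f₁ ⊚ f₂ ⊚ f₃ ⊚ f₄) (t * Q.d2 x) = (f₁ ⊚ f₂ ⊚ f₃ ⊚ f₄) t :=
  RightInv.d2 (fun r s a t => by simp [rchain_assoc, h a t]) hx t

lemma LeftInv.rchain_d3 (h : Q.LeftInv (f₃ ⊚ f₄)) {x} (hx : Q.e3 x = 1) (t) :
    (f₁ ⊚ f₂ ⊚ f₃ ⊚ f₄) (Q.d3 x * t) = (f₁ ⊚ f₂ ⊚ f₃ ⊚ f₄) t :=
  LeftInv.d3 (fun r s a t => by simp [h a t]) hx t

end

lemma LeftInv.mul_right {f g : H →ₗ[k] A} (h : Q.LeftInv (f ⊛ g)) (c : A) :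
    Q.LeftInv (f ⊛ (g ◂ c)) := by
  have e : ∀ t, (f ⊛ (g ◂ c)) t = (f ⊛ g) t * c := by
    intro t
    induction t using TensorProduct.induction_on with
    | zero => simp
    | tmul a b => simp [mul_assoc]
    | add x y hx hy => simp only [map_add, hx, hy, add_mul]
  intro a t
  rw [e, e, h, smul_mul_assoc]

lemma RightInv.mul_right {f g : H →ₗ[k] A} (h : Q.RightInv (f ⊛ g)) (c : A) :
    Q.RightInv (f ⊛ (g ◂ c)) := by
  have e : ∀ t, (f ⊛ (g ◂ c)) t = (f ⊛ g) t * c := by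
    intro t
    induction t using TensorProduct.induction_on with
    | zero => simp
    | tmul a b => simp [mul_assoc]
    | add x y hx hy => simp only [map_add, hx, hy, add_mul]
  intro a t
  rw [e, e, h, smul_mul_assoc]

/-- `x ⊗ y ↦ σ(x) c D(y)` collapses coproducts on the left as soon as `σ(a₁) c D(a₂) = ε(a) c`. -/
lemma leftInv_chain {σ : H →ₗ[k] A} (hσ : ∀ a b, σ (a * b) = σ b * σ a) (D : H →ₐ[k] A) {c : A}
    (h : ∀ a, ((σ ◂ c) ⊛ D.toLinearMap) (Q.comul a) = Q.counit a • c) :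
    Q.LeftInv ((σ ◂ c) ⊛ D.toLinearMap) := by
  have e : ∀ d t1 t2, ((σ ◂ c) ⊛ D.toLinearMap) (d * (t1 ⊗ₜ t2)) =
      σ t1 * ((σ ◂ c) ⊛ D.toLinearMap) d * D t2 := by
    intro d t1 t2
    induction d using TensorProduct.induction_on with
    | zero => simp
    | tmul a b => simp [mul_assoc, hσ]
    | add x y hx hy => simp only [map_add, hx, hy, add_mul, mul_add]
  intro a t
  induction t using TensorProduct.induction_on with
  | zero => simp
  | tmul t1 t2 => rw [e, h]; simp
  | add x y hx hy => simp only [map_add, hx, hy, mul_add, smul_add]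

/-- `x ⊗ y ↦ D(x) c σ(y)` collapses coproducts on the right as soon as `D(a₁) c σ(a₂) = ε(a) c`. -/
lemma rightInv_chain {σ : H →ₗ[k] A} (hσ : ∀ a b, σ (a * b) = σ b * σ a) (D : H →ₐ[k] A) {c : A}
    (h : ∀ a, ((D.toLinearMap ◂ c) ⊛ σ) (Q.comul a) = Q.counit a • c) :
    Q.RightInv ((D.toLinearMap ◂ c) ⊛ σ) := by
  have e : ∀ d t1 t2, ((D.toLinearMap ◂ c) ⊛ σ) ((t1 ⊗ₜ t2) * d) =
      D t1 * ((D.toLinearMap ◂ c) ⊛ σ) d * σ t2 := by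
    intro d t1 t2
    induction d using TensorProduct.induction_on with
    | zero => simp
    | tmul a b => simp [mul_assoc, hσ]
    | add x y hx hy => simp only [map_add, hx, hy, add_mul, mul_add]
  intro a t
  induction t using TensorProduct.induction_on with
  | zero => simp
  | tmul t1 t2 => rw [e, h]; simp
  | add x y hx hy => simp only [map_add, hx, hy, add_mul, smul_add]

variable (Q)

lemma leftInv_alpha (D : H →ₐ[k] A) :
    Q.LeftInv (((D.toLinearMap ∘ₗ Q.S) ◂ D Q.alpha) ⊛ D.toLinearMap) := by
  refine leftInv_chain (by simp) D fun a => ?_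
  rw [← map_smul, ← sandwichLeft_comul]
  generalize Q.comul a = d
  induction d using TensorProduct.induction_on with
  | zero => simp
  | tmul a b => simp
  | add x y hx hy => simp only [map_add, hx, hy]

lemma rightInv_beta (D : H →ₐ[k] A) :
    Q.RightInv ((D.toLinearMap ◂ D Q.beta) ⊛ (D.toLinearMap ∘ₗ Q.S)) := by
  refine rightInv_chain (by simp) D fun a => ?_
  rw [← map_smul, ← sandwichRight_comul]
  generalize Q.comul a = d
  induction d using TensorProduct.induction_on with
  | zero => simp
  | tmul a b => simp
  | add x y hx hy => simp only [map_add, hx, hy]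

/-- `S⁻¹(a₂) S⁻¹(α) a₁ = ε(a) S⁻¹(α)`, in the form of a collapse. -/
lemma leftInv_alpha_inv (D : H →ₐ[k] A) :
    Q.LeftInv ((D (Q.Sinv Q.alpha) ▸▸ D.toLinearMap) ⊚ (D.toLinearMap ∘ₗ Q.Sinv)) := by
  have e : ∀ d t1 t2, ((D (Q.Sinv Q.alpha) ▸▸ D.toLinearMap) ⊚ (D.toLinearMap ∘ₗ Q.Sinv))
      (d * (t1 ⊗ₜ t2)) = D (Q.Sinv (sandwichLeft Q.S Q.alpha d * t2)) * D t1 := by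
    intro d t1 t2
    induction d using TensorProduct.induction_on with
    | zero => simp
    | tmul a b => simp [mul_assoc]
    | add x y hx hy => simp only [map_add, hx, hy, add_mul]
  intro a t
  induction t using TensorProduct.induction_on with
  | zero => simp
  | tmul t1 t2 => rw [e, sandwichLeft_comul]; simp [mul_assoc]
  | add x y hx hy => simp only [map_add, hx, hy, mul_add, smul_add]

/-- `a₂ S⁻¹(β) S⁻¹(a₁) = ε(a) S⁻¹(β)`, in the form of a collapse. -/
lemma rightInv_beta_inv (D : H →ₐ[k] A) :
    Q.RightInv ((D.toLinearMap ∘ₗ Q.Sinv) ⊚ (D.toLinearMap ◂ D (Q.Sinv Q.beta))) := by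
  have e : ∀ d t1 t2, ((D.toLinearMap ∘ₗ Q.Sinv) ⊚ (D.toLinearMap ◂ D (Q.Sinv Q.beta)))
      ((t1 ⊗ₜ t2) * d) = D (t2 * Q.Sinv (t1 * sandwichRight Q.S Q.beta d)) := by
    intro d t1 t2
    induction d using TensorProduct.induction_on with
    | zero => simp
    | tmul a b => simp [mul_assoc]
    | add x y hx hy => simp only [map_add, hx, hy, mul_add]
  intro a t
  induction t using TensorProduct.induction_on with
  | zero => simp
  | tmul t1 t2 => rw [e, sandwichRight_comul]; simp [mul_assoc]
  | add x y hx hy => simp only [map_add, hx, hy, add_mul, smul_add]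

end Collapse

end QuasiHopfAlgebra

/-! ### Collapses in three factors -/

namespace QuasiHopfAlgebra

variable {k H : Type*} [Field k] [Ring H] [Algebra k H] (Q : QuasiHopfAlgebra k H)

section
variable {A : Type*} [Ring A] [Algebra k A] {f₁ f₂ f₃ : H →ₗ[k] A}
variable {Q}

lemma LeftInv.chain_comulFst (h : Q.LeftInv (f₁ ⊛ f₂)) (d : H ⊗[k] H) (t) :
    (f₁ ⊛ f₂ ⊛ f₃) (Q.comulFst d * t) =
      (f₁ ⊛ f₂ ⊛ f₃) ((1 ⊗ₜ (1 ⊗ₜ Q.counitFst H d)) * t) := by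
  induction d using TensorProduct.induction_on with
  | zero => simp
  | add x y hx hy => simp only [map_add, add_mul, TensorProduct.tmul_add, hx, hy]
  | tmul a b =>
    induction t using tensor3_induction with
    | add x y hx hy => simp only [map_add, mul_add, hx, hy]
    | tmul t1 t2 t3 =>
      rw [comulFst_tmul, ← TensorProduct.assoc_tmul, ← assoc_mul,
        Algebra.TensorProduct.tmul_mul_tmul, chain_assoc, h]
      simp [mul_assoc]

lemma RightInv.chain_comulSnd (h : Q.RightInv (f₂ ⊛ f₃)) (d : H ⊗[k] H) (t) :
    (f₁ ⊛ f₂ ⊛ f₃) (t * Q.comulSnd d) =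
      (f₁ ⊛ f₂ ⊛ f₃) (t * (Q.counitSnd d ⊗ₜ 1)) := by
  induction d using TensorProduct.induction_on with
  | zero => simp
  | add x y hx hy => simp only [map_add, mul_add, TensorProduct.add_tmul, hx, hy]
  | tmul a b =>
    induction t using tensor3_induction with
    | add x y hx hy => simp only [map_add, add_mul, hx, hy]
    | tmul t1 t2 t3 =>
      rw [comulSnd_tmul, Algebra.TensorProduct.tmul_mul_tmul, chain_tmul, h,
        Algebra.TensorProduct.tmul_mul_tmul]
      simp

end

lemma rightInv_beta_inr :
    Q.RightInv ((inr k H H ◂ (1 ⊗ₜ Q.beta)) ⊛ (inr k H H ∘ₗ Q.S)) :=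
  Q.rightInv_beta (Algebra.TensorProduct.includeRight : H →ₐ[k] H ⊗[k] H)

lemma leftInv_alpha_inr :
    Q.LeftInv (((inr k H H ∘ₗ Q.S) ◂ (1 ⊗ₜ Q.alpha)) ⊛ inr k H H) :=
  Q.leftInv_alpha (Algebra.TensorProduct.includeRight : H →ₐ[k] H ⊗[k] H)

lemma rightInv_beta_inl :
    Q.RightInv ((inl k H H ◂ (Q.beta ⊗ₜ 1)) ⊛ (inl k H H ∘ₗ Q.S)) :=
  Q.rightInv_beta Algebra.TensorProduct.includeLeft

lemma leftInv_alpha_inl :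
    Q.LeftInv (((inl k H H ∘ₗ Q.S) ◂ (Q.alpha ⊗ₜ 1)) ⊛ inl k H H) :=
  Q.leftInv_alpha Algebra.TensorProduct.includeLeft

/-! ### The elements `p` and `q` -/

/-- The contraction `x ⊗ y ⊗ z ↦ x ⊗ y β S(z)`. -/
def pRMap : H ⊗[k] (H ⊗[k] H) →ₗ[k] H ⊗[k] H :=
  inl k H H ⊛ (inr k H H ◂ (1 ⊗ₜ Q.beta)) ⊛ (inr k H H ∘ₗ Q.S)

/-- The contraction `x ⊗ y ⊗ z ↦ x ⊗ S⁻¹(α z) y`. -/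
def qRMap : H ⊗[k] (H ⊗[k] H) →ₗ[k] H ⊗[k] H :=
  inl k H H ⊚ ((1 ⊗ₜ Q.Sinv Q.alpha) ▸▸ inr k H H) ⊚ (inr k H H ∘ₗ Q.Sinv)

/-- The contraction `x ⊗ y ⊗ z ↦ y S⁻¹(x β) ⊗ z`. -/
def pLMap : H ⊗[k] (H ⊗[k] H) →ₗ[k] H ⊗[k] H :=
  (inl k H H ∘ₗ Q.Sinv) ⊚ (inl k H H ◂ (Q.Sinv Q.beta ⊗ₜ 1)) ⊚ inr k H H

/-- The contraction `x ⊗ y ⊗ z ↦ S(x) α y ⊗ z`. -/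
def qLMap : H ⊗[k] (H ⊗[k] H) →ₗ[k] H ⊗[k] H :=
  ((inl k H H ∘ₗ Q.S) ◂ (Q.alpha ⊗ₜ 1)) ⊛ inl k H H ⊛ inr k H H

@[simp] lemma pRMap_tmul (a b c : H) :
    Q.pRMap (a ⊗ₜ (b ⊗ₜ c)) = a ⊗ₜ (b * Q.beta * Q.S c) := by simp [pRMap]

@[simp] lemma qRMap_tmul (a b c : H) :
    Q.qRMap (a ⊗ₜ (b ⊗ₜ c)) = a ⊗ₜ (Q.Sinv c * Q.Sinv Q.alpha * b) := by
  simp [qRMap, mul_assoc]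

@[simp] lemma pLMap_tmul (a b c : H) :
    Q.pLMap (a ⊗ₜ (b ⊗ₜ c)) = (b * Q.Sinv Q.beta * Q.Sinv a) ⊗ₜ c := by simp [pLMap]

@[simp] lemma qLMap_tmul (a b c : H) :
    Q.qLMap (a ⊗ₜ (b ⊗ₜ c)) = (Q.S a * Q.alpha * b) ⊗ₜ c := by simp [qLMap]

lemma pR_eq : Q.pR = Q.pRMap Q.phiInv := by
  rw [pR]
  generalize Q.phiInv = x
  induction x using tensor3_induction with
  | tmul a b c => simp
  | add x y hx hy => simp only [map_add, hx, hy]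

lemma qR_eq : Q.qR = Q.qRMap Q.phi := by
  rw [qR]
  generalize Q.phi = x
  induction x using tensor3_induction with
  | tmul a b c => simp
  | add x y hx hy => simp only [map_add, hx, hy]

lemma pL_eq : Q.pL = Q.pLMap Q.phi := by
  rw [pL]
  generalize Q.phi = x
  induction x using tensor3_induction with
  | tmul a b c => simp [mul_assoc]
  | add x y hx hy => simp only [map_add, hx, hy]

lemma qL_eq : Q.qL = Q.qLMap Q.phiInv := by
  rw [qL]
  generalize Q.phiInv = x
  induction x using tensor3_induction with
  | tmul a b c => simp
  | add x y hx hy => simp only [map_add, hx, hy]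

/-- `Δ(a₁) p_R (1 ⊗ S(a₂)) = p_R (a ⊗ 1)`. -/
lemma pR_cov (a : H) :
    ((Q.Delta ◂ Q.pR) ⊛ (inr k H H ∘ₗ Q.S)) (Q.comul a) = Q.pR * (a ⊗ₜ 1) := by
  have hl : ∀ d x, ((Q.Delta ◂ Q.pRMap x) ⊛ (inr k H H ∘ₗ Q.S)) d =
      Q.pRMap (Q.comulFst d * x) := by
    intro d x
    induction d using TensorProduct.induction_on with
    | zero => simp
    | add x y hx hy => simp only [map_add, add_mul, hx, hy]
    | tmul b c =>
      rw [comulFst_tmul, chain_tmul, rmul_apply, Delta_apply]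
      generalize Q.comul b = e
      induction e using TensorProduct.induction_on with
      | zero => simp
      | add x y hx hy => simp only [map_add, add_mul, TensorProduct.add_tmul, hx, hy]
      | tmul e1 e2 =>
        induction x using tensor3_induction with
        | tmul x1 x2 x3 => simp [mul_assoc]
        | add x y hx hy => simp only [map_add, add_mul, mul_add, hx, hy]
  have hr : ∀ (b : H) x, Q.pRMap (x * (b ⊗ₜ 1)) = Q.pRMap x * (b ⊗ₜ 1) := by
    intro b x
    induction x using tensor3_induction with
    | tmul x1 x2 x3 => simp
    | add x y hx hy => simp only [map_add, add_mul, hx, hy]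
  rw [pR_eq, hl, ← phiInv_mul_comulSnd, ← hr, pRMap,
    Q.rightInv_beta_inr.chain_comulSnd, counitSnd_comul]

lemma pR_cov_mul (t : H ⊗[k] H) (a : H) :
    ((Q.Delta ◂ Q.pR) ⊛ (inr k H H ∘ₗ Q.S)) (t * Q.comul a) =
      ((Q.Delta ◂ Q.pR) ⊛ (inr k H H ∘ₗ Q.S)) t * (a ⊗ₜ 1) := by
  have h : ∀ t1 t2 d, ((Q.Delta ◂ Q.pR) ⊛ (inr k H H ∘ₗ Q.S)) ((t1 ⊗ₜ t2) * d) =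
      Q.comul t1 * ((Q.Delta ◂ Q.pR) ⊛ (inr k H H ∘ₗ Q.S)) d * (1 ⊗ₜ Q.S t2) := by
    intro t1 t2 d
    induction d using TensorProduct.induction_on with
    | zero => simp
    | add x y hx hy => simp only [map_add, mul_add, add_mul, hx, hy]
    | tmul b c =>
      rw [show (1 : H) ⊗ₜ[k] Q.S t2 = inr k H H (Q.S t2) from rfl]
      simp [mul_assoc]
  induction t using TensorProduct.induction_on with
  | zero => simp
  | add x y hx hy => simp only [map_add, add_mul, hx, hy]
  | tmul t1 t2 => rw [h, pR_cov]; simp [mul_assoc]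

/-- `(S(a₁) ⊗ 1) q_L Δ(a₂) = (1 ⊗ a) q_L`. -/
lemma qL_cov (a : H) :
    (((inl k H H ∘ₗ Q.S) ◂ Q.qL) ⊛ Q.Delta) (Q.comul a) = (1 ⊗ₜ a) * Q.qL := by
  have hr : ∀ d x, (((inl k H H ∘ₗ Q.S) ◂ Q.qLMap x) ⊛ Q.Delta) d =
      Q.qLMap (x * Q.comulSnd d) := by
    intro d x
    induction d using TensorProduct.induction_on with
    | zero => simp
    | add x y hx hy => simp only [map_add, mul_add, hx, hy]
    | tmul b c =>
      rw [comulSnd_tmul, chain_tmul, rmul_apply, Delta_apply]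
      generalize Q.comul c = e
      induction e using TensorProduct.induction_on with
      | zero => simp
      | add x y hx hy => simp only [map_add, mul_add, TensorProduct.tmul_add, hx, hy]
      | tmul e1 e2 =>
        induction x using tensor3_induction with
        | tmul x1 x2 x3 => simp [mul_assoc]
        | add x y hx hy => simp only [map_add, add_mul, mul_add, hx, hy]
  have hl : ∀ x, Q.qLMap ((1 ⊗ₜ (1 ⊗ₜ a)) * x) = (1 ⊗ₜ a) * Q.qLMap x := by
    intro x
    induction x using tensor3_induction with
    | tmul x1 x2 x3 => simp
    | add x y hx hy => simp only [map_add, mul_add, hx, hy]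
  rw [qL_eq, hr, phiInv_mul_comulSnd, ← hl, qLMap, Q.leftInv_alpha_inl.chain_comulFst,
    counitFst_comul]

lemma qL_cov_mul (t : H ⊗[k] H) (a : H) :
    (((inl k H H ∘ₗ Q.S) ◂ Q.qL) ⊛ Q.Delta) (Q.comul a * t) =
      (1 ⊗ₜ a) * (((inl k H H ∘ₗ Q.S) ◂ Q.qL) ⊛ Q.Delta) t := by
  have h : ∀ t1 t2 d, (((inl k H H ∘ₗ Q.S) ◂ Q.qL) ⊛ Q.Delta) (d * (t1 ⊗ₜ t2)) =
      (Q.S t1 ⊗ₜ 1) * (((inl k H H ∘ₗ Q.S) ◂ Q.qL) ⊛ Q.Delta) d * Q.comul t2 := by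
    intro t1 t2 d
    induction d using TensorProduct.induction_on with
    | zero => simp
    | add x y hx hy => simp only [map_add, mul_add, add_mul, hx, hy]
    | tmul b c =>
      rw [Algebra.TensorProduct.tmul_mul_tmul, chain_tmul, chain_tmul]
      simp only [rmul_apply, LinearMap.comp_apply, S_mul, Delta_apply, map_mul, inl_apply]
      rw [show (Q.S t1 * Q.S b) ⊗ₜ[k] (1 : H) = (Q.S t1 ⊗ₜ 1) * (Q.S b ⊗ₜ 1) by simp]
      simp only [mul_assoc]
  induction t using TensorProduct.induction_on with
  | zero => simp
  | add x y hx hy => simp only [map_add, mul_add, hx, hy]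
  | tmul t1 t2 =>
    rw [h, qL_cov, chain_tmul]
    simp only [rmul_apply, LinearMap.comp_apply, inl_apply, Delta_apply, ← mul_assoc,
      Algebra.TensorProduct.tmul_mul_tmul, one_mul, mul_one]

/-- `(1 ⊗ S⁻¹(a₂)) q_R Δ(a₁) = (a ⊗ 1) q_R`. -/
lemma qR_cov (a : H) :
    ((Q.qR ▸▸ Q.Delta) ⊚ (inr k H H ∘ₗ Q.Sinv)) (Q.comul a) = (a ⊗ₜ 1) * Q.qR := by
  have hl : ∀ d x, ((Q.qRMap x ▸▸ Q.Delta) ⊚ (inr k H H ∘ₗ Q.Sinv)) d =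
      Q.qRMap (x * Q.comulFst d) := by
    intro d x
    induction d using TensorProduct.induction_on with
    | zero => simp
    | add x y hx hy => simp only [map_add, mul_add, hx, hy]
    | tmul b c =>
      rw [comulFst_tmul, rchain_tmul, lmul_apply, Delta_apply]
      generalize Q.comul b = e
      induction e using TensorProduct.induction_on with
      | zero => simp
      | add x y hx hy => simp only [map_add, mul_add, TensorProduct.add_tmul, hx, hy]
      | tmul e1 e2 =>
        induction x using tensor3_induction with
        | tmul x1 x2 x3 => simp [mul_assoc]
        | add x y hx hy => simp only [map_add, add_mul, mul_add, hx, hy]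
  have hs : ∀ d x, Q.qRMap (Q.comulSnd d * x) = (Q.counitSnd d ⊗ₜ 1) * Q.qRMap x := by
    intro d x
    induction d using TensorProduct.induction_on with
    | zero => simp
    | add x y hx hy => simp only [map_add, add_mul, TensorProduct.add_tmul, hx, hy]
    | tmul b c =>
      induction x using tensor3_induction with
      | add x y hx hy => simp only [map_add, mul_add, hx, hy]
      | tmul x1 x2 x3 =>
        have := Q.leftInv_alpha_inv (AlgHom.id k H) c (x2 ⊗ₜ x3)
        have e : ∀ t, Q.qRMap ((b * x1) ⊗ₜ t) = (b * x1) ⊗ₜ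
            (((AlgHom.id k H (Q.Sinv Q.alpha) ▸▸ (AlgHom.id k H).toLinearMap) ⊚
              ((AlgHom.id k H).toLinearMap ∘ₗ Q.Sinv)) t) := by
          intro t
          induction t using TensorProduct.induction_on with
          | zero => simp
          | add x y hx hy => simp only [map_add, TensorProduct.tmul_add, hx, hy]
          | tmul u v => simp [mul_assoc]
        rw [comulSnd_tmul, Algebra.TensorProduct.tmul_mul_tmul, e, this]
        simp [TensorProduct.smul_tmul', mul_assoc]
  rw [qR_eq, hl, ← comulSnd_comul, hs, counitSnd_comul]

lemma qR_cov_mul (t : H ⊗[k] H) (a : H) :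
    ((Q.qR ▸▸ Q.Delta) ⊚ (inr k H H ∘ₗ Q.Sinv)) (Q.comul a * t) =
      (a ⊗ₜ 1) * ((Q.qR ▸▸ Q.Delta) ⊚ (inr k H H ∘ₗ Q.Sinv)) t := by
  have h : ∀ t1 t2 d, ((Q.qR ▸▸ Q.Delta) ⊚ (inr k H H ∘ₗ Q.Sinv)) (d * (t1 ⊗ₜ t2)) =
      (1 ⊗ₜ Q.Sinv t2) * ((Q.qR ▸▸ Q.Delta) ⊚ (inr k H H ∘ₗ Q.Sinv)) d * Q.comul t1 := by
    intro t1 t2 d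
    induction d using TensorProduct.induction_on with
    | zero => simp
    | add x y hx hy => simp only [map_add, mul_add, add_mul, hx, hy]
    | tmul b c =>
      simp only [Algebra.TensorProduct.tmul_mul_tmul, rchain_tmul, lmul_apply,
        LinearMap.comp_apply, Sinv_mul, Delta_apply, map_mul, inr_apply]
      rw [show (1 : H) ⊗ₜ[k] (Q.Sinv t2 * Q.Sinv c) = (1 ⊗ₜ Q.Sinv t2) * (1 ⊗ₜ Q.Sinv c) by simp]
      simp only [mul_assoc]
  induction t using TensorProduct.induction_on with
  | zero => simp
  | add x y hx hy => simp only [map_add, mul_add, hx, hy]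
  | tmul t1 t2 =>
    rw [h, qR_cov, rchain_tmul, ← mul_assoc]
    simp only [Algebra.TensorProduct.tmul_mul_tmul, LinearMap.comp_apply, inr_apply, lmul_apply,
      Delta_apply, ← mul_assoc, mul_one, one_mul]

/-- `Δ(a₂) p_L (S⁻¹(a₁) ⊗ 1) = p_L (1 ⊗ a)`. -/
lemma pL_cov (a : H) :
    ((Q.pL ▸▸ (inl k H H ∘ₗ Q.Sinv)) ⊚ Q.Delta) (Q.comul a) = Q.pL * (1 ⊗ₜ a) := by
  have hl : ∀ d x, ((Q.pLMap x ▸▸ (inl k H H ∘ₗ Q.Sinv)) ⊚ Q.Delta) d =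
      Q.pLMap (Q.comulSnd d * x) := by
    intro d x
    induction d using TensorProduct.induction_on with
    | zero => simp
    | add x y hx hy => simp only [map_add, add_mul, hx, hy]
    | tmul b c =>
      rw [comulSnd_tmul, rchain_tmul, lmul_apply, Delta_apply]
      generalize Q.comul c = e
      induction e using TensorProduct.induction_on with
      | zero => simp
      | add x y hx hy => simp only [map_add, add_mul, TensorProduct.tmul_add, hx, hy]
      | tmul e1 e2 =>
        induction x using tensor3_induction with
        | tmul x1 x2 x3 => simp [mul_assoc]
        | add x y hx hy => simp only [map_add, add_mul, mul_add, hx, hy]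
  have hs : ∀ d x, Q.pLMap (x * Q.comulFst d) = Q.pLMap x * (1 ⊗ₜ Q.counitFst H d) := by
    intro d x
    induction d using TensorProduct.induction_on with
    | zero => simp
    | add x y hx hy => simp only [map_add, mul_add, TensorProduct.tmul_add, hx, hy]
    | tmul b c =>
      induction x using tensor3_induction with
      | add x y hx hy => simp only [map_add, add_mul, hx, hy]
      | tmul x1 x2 x3 =>
        have := Q.rightInv_beta_inv (AlgHom.id k H) b (x1 ⊗ₜ x2)
        have e : ∀ t, Q.pLMap (TensorProduct.assoc k H H H (t ⊗ₜ (x3 * c))) =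
            ((((AlgHom.id k H).toLinearMap ∘ₗ Q.Sinv) ⊚ ((AlgHom.id k H).toLinearMap ◂
              AlgHom.id k H (Q.Sinv Q.beta))) t) ⊗ₜ (x3 * c) := by
          intro t
          induction t using TensorProduct.induction_on with
          | zero => simp
          | add x y hx hy => simp only [map_add, TensorProduct.add_tmul, hx, hy]
          | tmul u v => simp
        rw [comulFst_tmul, ← TensorProduct.assoc_tmul, ← assoc_mul,
          Algebra.TensorProduct.tmul_mul_tmul, e, this]
        simp [TensorProduct.smul_tmul']
  rw [pL_eq, hl, comulSnd_comul, hs, counitFst_comul]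

/-! ### Cancellations between `p` and `q` -/

/-- `Δ(q_R¹) p_R (1 ⊗ S(q_R²)) = 1 ⊗ 1`. -/
lemma qR_pR_cancel :
    ((Q.Delta ◂ Q.pR) ⊛ ((inr k H H ∘ₗ Q.S) ◂ (1 ⊗ₜ Q.alpha)) ⊛ inr k H H) Q.phi = 1 := by
  let M := inl k H H ⊛ (inr k H H ◂ (1 ⊗ₜ Q.beta)) ⊛
    ((inr k H H ∘ₗ Q.S) ◂ (1 ⊗ₜ Q.alpha)) ⊛ inr k H H
  have h : ∀ x y, ((Q.Delta ◂ Q.pRMap y) ⊛ ((inr k H H ∘ₗ Q.S) ◂ (1 ⊗ₜ Q.alpha)) ⊛ inr k H H) x =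
      M (Q.d1 x * padRight k H y) := by
    intro x y
    induction x using tensor3_induction with
    | add x y hx hy => simp only [map_add, add_mul, hx, hy]
    | tmul a b c =>
      rw [d1_tmul, chain_tmul, rmul_apply, Delta_apply]
      generalize Q.comul a = e
      induction e using TensorProduct.induction_on with
      | zero => simp
      | add x y hx hy => simp only [map_add, add_mul, TensorProduct.add_tmul, hx, hy]
      | tmul e1 e2 =>
        induction y using tensor3_induction with
        | add x y hx hy => simp only [map_add, add_mul, mul_add, hx, hy]
        | tmul y1 y2 y3 => simp [M, mul_assoc]
  have hz : ∀ x, M (padLeft k H x) = 1 ⊗ₜ Q.zigzag x := by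
    intro x
    induction x using tensor3_induction with
    | tmul a b c => simp [M, mul_assoc]
    | add x y hx hy => simp only [map_add, TensorProduct.tmul_add, hx, hy]
  rw [pR_eq, h, d1_mul_padRight_inv]
  rw [(Q.rightInv_beta_inr.mul_right _).chain_d2 Q.e2_phi,
    Q.leftInv_alpha_inr.chain_d3 Q.e3_phiInv, hz, zigzag_phi]
  rfl

end QuasiHopfAlgebra

namespace QuasiHopfAlgebra

variable {k H : Type*} [Field k] [Ring H] [Algebra k H] (Q : QuasiHopfAlgebra k H)

lemma rightInv_beta_comul :
    Q.RightInv ((Q.Delta ◂ Q.comul Q.beta) ⊛ (Q.Delta ∘ₗ Q.S)) :=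
  Q.rightInv_beta Q.comul

lemma leftInv_alpha_comul :
    Q.LeftInv (((Q.Delta ∘ₗ Q.S) ◂ Q.comul Q.alpha) ⊛ Q.Delta) :=
  Q.leftInv_alpha Q.comul

/-- `(S(p_L¹) ⊗ 1) q_L Δ(p_L²) = 1 ⊗ 1`. -/
lemma pL_qL_cancel :
    ((inl k H H ◂ (Q.beta ⊗ₜ 1)) ⊛ ((inl k H H ∘ₗ Q.S) ◂ Q.qL) ⊛ Q.Delta) Q.phi = 1 := by
  let M := (inl k H H ◂ (Q.beta ⊗ₜ 1)) ⊛ ((inl k H H ∘ₗ Q.S) ◂ (Q.alpha ⊗ₜ 1)) ⊛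
    inl k H H ⊛ inr k H H
  have h : ∀ x y, ((inl k H H ◂ (Q.beta ⊗ₜ 1)) ⊛ ((inl k H H ∘ₗ Q.S) ◂ Q.qLMap y) ⊛ Q.Delta) x =
      M (padLeft k H y * Q.d3 x) := by
    intro x y
    induction x using tensor3_induction with
    | add x y hx hy => simp only [map_add, mul_add, hx, hy]
    | tmul a b c =>
      rw [d3_tmul, comulSnd_tmul, chain_tmul, chain_tmul, Delta_apply]
      generalize Q.comul c = e
      induction e using TensorProduct.induction_on with
      | zero => simp
      | add x y hx hy => simp only [map_add, mul_add, TensorProduct.tmul_add, hx, hy]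
      | tmul e1 e2 =>
        induction y using tensor3_induction with
        | add x y hx hy => simp only [map_add, add_mul, mul_add, rmul_apply] at hx hy ⊢; rw [hx, hy]
        | tmul y1 y2 y3 => simp [M, mul_assoc]
  have hz : ∀ x, M (padRight k H x) = Q.zigzag x ⊗ₜ 1 := by
    intro x
    induction x using tensor3_induction with
    | tmul a b c => simp [M, mul_assoc]
    | add x y hx hy => simp only [map_add, TensorProduct.add_tmul, hx, hy]
  rw [qL_eq, h, padLeft_inv_mul_d3, (Q.rightInv_beta_inl.mul_right _).chain_d1 Q.e1_phiInv,
    Q.leftInv_alpha_inl.chain_d2 Q.e2_phi, hz, zigzag_phi]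
  rfl

/-- `Δ(q_L²) p_L (S⁻¹(q_L¹) ⊗ 1) = 1 ⊗ 1`. -/
lemma qL_pL_cancel :
    (((Q.Sinv Q.alpha ⊗ₜ 1) ▸▸ inl k H H) ⊚ (Q.pL ▸▸ (inl k H H ∘ₗ Q.Sinv)) ⊚ Q.Delta)
      Q.phiInv = 1 := by
  let M := ((Q.Sinv Q.alpha ⊗ₜ 1) ▸▸ inl k H H) ⊚ (inl k H H ∘ₗ Q.Sinv) ⊚
    (inl k H H ◂ (Q.Sinv Q.beta ⊗ₜ 1)) ⊚ inr k H H
  have h : ∀ x y, (((Q.Sinv Q.alpha ⊗ₜ 1) ▸▸ inl k H H) ⊚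
      (Q.pLMap y ▸▸ (inl k H H ∘ₗ Q.Sinv)) ⊚ Q.Delta) x = M (Q.d3 x * padLeft k H y) := by
    intro x y
    induction x using tensor3_induction with
    | add x y hx hy => simp only [map_add, add_mul, hx, hy]
    | tmul a b c =>
      rw [d3_tmul, comulSnd_tmul, rchain_tmul, rchain_tmul, Delta_apply]
      generalize Q.comul c = e
      induction e using TensorProduct.induction_on with
      | zero => simp
      | add x y hx hy => simp only [map_add, add_mul, TensorProduct.tmul_add, hx, hy]
      | tmul e1 e2 =>
        induction y using tensor3_induction with
        | add x y hx hy => simp only [map_add, add_mul, mul_add, lmul_apply] at hx hy ⊢; rw [hx, hy]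
        | tmul y1 y2 y3 => simp [M, mul_assoc]
  have hz : ∀ x, M (padRight k H x) = Q.Sinv (Q.zigzag' x) ⊗ₜ 1 := by
    intro x
    induction x using tensor3_induction with
    | tmul a b c => simp [M, mul_assoc]
    | add x y hx hy => simp only [map_add, TensorProduct.add_tmul, hx, hy]
  have hα : Q.LeftInv (((Q.Sinv Q.alpha ⊗ₜ 1) ▸▸ inl k H H) ⊚ (inl k H H ∘ₗ Q.Sinv)) :=
    Q.leftInv_alpha_inv (Algebra.TensorProduct.includeLeft : H →ₐ[k] H ⊗[k] H)
  have hβ : Q.RightInv ((inl k H H ∘ₗ Q.Sinv) ⊚ (inl k H H ◂ (Q.Sinv Q.beta ⊗ₜ 1))) :=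
    Q.rightInv_beta_inv (Algebra.TensorProduct.includeLeft : H →ₐ[k] H ⊗[k] H)
  rw [pL_eq, h, d3_inv_mul_padLeft, hβ.rchain_d2 Q.e2_phiInv, hα.rchain_d1 Q.e1_phi, hz,
    zigzag'_phiInv, Sinv_one]
  rfl

/-- `(S(x) ⊗ 1) q_L Δ(y) p_R (1 ⊗ S(z)) = α ⊗ β`, where `φ⁻¹ = x ⊗ y ⊗ z`. -/
lemma qL_pR_contract :
    (((inl k H H ∘ₗ Q.S) ◂ Q.qL) ⊛ (Q.Delta ◂ Q.pR) ⊛ (inr k H H ∘ₗ Q.S)) Q.phiInv =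
      Q.alpha ⊗ₜ Q.beta := by
  let M := ((inl k H H ∘ₗ Q.S) ◂ (Q.alpha ⊗ₜ 1)) ⊛ inl k H H ⊛
    (inr k H H ◂ (1 ⊗ₜ Q.beta)) ⊛ (inr k H H ∘ₗ Q.S)
  have h : ∀ x y z, (((inl k H H ∘ₗ Q.S) ◂ Q.qLMap x) ⊛ (Q.Delta ◂ Q.pRMap z) ⊛
      (inr k H H ∘ₗ Q.S)) y = M (padRight k H x * Q.d2 y * padLeft k H z) := by
    intro x y z
    induction y using tensor3_induction with
    | add x y hx hy => simp only [map_add, add_mul, mul_add, hx, hy]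
    | tmul a b c =>
      rw [d2_tmul, comulFst_tmul, chain_tmul, chain_tmul, rmul_apply, rmul_apply, Delta_apply]
      generalize Q.comul b = e
      induction e using TensorProduct.induction_on with
      | zero => simp
      | add x y hx hy =>
        simp only [map_add, add_mul, mul_add, TensorProduct.tmul_add, TensorProduct.add_tmul,
          hx, hy]
      | tmul e1 e2 =>
        induction x using tensor3_induction with
        | add x y hx hy => simp only [map_add, add_mul, mul_add, hx, hy]
        | tmul x1 x2 x3 =>
          induction z using tensor3_induction with
          | add x y hx hy => simp only [map_add, add_mul, mul_add, hx, hy]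
          | tmul z1 z2 z3 => simp [M, mul_assoc]
  rw [qL_eq, pR_eq, h, padRight_inv_mul_d2_inv, Q.leftInv_alpha_inl.chain_d1 Q.e1_phiInv,
    ← one_mul (Q.d3 Q.phiInv),
    Q.rightInv_beta_inr.chain_d3 Q.e3_phiInv]
  simp [Algebra.TensorProduct.one_def]

/-! ### The element `U` -/

/-- The element `Δ(q_L¹) p_R (1 ⊗ S(q_L²))`, an explicit form of `U`. -/
def explicitU : H ⊗[k] H :=
  (((Q.Delta ∘ₗ Q.S) ◂ Q.comul Q.alpha) ⊛ (Q.Delta ◂ Q.pR) ⊛ (inr k H H ∘ₗ Q.S)) Q.phiInv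

/-- `Δ(S(a₁)) U (a₂ ⊗ 1) = U (1 ⊗ S(a))`. -/
lemma explicitU_cov (a : H) :
    (((Q.Delta ∘ₗ Q.S) ◂ Q.explicitU) ⊛ inl k H H) (Q.comul a) =
      Q.explicitU * (1 ⊗ₜ Q.S a) := by
  let F := ((Q.Delta ∘ₗ Q.S) ◂ Q.comul Q.alpha) ⊛ (Q.Delta ◂ Q.pR) ⊛ (inr k H H ∘ₗ Q.S)
  have h : ∀ d x, (((Q.Delta ∘ₗ Q.S) ◂ F x) ⊛ inl k H H) d = F (x * Q.comulSnd d) := by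
    intro d x
    induction d using TensorProduct.induction_on with
    | zero => simp
    | add x y hx hy => simp only [map_add, mul_add, hx, hy]
    | tmul b c =>
      induction x using tensor3_induction with
      | add x y hx hy =>
        simp only [map_add, add_mul, mul_add, chain_tmul, rmul_apply] at hx hy ⊢
        rw [hx, hy]
      | tmul x1 x2 x3 =>
        have e : ∀ t, F ((x1 * b) ⊗ₜ t) = Q.comul (Q.S (x1 * b)) * Q.comul Q.alpha *
          ((Q.Delta ◂ Q.pR) ⊛ (inr k H H ∘ₗ Q.S)) t := fun t => by simp [F]
        rw [comulSnd_tmul, Algebra.TensorProduct.tmul_mul_tmul, e, pR_cov_mul]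
        simp [F, mul_assoc]
  have hl : ∀ x, F ((1 ⊗ₜ (1 ⊗ₜ a)) * x) = F x * (1 ⊗ₜ Q.S a) := by
    intro x
    induction x using tensor3_induction with
    | add x y hx hy => simp only [map_add, add_mul, mul_add, hx, hy]
    | tmul x1 x2 x3 => simp [F, mul_assoc]
  rw [explicitU, h, phiInv_mul_comulSnd, ← hl]
  simp only [F]
  rw [(Q.leftInv_alpha_comul.mul_right _).chain_comulFst, counitFst_comul]

/-- `Δ(X β S(Y)) U (Z ⊗ 1) = p_R`. -/
lemma explicitU_contract :
    ((Q.Delta ◂ Q.comul Q.beta) ⊛ ((Q.Delta ∘ₗ Q.S) ◂ Q.explicitU) ⊛ inl k H H) Q.phi = Q.pR := by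
  let F := ((Q.Delta ∘ₗ Q.S) ◂ Q.comul Q.alpha) ⊛ (Q.Delta ◂ Q.pR) ⊛ (inr k H H ∘ₗ Q.S)
  let M := (Q.Delta ◂ Q.comul Q.beta) ⊛ F
  have h : ∀ x y, ((Q.Delta ◂ Q.comul Q.beta) ⊛ ((Q.Delta ∘ₗ Q.S) ◂ F y) ⊛ inl k H H) x =
      M (padLeft k H y * Q.d3 x) := by
    intro x y
    induction x using tensor3_induction with
    | add x y hx hy => simp only [map_add, mul_add, hx, hy]
    | tmul a b c =>
      induction y using tensor3_induction with
      | add x y hx hy =>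
        simp only [map_add, add_mul, mul_add, chain_tmul, rmul_apply, padLeft_apply] at hx hy ⊢
        rw [hx, hy]
      | tmul y1 y2 y3 =>
        have e : ∀ t, M (a ⊗ₜ ((y1 * b) ⊗ₜ t)) = Q.comul a * Q.comul Q.beta *
          (Q.comul (Q.S (y1 * b)) * Q.comul Q.alpha *
          ((Q.Delta ◂ Q.pR) ⊛ (inr k H H ∘ₗ Q.S)) t) := fun t => by simp [F, M]
        rw [d3_tmul, comulSnd_tmul, padLeft_apply, Algebra.TensorProduct.tmul_mul_tmul, one_mul,
          Algebra.TensorProduct.tmul_mul_tmul, e, pR_cov_mul]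
        simp [F, mul_assoc]
  have hz : ∀ x, M (padRight k H x) = Q.comul (Q.zigzag x) * Q.pR := by
    intro x
    induction x using tensor3_induction with
    | tmul a b c => simp [M, F, mul_assoc, ← Algebra.TensorProduct.one_def]
    | add x y hx hy => simp only [map_add, add_mul, hx, hy]
  rw [explicitU, h, padLeft_inv_mul_d3]
  simp only [M, F]
  rw [(Q.rightInv_beta_comul.mul_right _).chain_d1 Q.e1_phiInv,
    (Q.leftInv_alpha_comul.mul_right _).chain_d2 Q.e2_phi]
  simp only [M, F] at hz
  rw [hz, zigzag_phi, map_one, one_mul]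

end QuasiHopfAlgebra

namespace QuasiHopfAlgebra

variable {k H : Type*} [Field k] [Ring H] [Algebra k H] (Q : QuasiHopfAlgebra k H)

/-! ### Drinfeld's twist -/

/-- The antimultiplicative bijection `a ⊗ b ↦ S(b) ⊗ S(a)` of `H ⊗ H`. -/
def flipS : H ⊗[k] H ≃ₗ[k] H ⊗[k] H :=
  TensorProduct.comm k H H ≪≫ₗ TensorProduct.congr Q.antipode Q.antipode

/-- The antimultiplicative map `a ↦ S(a₂) ⊗ S(a₁)`. -/
def antiComul : H →ₗ[k] H ⊗[k] H := Q.flipS.toLinearMap ∘ₗ Q.Delta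

@[simp] lemma flipS_tmul (a b : H) : Q.flipS (a ⊗ₜ b) = Q.S b ⊗ₜ Q.S a := rfl

@[simp] lemma flipS_mul (x y : H ⊗[k] H) : Q.flipS (x * y) = Q.flipS y * Q.flipS x := by
  induction x using TensorProduct.induction_on with
  | zero => simp
  | add x y hx hy => simp only [map_add, add_mul, mul_add, hx, hy]
  | tmul a b =>
    induction y using TensorProduct.induction_on with
    | zero => simp
    | add x y hx hy => simp only [map_add, add_mul, mul_add, hx, hy]
    | tmul c d => simp

@[simp] lemma flipS_one : Q.flipS 1 = 1 := by
  rw [Algebra.TensorProduct.one_def, flipS_tmul, S_one]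

lemma map_S_flip (x : H ⊗[k] H) : TensorProduct.map Q.S Q.S (flip x) = Q.flipS x := rfl

lemma flipS_map_Sinv_flip (x : H ⊗[k] H) :
    Q.flipS (TensorProduct.map Q.Sinv Q.Sinv (flip x)) = x := by
  induction x using TensorProduct.induction_on with
  | zero => simp [flip]
  | add x y hx hy => simp only [flip, map_add] at hx hy ⊢; rw [hx, hy]
  | tmul a b => simp [flip]

@[simp] lemma antiComul_apply (a : H) : Q.antiComul a = Q.flipS (Q.comul a) := rfl

lemma antiComul_mul (a b : H) : Q.antiComul (a * b) = Q.antiComul b * Q.antiComul a := by simp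

/-- The contraction `x ⊗ y ⊗ z ↦ (S(y) ⊗ S(x) α) q_L Δ(z)`, which takes `φ` to `γ`. -/
def gammaMap : H ⊗[k] (H ⊗[k] H) →ₗ[k] H ⊗[k] H :=
  ((inr k H H ∘ₗ Q.S) ◂ (1 ⊗ₜ Q.alpha)) ⊛ ((inl k H H ∘ₗ Q.S) ◂ Q.qL) ⊛ Q.Delta

lemma gamma_eq : Q.gamma = Q.gammaMap Q.phi := by
  have h : ∀ x y, TensorProduct.map LinearMap.id (sandwichLeft Q.S Q.alpha)
      (TensorProduct.leftComm k H H H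
        (TensorProduct.map LinearMap.id
          (TensorProduct.map (sandwichLeft Q.S Q.alpha) LinearMap.id ∘ₗ
            (TensorProduct.assoc k H H H).symm.toLinearMap)
          (((1 : H) ⊗ₜ[k] y) *
            TensorProduct.map LinearMap.id (TensorProduct.map LinearMap.id Q.Delta) x))) =
      (((inr k H H ∘ₗ Q.S) ◂ (1 ⊗ₜ Q.alpha)) ⊛ ((inl k H H ∘ₗ Q.S) ◂ Q.qLMap y) ⊛
        Q.Delta) x := by
    intro x y
    induction x using tensor3_induction with
    | add x y hx hy => simp only [map_add, mul_add, hx, hy]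
    | tmul a b c =>
      simp only [TensorProduct.map_tmul, Delta_apply, chain_tmul]
      generalize Q.comul c = e
      induction e using TensorProduct.induction_on with
      | zero => simp
      | add x y hx hy =>
        simp only [map_add, mul_add, TensorProduct.tmul_add, hx, hy]
      | tmul e1 e2 =>
        induction y using tensor3_induction with
        | add x y hx hy =>
          simp only [map_add, add_mul, mul_add, TensorProduct.tmul_add, rmul_apply] at hx hy ⊢
          rw [hx, hy]
        | tmul y1 y2 y3 => simp [mul_assoc]
  rw [gamma, h, gammaMap, qL_eq]

/-- `(S(a₂) ⊗ S(a₁)) γ Δ(a₃) = ε(a) γ`, where `(Δ ⊗ id)(Δ(a)) = a₁ ⊗ a₂ ⊗ a₃`. -/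
lemma leftInv_gamma : Q.LeftInv ((Q.antiComul ◂ Q.gamma) ⊛ Q.Delta) := by
  refine leftInv_chain Q.antiComul_mul Q.comul fun a => ?_
  have hr : ∀ d x, ((Q.antiComul ◂ Q.gammaMap x) ⊛ Q.comul.toLinearMap) d =
      Q.gammaMap (x * Q.comulFst d) := by
    intro d x
    induction d using TensorProduct.induction_on with
    | zero => simp
    | add x y hx hy => simp only [map_add, mul_add, hx, hy]
    | tmul b c =>
      rw [comulFst_tmul, chain_tmul, rmul_apply, antiComul_apply]
      generalize Q.comul b = e
      induction e using TensorProduct.induction_on with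
      | zero => simp
      | add x y hx hy => simp only [map_add, add_mul, mul_add, TensorProduct.add_tmul, hx, hy]
      | tmul e1 e2 =>
        induction x using tensor3_induction with
        | add x y hx hy => simp only [map_add, add_mul, mul_add, hx, hy]
        | tmul x1 x2 x3 =>
          simp only [gammaMap, chain_tmul, rmul_apply, LinearMap.comp_apply, inl_apply, inr_apply,
            Delta_apply, TensorProduct.assoc_tmul, Algebra.TensorProduct.tmul_mul_tmul, ← mul_assoc,
            flipS_tmul, S_mul, map_mul, AlgHom.toLinearMap_apply, one_mul, mul_one]
  have hs : ∀ d x1 t, Q.gammaMap (Q.comulSnd d * (x1 ⊗ₜ t)) =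
      (1 ⊗ₜ (Q.S x1 * sandwichLeft Q.S Q.alpha d)) *
        (((inl k H H ∘ₗ Q.S) ◂ Q.qL) ⊛ Q.Delta) t := by
    intro d x1 t
    induction d using TensorProduct.induction_on with
    | zero => simp
    | add x y hx hy => simp only [map_add, add_mul, mul_add, TensorProduct.tmul_add, hx, hy]
    | tmul b c =>
      rw [comulSnd_tmul, Algebra.TensorProduct.tmul_mul_tmul, gammaMap, chain_tmul, qL_cov_mul,
        ← mul_assoc]
      simp [mul_assoc]
  have hs' : ∀ x, Q.gammaMap (Q.comulSnd (Q.comul a) * x) = Q.counit a • Q.gammaMap x := by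
    intro x
    induction x using TensorProduct.induction_on with
    | zero => simp
    | add x y hx hy => simp only [map_add, mul_add, smul_add, hx, hy]
    | tmul x1 t =>
      rw [hs, sandwichLeft_comul, gammaMap, chain_tmul]
      simp
  rw [gamma_eq, hr, ← comulSnd_comul, hs']

lemma twist_eq : Q.twist =
    ((Q.antiComul ◂ Q.gamma) ⊛ (Q.Delta ◂ Q.comul Q.beta) ⊛ (Q.Delta ∘ₗ Q.S)) Q.phiInv := by
  rw [twist, pR_eq]
  generalize Q.phiInv = x
  induction x using tensor3_induction with
  | add x y hx hy => simp only [map_add, hx, hy]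
  | tmul a b c =>
    simp only [pRMap_tmul, TensorProduct.lift.tmul, LinearMap.comp_apply, LinearMap.compl₂_apply,
      LinearMap.mulRight_apply, LinearMap.mul_apply', chain_tmul, rmul_apply, Delta_apply, map_mul]
    rfl

/-- The twist compares `(S ⊗ S) Δᵒᵖ` with `Δ S`. -/
lemma antiComul_mul_twist (a : H) :
    Q.antiComul a * Q.twist = Q.twist * Q.comul (Q.S a) := by
  let F := (Q.antiComul ◂ Q.gamma) ⊛ (Q.Delta ◂ Q.comul Q.beta) ⊛ (Q.Delta ∘ₗ Q.S)
  have hl : ∀ (b : H) x, F (x * (b ⊗ₜ 1)) = Q.antiComul b * F x := by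
    intro b x
    induction x using tensor3_induction with
    | add x y hx hy => simp only [map_add, add_mul, mul_add, hx, hy]
    | tmul x1 x2 x3 => simp [F, mul_assoc]
  have hr : ∀ x, F ((1 ⊗ₜ (1 ⊗ₜ a)) * x) = F x * Q.comul (Q.S a) := by
    intro x
    induction x using tensor3_induction with
    | add x y hx hy => simp only [map_add, add_mul, mul_add, hx, hy]
    | tmul x1 x2 x3 => simp [F, mul_assoc]
  rw [twist_eq, ← hl, ← hr]
  have h1 := Q.rightInv_beta_comul.chain_comulSnd (f₁ := Q.antiComul ◂ Q.gamma) (Q.comul a) Q.phiInv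
  have h2 := (Q.leftInv_gamma.mul_right (Q.comul Q.beta)).chain_comulFst (f₃ := Q.Delta ∘ₗ Q.S)
    (Q.comul a) Q.phiInv
  rw [counitSnd_comul] at h1
  rw [counitFst_comul] at h2
  exact h1.symm.trans ((congrArg F (Q.phiInv_mul_comulSnd a)).trans h2)

lemma twist_mul_comul_alpha : Q.twist * Q.comul Q.alpha = Q.gamma := by
  let M := (Q.antiComul ◂ Q.gamma) ⊛ (Q.Delta ◂ Q.comul Q.beta) ⊛
    ((Q.Delta ∘ₗ Q.S) ◂ Q.comul Q.alpha) ⊛ Q.Delta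
  have hr : ∀ x, M (padRight k H x) = ((Q.antiComul ◂ Q.gamma) ⊛ (Q.Delta ◂ Q.comul Q.beta) ⊛
      (Q.Delta ∘ₗ Q.S)) x * Q.comul Q.alpha := by
    intro x
    induction x using tensor3_induction with
    | add x y hx hy => simp only [map_add, add_mul, hx, hy]
    | tmul a b c => simp [M, mul_assoc]
  have hl : ∀ x, M (padLeft k H x) = Q.gamma * Q.comul (Q.zigzag x) := by
    intro x
    induction x using tensor3_induction with
    | add x y hx hy => simp only [map_add, mul_add, hx, hy]
    | tmul a b c => simp [M, mul_assoc]
  rw [twist_eq, ← hr, ← (Q.leftInv_gamma.mul_right _).chain_d1 Q.e1_phi, d1_mul_padRight_inv,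
    (Q.rightInv_beta_comul.mul_right _).chain_d2 Q.e2_phi,
    Q.leftInv_alpha_comul.chain_d3 Q.e3_phiInv, hl, zigzag_phi, map_one, mul_one]

/-- `f Δ(S(x) α y) p_R (1 ⊗ S(z)) = (S(x₂) ⊗ S(x₁)) γ Δ(y) p_R (1 ⊗ S(z))`, which removes `f` from
the product `f U`. -/
lemma twist_mul_explicitU_aux : Q.twist * Q.explicitU =
    ((Q.antiComul ◂ Q.gamma) ⊛ (Q.Delta ◂ Q.pR) ⊛ (inr k H H ∘ₗ Q.S)) Q.phiInv := by
  rw [explicitU]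
  generalize Q.phiInv = x
  induction x using tensor3_induction with
  | add x y hx hy => simp only [map_add, mul_add, hx, hy]
  | tmul a b c =>
    simp only [chain_tmul, rmul_apply, LinearMap.comp_apply, Delta_apply, ← mul_assoc]
    rw [← antiComul_mul_twist, mul_assoc (Q.antiComul a), twist_mul_comul_alpha]

lemma flipS_qRMap_tmul (a b c : H) :
    Q.flipS (Q.qRMap (a ⊗ₜ (b ⊗ₜ c))) = (Q.S b * (Q.alpha * c)) ⊗ₜ Q.S a := by
  simp [mul_assoc]

/-- The defining property of `U`: `f U = (S ⊗ S)(q_R²¹)`. -/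
lemma twist_mul_explicitU : Q.twist * Q.explicitU = Q.flipS Q.qR := by
  let l₂ := (inl k H H ∘ₗ Q.S) ◂ Q.qL
  let l₃ := Q.Delta ◂ Q.pR
  let l₄ := inr k H H ∘ₗ Q.S
  let M := ((inr k H H ∘ₗ Q.S) ◂ (1 ⊗ₜ Q.alpha)) ⊛ l₂ ⊛ l₃ ⊛ l₄
  have h : ∀ x y, ((Q.antiComul ◂ Q.gammaMap x) ⊛ l₃ ⊛ l₄) y = M (padRight k H x * Q.d1 y) := by
    intro x y
    induction y using tensor3_induction with
    | add x y hx hy => simp only [map_add, mul_add, hx, hy]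
    | tmul a b c =>
      rw [d1_tmul, chain_tmul, rmul_apply, antiComul_apply]
      generalize Q.comul a = e
      induction e using TensorProduct.induction_on with
      | zero => simp
      | add x y hx hy => simp only [map_add, mul_add, add_mul, TensorProduct.add_tmul, hx, hy]
      | tmul e1 e2 =>
        induction x using tensor3_induction with
        | add x y hx hy => simp only [map_add, add_mul, mul_add, hx, hy]
        | tmul x1 x2 x3 =>
          simp only [M, l₂, l₃, l₄, gammaMap, chain_tmul, rmul_apply, LinearMap.comp_apply,
            inl_apply, inr_apply, Delta_apply, TensorProduct.assoc_tmul, padRight_tmul,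
            Algebra.TensorProduct.tmul_mul_tmul, ← mul_assoc, flipS_tmul, S_mul, map_mul,
            one_mul, mul_one]
  have h3 : ∀ t a b c, M (t * Q.d3 (a ⊗ₜ (b ⊗ₜ c))) =
      (Q.S b ⊗ₜ Q.S a) * M t * (c ⊗ₜ 1) := by
    intro t a b c
    induction t using tensor4_induction with
    | add x y hx hy => simp only [map_add, add_mul, mul_add, hx, hy]
    | tmul t1 t2 t3 t4 =>
      have e : ∀ u v s, M (u ⊗ₜ (v ⊗ₜ s)) = (Q.S v ⊗ₜ (Q.S u * Q.alpha)) * Q.qL *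
          (l₃ ⊛ l₄) s := by
        intro u v s
        simp [M, l₂, ← mul_assoc]
      rw [d3_tmul, comulSnd_tmul, Algebra.TensorProduct.tmul_mul_tmul,
        Algebra.TensorProduct.tmul_mul_tmul, e, e, pR_cov_mul]
      simp only [S_mul, ← mul_assoc, Algebra.TensorProduct.tmul_mul_tmul]
      rfl
  have h2 : ∀ x y, (l₂ ⊛ l₃ ⊛ l₄) y = Q.alpha ⊗ₜ Q.beta →
      M (Q.d2 x * padLeft k H y) = Q.alpha ⊗ₜ Q.zigzag' x := by
    intro x y hy
    have e : ∀ a b c, M (Q.d2 (a ⊗ₜ (b ⊗ₜ c)) * padLeft k H y) =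
        (1 ⊗ₜ (Q.S a * Q.alpha * b)) * (l₂ ⊛ l₃ ⊛ l₄) y * (1 ⊗ₜ Q.S c) := by
      intro a b c
      clear hy
      induction y using tensor3_induction with
      | add x y hx hy => simp only [map_add, add_mul, mul_add, hx, hy]
      | tmul y1 y2 y3 =>
        have e : ∀ u s v, M (u ⊗ₜ TensorProduct.assoc k H H H (s ⊗ₜ v)) =
            (1 ⊗ₜ (Q.S u * Q.alpha)) * (l₂ ⊛ Q.Delta) s * (Q.pR * (1 ⊗ₜ Q.S v)) := by
          intro u s v
          induction s using TensorProduct.induction_on with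
          | zero => simp
          | add x y hx hy =>
            simp only [TensorProduct.add_tmul, TensorProduct.tmul_add, map_add, add_mul, mul_add,
              hx, hy]
          | tmul s1 s2 => simp [M, l₃, l₄, mul_assoc]
        rw [d2_tmul, comulFst_tmul, padLeft_apply, Algebra.TensorProduct.tmul_mul_tmul,
          ← TensorProduct.assoc_tmul, ← assoc_mul, Algebra.TensorProduct.tmul_mul_tmul, e,
          qL_cov_mul]
        simp only [l₂, l₃, l₄, TensorProduct.assoc_tmul, chain_tmul, rmul_apply,
          LinearMap.comp_apply, inl_apply, inr_apply, Delta_apply, S_mul, ← mul_assoc,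
          Algebra.TensorProduct.tmul_mul_tmul, one_mul, mul_one]
        simp only [mul_assoc, Algebra.TensorProduct.tmul_mul_tmul, one_mul]
    induction x using tensor3_induction with
    | add x y hx hy => simp only [map_add, add_mul, TensorProduct.tmul_add, hx, hy]
    | tmul a b c => rw [e, hy]; simp [mul_assoc]
  have h2' : M (Q.d2 Q.phiInv * padLeft k H Q.phiInv) = Q.alpha ⊗ₜ 1 := by
    rw [h2 _ _ Q.qL_pR_contract, zigzag'_phiInv]
  have h3' : ∀ x, M (Q.d2 Q.phiInv * padLeft k H Q.phiInv * Q.d3 x) = Q.flipS (Q.qRMap x) := by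
    intro x
    induction x using tensor3_induction with
    | add x y hx hy => simp only [map_add, mul_add, hx, hy]
    | tmul a b c => rw [h3, h2', flipS_qRMap_tmul]; simp [mul_assoc]
  rw [twist_mul_explicitU_aux, gamma_eq, h, padRight_mul_d1_inv, h3', qR_eq]

/-- `(S(x₂) ⊗ S(x₁)) (S ⊗ S)(q_R²¹) (y β S(z) ⊗ 1) = 1 ⊗ 1`. -/
lemma pR_qR_cancel : ((Q.antiComul ◂ Q.flipS Q.qR) ⊛ (inl k H H ◂ (Q.beta ⊗ₜ 1)) ⊛
    (inl k H H ∘ₗ Q.S)) Q.phiInv = 1 := by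
  let M := (inr k H H ∘ₗ Q.S) ⊛ ((inl k H H ∘ₗ Q.S) ◂ (Q.alpha ⊗ₜ 1)) ⊛
    (inl k H H ◂ (Q.beta ⊗ₜ 1)) ⊛ (inl k H H ∘ₗ Q.S)
  have h : ∀ x y, ((Q.antiComul ◂ Q.flipS (Q.qRMap x)) ⊛ (inl k H H ◂ (Q.beta ⊗ₜ 1)) ⊛
    (inl k H H ∘ₗ Q.S)) y = M (padRight k H x * Q.d1 y) := by
    intro x y
    induction y using tensor3_induction with
    | add x y hx hy => simp only [map_add, mul_add, hx, hy]
    | tmul a b c =>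
      rw [d1_tmul, chain_tmul, rmul_apply, antiComul_apply]
      generalize Q.comul a = e
      induction e using TensorProduct.induction_on with
      | zero => simp
      | add x y hx hy => simp only [map_add, mul_add, add_mul, TensorProduct.add_tmul, hx, hy]
      | tmul e1 e2 =>
        induction x using tensor3_induction with
        | add x y hx hy => simp only [map_add, add_mul, mul_add, hx, hy]
        | tmul x1 x2 x3 => rw [flipS_qRMap_tmul]; simp [M, mul_assoc]
  have hl : ∀ x, M (padLeft k H x) = Q.zigzag' x ⊗ₜ 1 := by
    intro x
    induction x using tensor3_induction with
    | add x y hx hy => simp only [map_add, TensorProduct.add_tmul, hx, hy]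
    | tmul a b c => simp [M, mul_assoc]
  rw [qR_eq, h, padRight_mul_d1_inv, Q.rightInv_beta_inl.chain_d3 Q.e3_phi,
    (Q.leftInv_alpha_inl.mul_right _).chain_d2 Q.e2_phiInv, hl, zigzag'_phiInv]
  rfl

/-- A right inverse of `f` comes from `f U = (S ⊗ S)(q_R²¹)` and `pR_qR_cancel`; it is two-sided
because `H ⊗ H` is finite dimensional. -/
lemma isUnit_twist [Module.Finite k H] : IsUnit Q.twist := by
  obtain ⟨g, hg⟩ : ∃ g, Q.twist * g = 1 := by
    refine ⟨(((Q.Delta ∘ₗ Q.S) ◂ Q.explicitU) ⊛ (inl k H H ◂ (Q.beta ⊗ₜ 1)) ⊛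
      (inl k H H ∘ₗ Q.S)) Q.phiInv, ?_⟩
    rw [← pR_qR_cancel, ← twist_mul_explicitU]
    generalize Q.phiInv = x
    induction x using tensor3_induction with
    | add x y hx hy => simp only [map_add, mul_add, hx, hy]
    | tmul a b c =>
      simp only [chain_tmul, rmul_apply, LinearMap.comp_apply, Delta_apply, ← mul_assoc]
      rw [← antiComul_mul_twist]
  have hs : Function.Surjective (LinearMap.mulLeft k Q.twist) := fun y =>
    ⟨g * y, by rw [LinearMap.mulLeft_apply, ← mul_assoc, hg, one_mul]⟩
  have hi : Function.Injective (LinearMap.mulLeft k Q.twist) :=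
    LinearMap.injective_iff_surjective.mpr hs
  refine ⟨⟨Q.twist, g, hg, hi ?_⟩, rfl⟩
  simp only [LinearMap.mulLeft_apply]
  rw [← mul_assoc, hg, one_mul, mul_one]

lemma U_eq [Module.Finite k H] : Q.U = Q.explicitU := by
  rw [U, map_S_flip, ← twist_mul_explicitU, ← mul_assoc,
    Ring.inverse_mul_cancel _ Q.isUnit_twist, one_mul]

/-! ### The element `V` -/

/-- The defining property of `V`: `(S ⊗ S)(V²¹) = f p_R`. -/
lemma flipS_V : Q.flipS Q.V = Q.twist * Q.pR := by
  rw [V, flipS_mul, flipS_map_Sinv_flip, twistH, flipS_map_Sinv_flip]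

/-- `(a₂ ⊗ 1) V Δ(S⁻¹(a₁)) = (1 ⊗ S⁻¹(a)) V`. -/
lemma V_cov (a : H) :
    ((Q.V ▸▸ (Q.Delta ∘ₗ Q.Sinv)) ⊚ inl k H H) (Q.comul a) = (1 ⊗ₜ Q.Sinv a) * Q.V := by
  apply Q.flipS.injective
  have h : ∀ d, Q.flipS (((Q.V ▸▸ (Q.Delta ∘ₗ Q.Sinv)) ⊚ inl k H H) d) =
      Q.twist * ((Q.Delta ◂ Q.pR) ⊛ (inr k H H ∘ₗ Q.S)) d := by
    intro d
    induction d using TensorProduct.induction_on with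
    | zero => simp
    | add x y hx hy => simp only [map_add, mul_add, hx, hy]
    | tmul b c =>
      have := Q.antiComul_mul_twist (Q.Sinv b)
      rw [antiComul_apply, S_Sinv] at this
      simp only [rchain_tmul, lmul_apply, LinearMap.comp_apply, Delta_apply, flipS_mul, flipS_V,
        chain_tmul, rmul_apply, inl_apply, inr_apply, flipS_tmul, S_one]
      simp only [← mul_assoc, this]
  rw [h, pR_cov, flipS_mul, flipS_V]
  simp [mul_assoc]

/-- `(z ⊗ 1) V Δ(S⁻¹(y)) Δ(S⁻¹(α) x) = q_R`. -/
lemma V_contract :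
    ((Q.comul (Q.Sinv Q.alpha) ▸▸ Q.Delta) ⊚ (Q.V ▸▸ (Q.Delta ∘ₗ Q.Sinv)) ⊚ inl k H H) Q.phiInv =
      Q.qR := by
  apply Q.flipS.injective
  rw [← twist_mul_explicitU, twist_mul_explicitU_aux]
  generalize Q.phiInv = x
  induction x using tensor3_induction with
  | add x y hx hy => simp only [map_add, hx, hy]
  | tmul a b c =>
    have h1 := Q.antiComul_mul_twist (Q.Sinv b)
    have h2 := Q.antiComul_mul_twist (Q.Sinv Q.alpha)
    rw [antiComul_apply, S_Sinv] at h1 h2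
    rw [twist_mul_comul_alpha] at h2
    simp only [rchain_tmul, lmul_apply, LinearMap.comp_apply, Delta_apply, flipS_mul, flipS_V,
        chain_tmul, rmul_apply, inl_apply, inr_apply, flipS_tmul, S_one, antiComul_apply]
    rw [← h2]
    simp only [mul_assoc]
    rw [← mul_assoc (Q.flipS (Q.comul (Q.Sinv b))), h1]
    simp only [← mul_assoc]

/-- The explicit form `V = (1 ⊗ S⁻¹(p_L²)) q_R Δ(p_L¹)`. -/
lemma V_eq : Q.V = ((Q.Delta ∘ₗ Q.Sinv) ⊚ ((Q.qR ▸▸ Q.Delta) ◂ Q.comul (Q.Sinv Q.beta)) ⊚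
    (inr k H H ∘ₗ Q.Sinv)) Q.phi := by
  apply Q.flipS.injective
  rw [flipS_V, ← explicitU_contract]
  generalize Q.phi = x
  induction x using tensor3_induction with
  | add x y hx hy => simp only [map_add, mul_add, hx, hy]
  | tmul a b c =>
    have h1 := Q.antiComul_mul_twist (Q.Sinv a)
    have h2 := Q.antiComul_mul_twist (Q.Sinv Q.beta)
    have h3 := Q.antiComul_mul_twist b
    rw [antiComul_apply] at h1 h2 h3
    rw [S_Sinv] at h1 h2
    simp only [rchain_tmul, rmul_apply, lmul_apply, LinearMap.comp_apply, Delta_apply, flipS_mul,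
        chain_tmul, rmul_apply, inl_apply, inr_apply, flipS_tmul, S_one, S_Sinv,
        ← twist_mul_explicitU]
    simp only [← mul_assoc, ← h1]
    rw [mul_assoc _ Q.twist, ← h2, ← mul_assoc]
    rw [mul_assoc _ Q.twist, ← h3, ← mul_assoc]

end QuasiHopfAlgebra

section
variable {k : Type*} [Field k] {A B : Type*} [Ring A] [Algebra k A] [Ring B] [Algebra k B]

lemma inl_mul (a b : A) : inl k A B (a * b) = inl k A B a * inl k A B b := by simp

lemma inr_mul (a b : B) : inr k A B (a * b) = inr k A B a * inr k A B b := by simp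

lemma inr_mul_inl (a : A) (b : B) : inr k A B b * inl k A B a = inl k A B a * inr k A B b := by
  simp

lemma inr_mul_inl_mul (a : A) (b : B) (c : A ⊗[k] B) :
    inr k A B b * (inl k A B a * c) = inl k A B a * (inr k A B b * c) := by
  rw [← mul_assoc, inr_mul_inl, mul_assoc]

lemma tmul_eq_inl_mul_inr (a : A) (b : B) : a ⊗ₜ[k] b = inl k A B a * inr k A B b := by simp

end

namespace QuasiHopfAlgebra

variable {k H : Type*} [Field k] [Ring H] [Algebra k H] (Q : QuasiHopfAlgebra k H)

/-! ### Coassociativity of `U` and `V` -/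

/-- `(id ⊗ Δ) Δ`, as opposed to `(Δ ⊗ id) Δ`, which is written `comulFst (comul a)`. -/
def comul3 : H →ₐ[k] H ⊗[k] (H ⊗[k] H) := Q.comulSnd.comp Q.comul

lemma comul3_mul_phi (a : H) :
    Q.comul3 a * Q.phi = Q.phi * Q.comulFst (Q.comul a) := Q.comulSnd_comul a

lemma phiInv_mul_comul3 (a : H) :
    Q.phiInv * Q.comul3 a = Q.comulFst (Q.comul a) * Q.phiInv := Q.phiInv_mul_comulSnd a

variable (k H) in
/-- `a ↦ 1 ⊗ a ⊗ 1`. -/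
def mid : H →ₗ[k] H ⊗[k] (H ⊗[k] H) := inr k H (H ⊗[k] H) ∘ₗ inl k H H

variable (k H) in
/-- `a ↦ 1 ⊗ 1 ⊗ a`. -/
def last : H →ₗ[k] H ⊗[k] (H ⊗[k] H) := inr k H (H ⊗[k] H) ∘ₗ inr k H H

variable (k H) in
/-- `a ↦ 1 ⊗ 1 ⊗ a`, as an algebra map. -/
def lastHom : H →ₐ[k] H ⊗[k] (H ⊗[k] H) :=
  (Algebra.TensorProduct.includeRight : H ⊗[k] H →ₐ[k] H ⊗[k] (H ⊗[k] H)).comp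
    (Algebra.TensorProduct.includeRight : H →ₐ[k] H ⊗[k] H)

/-- `a ↦ 1 ⊗ Δ(a)`. -/
def comulRight : H →ₐ[k] H ⊗[k] (H ⊗[k] H) :=
  (Algebra.TensorProduct.includeRight : H ⊗[k] H →ₐ[k] H ⊗[k] (H ⊗[k] H)).comp Q.comul

lemma rightInv_beta_last :
    Q.RightInv ((last k H ◂ last k H Q.beta) ⊛ (last k H ∘ₗ Q.S)) :=
  Q.rightInv_beta (lastHom k H)

lemma leftInv_alpha_last :
    Q.LeftInv ((last k H (Q.Sinv Q.alpha) ▸▸ last k H) ⊚ (last k H ∘ₗ Q.Sinv)) :=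
  Q.leftInv_alpha_inv (lastHom k H)

lemma rightInv_beta_comulRight :
    Q.RightInv (((inr k H (H ⊗[k] H) ∘ₗ Q.Delta) ◂ inr k H (H ⊗[k] H) (Q.comul Q.beta)) ⊛
      (inr k H (H ⊗[k] H) ∘ₗ Q.Delta ∘ₗ Q.S)) :=
  Q.rightInv_beta Q.comulRight

lemma leftInv_alpha_comulRight :
    Q.LeftInv ((inr k H (H ⊗[k] H) (Q.comul (Q.Sinv Q.alpha)) ▸▸
      (inr k H (H ⊗[k] H) ∘ₗ Q.Delta)) ⊚ (inr k H (H ⊗[k] H) ∘ₗ Q.Delta ∘ₗ Q.Sinv)) :=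
  Q.leftInv_alpha_inv Q.comulRight

lemma explicitU_cov_mul (t : H ⊗[k] H) (a : H) :
    (((Q.Delta ∘ₗ Q.S) ◂ Q.explicitU) ⊛ inl k H H) (Q.comul a * t) =
      (((Q.Delta ∘ₗ Q.S) ◂ Q.explicitU) ⊛ inl k H H) t * inr k H H (Q.S a) := by
  have h : ∀ t1 t2 d, (((Q.Delta ∘ₗ Q.S) ◂ Q.explicitU) ⊛ inl k H H) (d * (t1 ⊗ₜ t2)) =
      Q.comul (Q.S t1) * (((Q.Delta ∘ₗ Q.S) ◂ Q.explicitU) ⊛ inl k H H) d * inl k H H t2 := by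
    intro t1 t2 d
    induction d using TensorProduct.induction_on with
    | zero => simp
    | add x y hx hy => simp only [map_add, mul_add, add_mul, hx, hy]
    | tmul b c =>
      simp only [Algebra.TensorProduct.tmul_mul_tmul, chain_tmul, rmul_apply,
        LinearMap.comp_apply, S_mul, Delta_apply, map_mul, inl_mul, mul_assoc]
  induction t using TensorProduct.induction_on with
  | zero => simp
  | add x y hx hy => simp only [map_add, mul_add, add_mul, hx, hy]
  | tmul t1 t2 =>
    have e : (1 : H) ⊗ₜ[k] Q.S a = inr k H H (Q.S a) := rfl
    rw [h, explicitU_cov, chain_tmul, e]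
    simp only [rmul_apply, LinearMap.comp_apply, Delta_apply, mul_assoc, inr_mul_inl]

lemma V_cov_mul (t : H ⊗[k] H) (a : H) :
    ((Q.V ▸▸ (Q.Delta ∘ₗ Q.Sinv)) ⊚ inl k H H) (t * Q.comul a) =
      inr k H H (Q.Sinv a) * ((Q.V ▸▸ (Q.Delta ∘ₗ Q.Sinv)) ⊚ inl k H H) t := by
  have h : ∀ t1 t2 d, ((Q.V ▸▸ (Q.Delta ∘ₗ Q.Sinv)) ⊚ inl k H H) ((t1 ⊗ₜ t2) * d) =
      inl k H H t2 * ((Q.V ▸▸ (Q.Delta ∘ₗ Q.Sinv)) ⊚ inl k H H) d * Q.comul (Q.Sinv t1) := by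
    intro t1 t2 d
    induction d using TensorProduct.induction_on with
    | zero => simp
    | add x y hx hy => simp only [map_add, mul_add, add_mul, hx, hy]
    | tmul b c =>
      simp only [Algebra.TensorProduct.tmul_mul_tmul, rchain_tmul, lmul_apply,
        LinearMap.comp_apply, Sinv_mul, Delta_apply, map_mul, inl_mul, mul_assoc]
  induction t using TensorProduct.induction_on with
  | zero => simp
  | add x y hx hy => simp only [map_add, mul_add, add_mul, hx, hy]
  | tmul t1 t2 =>
    rw [h, V_cov, rchain_tmul]
    simp only [lmul_apply, LinearMap.comp_apply, Delta_apply, mul_assoc, inr_mul_inl_mul]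
    rfl

/-- `φ (Δ ⊗ id)(p_R) = x ⊗ Δ(y) p_R (1 ⊗ S(z))`, where `φ⁻¹ = x ⊗ y ⊗ z`. -/
lemma phi_mul_comulFst_pR_aux : Q.phi * Q.comulFst Q.pR =
    (inl k H (H ⊗[k] H) ⊛ ((inr k H (H ⊗[k] H) ∘ₗ Q.Delta) ◂ inr k H (H ⊗[k] H) Q.pR) ⊛
      (last k H ∘ₗ Q.S)) Q.phiInv := by
  let M := inl k H (H ⊗[k] H) ⊛ mid k H ⊛ (last k H ◂ last k H Q.beta) ⊛ (last k H ∘ₗ Q.S)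
  have h1 : ∀ x y, y * Q.comulFst (Q.pRMap x) = M (padRight k H y * Q.d1 x) := by
    intro x y
    induction x using tensor3_induction with
    | add x y hx hy => simp only [map_add, mul_add, hx, hy]
    | tmul a b c =>
      rw [pRMap_tmul, comulFst_tmul, d1_tmul]
      generalize Q.comul a = e
      induction e using TensorProduct.induction_on with
      | zero => simp
      | add x y hx hy => simp only [map_add, mul_add, TensorProduct.add_tmul, hx, hy]
      | tmul e1 e2 =>
        induction y using tensor3_induction with
        | add x y hx hy => simp only [map_add, add_mul, hx, hy]
        | tmul y1 y2 y3 => simp [M, mid, last, mul_assoc]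
  have h2 : ∀ x y, M (Q.d2 x * padLeft k H y) = (inl k H (H ⊗[k] H) ⊛
      ((inr k H (H ⊗[k] H) ∘ₗ Q.Delta) ◂ inr k H (H ⊗[k] H) (Q.pRMap y)) ⊛
      (last k H ∘ₗ Q.S)) x := by
    intro x y
    induction x using tensor3_induction with
    | add x y hx hy => simp only [map_add, add_mul, hx, hy]
    | tmul a b c =>
      rw [d2_tmul, comulFst_tmul, chain_tmul, chain_tmul, rmul_apply, LinearMap.comp_apply,
        Delta_apply]
      generalize Q.comul b = e
      induction e using TensorProduct.induction_on with
      | zero => simp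
      | add x y hx hy =>
        simp only [map_add, mul_add, add_mul, TensorProduct.add_tmul, TensorProduct.tmul_add,
          hx, hy]
      | tmul e1 e2 =>
        induction y using tensor3_induction with
        | add x y hx hy => simp only [map_add, add_mul, mul_add, hx, hy]
        | tmul y1 y2 y3 => simp [M, mid, last, mul_assoc]
  rw [pR_eq, h1, padRight_mul_d1_inv, Q.rightInv_beta_last.chain_d3 Q.e3_phi, h2]

/-- `φ (Δ ⊗ id)(p_R) = (id ⊗ Δ)(Δ(X) p_R) (1 ⊗ Δ(S(Y)) U (Z ⊗ 1))`. -/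
lemma phi_mul_comulFst_pR : Q.phi * Q.comulFst Q.pR =
    ((Q.comul3.toLinearMap ◂ Q.comulSnd Q.pR) ⊛
      ((inr k H (H ⊗[k] H) ∘ₗ Q.Delta ∘ₗ Q.S) ◂ inr k H (H ⊗[k] H) Q.explicitU) ⊛
      mid k H) Q.phi := by
  let F := (Q.Delta ◂ Q.comul Q.beta) ⊛ ((Q.Delta ∘ₗ Q.S) ◂ Q.explicitU) ⊛ inl k H H
  let l₃ := (inr k H (H ⊗[k] H) ∘ₗ Q.Delta ∘ₗ Q.S) ◂ inr k H (H ⊗[k] H) Q.explicitU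
  let M := inl k H (H ⊗[k] H) ⊛
    ((inr k H (H ⊗[k] H) ∘ₗ Q.Delta) ◂ inr k H (H ⊗[k] H) (Q.comul Q.beta)) ⊛ l₃ ⊛ mid k H
  have hl : ∀ t, (l₃ ⊛ mid k H) t = inr k H (H ⊗[k] H)
      ((((Q.Delta ∘ₗ Q.S) ◂ Q.explicitU) ⊛ inl k H H) t) := by
    intro t
    induction t using TensorProduct.induction_on with
    | zero => simp
    | add x y hx hy => simp only [map_add, hx, hy]
    | tmul a b => simp only [l₃, mid, chain_tmul, rmul_apply, LinearMap.comp_apply, inr_mul]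
  have h1 : ∀ x y, (inl k H (H ⊗[k] H) ⊛
      ((inr k H (H ⊗[k] H) ∘ₗ Q.Delta) ◂ inr k H (H ⊗[k] H) (F y)) ⊛ (last k H ∘ₗ Q.S)) x =
      M (Q.d3 x * padLeft k H y) := by
    intro x y
    induction x using tensor3_induction with
    | add x y hx hy => simp only [map_add, add_mul, hx, hy]
    | tmul a b c =>
      induction y using tensor3_induction with
      | add x y hx hy =>
        simp only [map_add, mul_add, add_mul, chain_tmul, rmul_apply] at hx hy ⊢
        rw [hx, hy]
      | tmul y1 y2 y3 =>
        rw [d3_tmul, comulSnd_tmul, padLeft_apply, Algebra.TensorProduct.tmul_mul_tmul,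
          Algebra.TensorProduct.tmul_mul_tmul, mul_one]
        have e : (l₃ ⊛ mid k H) (Q.comul c * y2 ⊗ₜ y3) = _ := (hl _).trans
          (congrArg _ (Q.explicitU_cov_mul _ _))
        simp only [M, F, chain_tmul, e]
        simp only [rmul_apply, LinearMap.comp_apply, Delta_apply, map_mul, inr_mul,
          mul_assoc, last]
  have h2 : ∀ x y, M (Q.d1 x * padRight k H y) =
      ((Q.comul3.toLinearMap ◂ Q.comulSnd (Q.pRMap y)) ⊛ l₃ ⊛ mid k H) x := by
    intro x y
    induction x using tensor3_induction with
    | add x y hx hy => simp only [map_add, add_mul, hx, hy]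
    | tmul a b c =>
      rw [d1_tmul, chain_tmul, rmul_apply, AlgHom.toLinearMap_apply, comul3, AlgHom.comp_apply]
      generalize Q.comul a = e
      induction e using TensorProduct.induction_on with
      | zero => simp
      | add x y hx hy =>
        simp only [map_add, add_mul, TensorProduct.add_tmul, hx, hy]
      | tmul e1 e2 =>
        induction y using tensor3_induction with
        | add x y hx hy => simp only [map_add, add_mul, mul_add, hx, hy]
        | tmul y1 y2 y3 =>
          simp only [M, l₃, padRight_tmul, TensorProduct.assoc_tmul, chain_tmul, mul_one,
            Algebra.TensorProduct.tmul_mul_tmul, rmul_apply, LinearMap.comp_apply, Delta_apply,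
            pRMap_tmul, comulSnd_tmul, map_mul, S_mul, mid]
          simp only [tmul_eq_inl_mul_inr, inl_mul, inr_mul, mul_assoc]
  have hβ := Q.rightInv_beta_comulRight
  have hU : Q.pR = F Q.phi := Q.explicitU_contract.symm
  rw [phi_mul_comulFst_pR_aux]
  conv_lhs => rw [hU]
  rw [h1, d3_inv_mul_padLeft]
  simp only [M, l₃]
  rw [(hβ.mul_right _).chain_d2 Q.e2_phiInv]
  refine (h2 _ _).trans ?_
  rw [pR_eq]

/-- `φ (Δ ⊗ id)(U) = (id ⊗ Δ)(Δ(S(x)) U) (1 ⊗ U) (y ⊗ z ⊗ 1)`, where `φ⁻¹ = x ⊗ y ⊗ z`. -/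
lemma phi_mul_comulFst_explicitU : Q.phi * Q.comulFst Q.explicitU =
    (((Q.comul3.toLinearMap ∘ₗ Q.S) ◂
        (Q.comulSnd Q.explicitU * inr k H (H ⊗[k] H) Q.explicitU)) ⊛
      inl k H (H ⊗[k] H) ⊛ mid k H) Q.phiInv := by
  let F := ((Q.Delta ∘ₗ Q.S) ◂ Q.comul Q.alpha) ⊛ (Q.Delta ◂ Q.pR) ⊛ (inr k H H ∘ₗ Q.S)
  let l₃ := (inr k H (H ⊗[k] H) ∘ₗ Q.Delta ∘ₗ Q.S) ◂ inr k H (H ⊗[k] H) Q.explicitU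
  let l₁ := (Q.comul3.toLinearMap ∘ₗ Q.S) ◂ Q.comul3 Q.alpha
  let l₂ := Q.comul3.toLinearMap ◂ Q.comulSnd Q.pR
  let M := l₁ ⊛ l₂ ⊛ l₃ ⊛ mid k H
  have hl : ∀ t, (l₃ ⊛ mid k H) t = inr k H (H ⊗[k] H)
      ((((Q.Delta ∘ₗ Q.S) ◂ Q.explicitU) ⊛ inl k H H) t) := by
    intro t
    induction t using TensorProduct.induction_on with
    | zero => simp
    | add x y hx hy => simp only [map_add, hx, hy]
    | tmul a b => simp only [l₃, mid, chain_tmul, rmul_apply, LinearMap.comp_apply, inr_mul]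
  have hc : ∀ t, (l₂ ⊛ l₃) t = Q.comulSnd (((Q.Delta ◂ Q.pR) ⊛ (inr k H H ∘ₗ Q.S)) t) *
      inr k H (H ⊗[k] H) Q.explicitU := by
    intro t
    induction t using TensorProduct.induction_on with
    | zero => simp
    | add x y hx hy => simp only [map_add, add_mul, hx, hy]
    | tmul a b =>
      simp only [l₂, l₃, chain_tmul, rmul_apply, LinearMap.comp_apply, map_mul, inr_apply,
        comulSnd_tmul, Delta_apply, comul3, AlgHom.toLinearMap_apply, AlgHom.comp_apply, mul_assoc]
  have h0 : ∀ x, Q.phi * Q.comulFst (F x) = (l₁ ⊛ (Q.comul3.toLinearMap ◂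
      (Q.phi * Q.comulFst Q.pR)) ⊛ (last k H ∘ₗ Q.S)) x := by
    intro x
    induction x using tensor3_induction with
    | add x y hx hy => simp only [map_add, mul_add, hx, hy]
    | tmul a b c =>
      have e : Q.comulFst (1 ⊗ₜ Q.S c) = last k H (Q.S c) := by
        rw [comulFst_tmul, map_one]; rfl
      simp only [F, l₁, chain_tmul, rmul_apply, LinearMap.comp_apply, map_mul, inr_apply, e,
        Delta_apply, AlgHom.toLinearMap_apply]
      simp only [← mul_assoc, ← comul3_mul_phi]
      rw [mul_assoc _ Q.phi, ← comul3_mul_phi, ← mul_assoc, mul_assoc _ Q.phi, ← comul3_mul_phi,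
        ← mul_assoc]
  have h1 : ∀ x y, (l₁ ⊛ (Q.comul3.toLinearMap ◂ (l₂ ⊛ l₃ ⊛ mid k H) y) ⊛
      (last k H ∘ₗ Q.S)) x = M (Q.d3 x * padLeft k H y) := by
    intro x y
    induction x using tensor3_induction with
    | add x y hx hy => simp only [map_add, add_mul, hx, hy]
    | tmul a b c =>
      induction y using tensor3_induction with
      | add x y hx hy =>
        simp only [map_add, mul_add, add_mul, chain_tmul, rmul_apply] at hx hy ⊢
        rw [hx, hy]
      | tmul y1 y2 y3 =>
        rw [d3_tmul, comulSnd_tmul, padLeft_apply, Algebra.TensorProduct.tmul_mul_tmul,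
          Algebra.TensorProduct.tmul_mul_tmul, mul_one]
        have e : (l₃ ⊛ mid k H) (Q.comul c * y2 ⊗ₜ y3) = _ := (hl _).trans
          (congrArg _ (Q.explicitU_cov_mul _ _))
        have e' := hl (y2 ⊗ₜ y3)
        rw [chain_tmul] at e'
        simp only [M, chain_tmul, e, rmul_apply, e']
        simp only [l₂, rmul_apply, LinearMap.comp_apply, map_mul, inr_mul,
          mul_assoc, last, AlgHom.toLinearMap_apply]
  have h2 : ∀ x y, M (padRight k H y * Q.d2 x) =
      (((Q.comul3.toLinearMap ∘ₗ Q.S) ◂ (Q.comulSnd (F y) * inr k H (H ⊗[k] H) Q.explicitU)) ⊛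
        inl k H (H ⊗[k] H) ⊛ mid k H) x := by
    intro x y
    induction x using tensor3_induction with
    | add x y hx hy => simp only [map_add, mul_add, hx, hy]
    | tmul a b c =>
      induction y using tensor3_induction with
      | add x y hx hy =>
        simp only [map_add, mul_add, add_mul, chain_tmul, rmul_apply] at hx hy ⊢
        rw [hx, hy]
      | tmul y1 y2 y3 =>
        rw [d2_tmul, comulFst_tmul, padRight_tmul, Algebra.TensorProduct.tmul_mul_tmul,
          ← TensorProduct.assoc_tmul, ← assoc_mul, Algebra.TensorProduct.tmul_mul_tmul, one_mul]
        simp only [M]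
        rw [chain_tmul, chain_assoc, hc, pR_cov_mul]
        have e : Q.comulSnd (b ⊗ₜ[k] (1 : H)) = inl k H (H ⊗[k] H) b := by
          rw [comulSnd_tmul, map_one]; rfl
        have e' : ∀ u, Q.comulSnd (1 ⊗ₜ u) = inr k H (H ⊗[k] H) (Q.comul u) := fun u => rfl
        have e'' : ∀ u, Q.comulSnd (Q.comul u) = Q.comul3 u := fun u => rfl
        simp only [F, l₁, chain_tmul, rmul_apply, LinearMap.comp_apply, map_mul, inr_apply, e,
          e', e'', Delta_apply, AlgHom.toLinearMap_apply, S_mul, mul_assoc]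
        simp only [← inr_apply, inr_mul_inl_mul]
  have hα : Q.LeftInv (l₁ ⊛ Q.comul3.toLinearMap) := Q.leftInv_alpha Q.comul3
  conv_lhs => rw [explicitU]
  refine (h0 _).trans ?_
  rw [phi_mul_comulFst_pR]
  refine (h1 _ _).trans ?_
  rw [d3_inv_mul_padLeft, mul_assoc]
  refine ((hα.mul_right _).chain_d1 Q.e1_phi _).trans ?_
  exact h2 _ _

lemma rchain_mul_left {A : Type*} [Ring A] [Algebra k A] (f g : H →ₗ[k] A) (c : A) (t) :
    (f ⊚ (c ▸▸ g)) t = c * (f ⊚ g) t := by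
  induction t using TensorProduct.induction_on with
  | zero => simp
  | add x y hx hy => simp only [map_add, mul_add, hx, hy]
  | tmul a b => simp [mul_assoc]

/-- `(Δ ⊗ id)(q_R) φ⁻¹ = (1 ⊗ S⁻¹(Z)) q_R Δ(Y) · X`, with `q_R` in the last two factors. -/
lemma comulFst_qR_mul_phiInv_aux : Q.comulFst Q.qR * Q.phiInv =
    (inl k H (H ⊗[k] H) ⊚ (inr k H (H ⊗[k] H) Q.qR ▸▸ (inr k H (H ⊗[k] H) ∘ₗ Q.Delta)) ⊚
      (last k H ∘ₗ Q.Sinv)) Q.phi := by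
  let M := inl k H (H ⊗[k] H) ⊚ mid k H ⊚ (last k H (Q.Sinv Q.alpha) ▸▸ last k H) ⊚
    (last k H ∘ₗ Q.Sinv)
  have h1 : ∀ x y, Q.comulFst (Q.qRMap x) * y = M (Q.d1 x * padRight k H y) := by
    intro x y
    induction x using tensor3_induction with
    | add x y hx hy => simp only [map_add, add_mul, hx, hy]
    | tmul a b c =>
      rw [qRMap_tmul, comulFst_tmul, d1_tmul]
      generalize Q.comul a = e
      induction e using TensorProduct.induction_on with
      | zero => simp
      | add x y hx hy => simp only [map_add, add_mul, TensorProduct.add_tmul, hx, hy]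
      | tmul e1 e2 =>
        induction y using tensor3_induction with
        | add x y hx hy => simp only [map_add, mul_add, hx, hy]
        | tmul y1 y2 y3 => simp [M, mid, last, mul_assoc]
  have h2 : ∀ x y, M (padLeft k H y * Q.d2 x) = (inl k H (H ⊗[k] H) ⊚
      (inr k H (H ⊗[k] H) (Q.qRMap y) ▸▸ (inr k H (H ⊗[k] H) ∘ₗ Q.Delta)) ⊚
      (last k H ∘ₗ Q.Sinv)) x := by
    intro x y
    induction x using tensor3_induction with
    | add x y hx hy => simp only [map_add, mul_add, hx, hy]
    | tmul a b c =>
      rw [d2_tmul, comulFst_tmul, rchain_tmul, rchain_tmul, lmul_apply, LinearMap.comp_apply,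
        LinearMap.comp_apply, Delta_apply]
      generalize Q.comul b = e
      induction e using TensorProduct.induction_on with
      | zero => simp
      | add x y hx hy =>
        simp only [map_add, mul_add, add_mul, TensorProduct.add_tmul, TensorProduct.tmul_add,
          hx, hy]
      | tmul e1 e2 =>
        induction y using tensor3_induction with
        | add x y hx hy => simp only [map_add, add_mul, mul_add, hx, hy]
        | tmul y1 y2 y3 => simp [M, mid, last, mul_assoc]
  rw [qR_eq, h1, d1_mul_padRight_inv, mul_assoc, Q.leftInv_alpha_last.rchain_d3 Q.e3_phiInv, h2]

/-- `(Δ ⊗ id)(q_R) φ⁻¹ = (1 ⊗ (z ⊗ 1) V Δ(S⁻¹(y))) (id ⊗ Δ)(q_R Δ(x))`, where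
`φ⁻¹ = x ⊗ y ⊗ z`. -/
lemma comulFst_qR_mul_phiInv : Q.comulFst Q.qR * Q.phiInv =
    ((Q.comulSnd Q.qR ▸▸ Q.comul3.toLinearMap) ⊚
      (inr k H (H ⊗[k] H) Q.V ▸▸ (inr k H (H ⊗[k] H) ∘ₗ Q.Delta ∘ₗ Q.Sinv)) ⊚
      mid k H) Q.phiInv := by
  let F := (Q.comul (Q.Sinv Q.alpha) ▸▸ Q.Delta) ⊚ (Q.V ▸▸ (Q.Delta ∘ₗ Q.Sinv)) ⊚ inl k H H
  let l₃ := inr k H (H ⊗[k] H) Q.V ▸▸ (inr k H (H ⊗[k] H) ∘ₗ Q.Delta ∘ₗ Q.Sinv)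
  let l₂ := inr k H (H ⊗[k] H) (Q.comul (Q.Sinv Q.alpha)) ▸▸ (inr k H (H ⊗[k] H) ∘ₗ Q.Delta)
  let M := inl k H (H ⊗[k] H) ⊚ l₂ ⊚ l₃ ⊚ mid k H
  have hl : ∀ t, (l₃ ⊚ mid k H) t = inr k H (H ⊗[k] H)
      (((Q.V ▸▸ (Q.Delta ∘ₗ Q.Sinv)) ⊚ inl k H H) t) := by
    intro t
    induction t using TensorProduct.induction_on with
    | zero => simp
    | add x y hx hy => simp only [map_add, hx, hy]
    | tmul a b => simp only [l₃, mid, rchain_tmul, lmul_apply, LinearMap.comp_apply, inr_mul]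
  have h1 : ∀ x y, (inl k H (H ⊗[k] H) ⊚
      (inr k H (H ⊗[k] H) (F y) ▸▸ (inr k H (H ⊗[k] H) ∘ₗ Q.Delta)) ⊚ (last k H ∘ₗ Q.Sinv)) x =
      M (padLeft k H y * Q.d3 x) := by
    intro x y
    induction x using tensor3_induction with
    | add x y hx hy => simp only [map_add, mul_add, hx, hy]
    | tmul a b c =>
      induction y using tensor3_induction with
      | add x y hx hy =>
        simp only [map_add, mul_add, add_mul, rchain_tmul, lmul_apply] at hx hy ⊢
        rw [hx, hy]
      | tmul y1 y2 y3 =>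
        rw [d3_tmul, comulSnd_tmul, padLeft_apply, Algebra.TensorProduct.tmul_mul_tmul,
          Algebra.TensorProduct.tmul_mul_tmul, one_mul]
        have e : (l₃ ⊚ mid k H) (y2 ⊗ₜ y3 * Q.comul c) = _ := (hl _).trans
          (congrArg _ (Q.V_cov_mul _ _))
        simp only [M, F, rchain_tmul, e]
        simp only [l₂, lmul_apply, LinearMap.comp_apply, Delta_apply, map_mul,
          inr_mul, mul_assoc, last]
  have h2 : ∀ x y, M (padRight k H y * Q.d1 x) =
      ((Q.comulSnd (Q.qRMap y) ▸▸ Q.comul3.toLinearMap) ⊚ l₃ ⊚ mid k H) x := by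
    intro x y
    induction x using tensor3_induction with
    | add x y hx hy => simp only [map_add, mul_add, hx, hy]
    | tmul a b c =>
      rw [d1_tmul, rchain_tmul, lmul_apply, AlgHom.toLinearMap_apply, comul3, AlgHom.comp_apply]
      generalize Q.comul a = e
      induction e using TensorProduct.induction_on with
      | zero => simp
      | add x y hx hy =>
        simp only [map_add, mul_add, TensorProduct.add_tmul, hx, hy]
      | tmul e1 e2 =>
        induction y using tensor3_induction with
        | add x y hx hy => simp only [map_add, add_mul, mul_add, hx, hy]
        | tmul y1 y2 y3 =>
          simp only [M, l₂, l₃, padRight_tmul, TensorProduct.assoc_tmul, rchain_tmul, one_mul,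
            Algebra.TensorProduct.tmul_mul_tmul, lmul_apply, LinearMap.comp_apply, Delta_apply,
            qRMap_tmul, comulSnd_tmul, map_mul, Sinv_mul, mid]
          simp only [tmul_eq_inl_mul_inr, inl_mul, inr_mul, mul_assoc, inr_mul_inl_mul,
            inr_mul_inl]
  have hα : Q.LeftInv (l₂ ⊚ (inr k H (H ⊗[k] H) ∘ₗ Q.Delta ∘ₗ Q.Sinv)) := Q.leftInv_alpha_comulRight
  have hα' : Q.LeftInv (l₂ ⊚ l₃) := fun a t => by
    rw [rchain_mul_left, rchain_mul_left, hα, mul_smul_comm]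
  have hV : Q.qR = F Q.phiInv := Q.V_contract.symm
  rw [comulFst_qR_mul_phiInv_aux]
  conv_lhs => rw [hV]
  rw [h1, padLeft_inv_mul_d3, mul_assoc]
  simp only [M]
  rw [hα'.rchain_d2 Q.e2_phi]
  refine (h2 _ _).trans ?_
  rw [qR_eq]

/-- `(Δ ⊗ id)(V) φ⁻¹ = (Y ⊗ Z ⊗ 1) (1 ⊗ V) (id ⊗ Δ)(V Δ(S⁻¹(X)))`. -/
lemma comulFst_V_mul_phiInv : Q.comulFst Q.V * Q.phiInv =
    (((inr k H (H ⊗[k] H) Q.V * Q.comulSnd Q.V) ▸▸ (Q.comul3.toLinearMap ∘ₗ Q.Sinv)) ⊚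
      inl k H (H ⊗[k] H) ⊚ mid k H) Q.phi := by
  let F := (Q.Delta ∘ₗ Q.Sinv) ⊚ ((Q.qR ▸▸ Q.Delta) ◂ Q.comul (Q.Sinv Q.beta)) ⊚
    (inr k H H ∘ₗ Q.Sinv)
  let l₃ := inr k H (H ⊗[k] H) Q.V ▸▸ (inr k H (H ⊗[k] H) ∘ₗ Q.Delta ∘ₗ Q.Sinv)
  let l₁ := Q.comul3.toLinearMap ∘ₗ Q.Sinv
  let l₂ := Q.comulSnd Q.qR ▸▸ (Q.comul3.toLinearMap ◂ Q.comul3 (Q.Sinv Q.beta))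
  let l₂' := Q.comulSnd Q.qR ▸▸ Q.comul3.toLinearMap
  let M := l₁ ⊚ l₂ ⊚ l₃ ⊚ mid k H
  have hl : ∀ t, (l₃ ⊚ mid k H) t = inr k H (H ⊗[k] H)
      (((Q.V ▸▸ (Q.Delta ∘ₗ Q.Sinv)) ⊚ inl k H H) t) := by
    intro t
    induction t using TensorProduct.induction_on with
    | zero => simp
    | add x y hx hy => simp only [map_add, hx, hy]
    | tmul a b => simp only [l₃, mid, rchain_tmul, lmul_apply, LinearMap.comp_apply, inr_mul]
  have hc : ∀ t, (l₂ ⊚ l₃) t = inr k H (H ⊗[k] H) Q.V *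
      Q.comulSnd (((Q.qR ▸▸ Q.Delta) ⊚ (inr k H H ∘ₗ Q.Sinv)) t) * Q.comul3 (Q.Sinv Q.beta) := by
    intro t
    induction t using TensorProduct.induction_on with
    | zero => simp
    | add x y hx hy => simp only [map_add, add_mul, mul_add, hx, hy]
    | tmul a b =>
      simp only [l₂, l₃, rchain_tmul, rmul_apply, lmul_apply, LinearMap.comp_apply, map_mul,
        inr_apply, comulSnd_tmul, Delta_apply, comul3, AlgHom.toLinearMap_apply,
        AlgHom.comp_apply, mul_assoc]
  have h0 : ∀ x, Q.comulFst (F x) * Q.phiInv = (l₁ ⊚ ((Q.comulFst Q.qR * Q.phiInv) ▸▸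
      (Q.comul3.toLinearMap ◂ Q.comul3 (Q.Sinv Q.beta))) ⊚ (last k H ∘ₗ Q.Sinv)) x := by
    intro x
    induction x using tensor3_induction with
    | add x y hx hy => simp only [map_add, add_mul, hx, hy]
    | tmul a b c =>
      have e : Q.comulFst (1 ⊗ₜ Q.Sinv c) = last k H (Q.Sinv c) := by
        rw [comulFst_tmul, map_one]; rfl
      simp only [F, l₁, rchain_tmul, lmul_apply, rmul_apply, LinearMap.comp_apply, map_mul,
        inr_apply, e, Delta_apply, AlgHom.toLinearMap_apply]
      simp only [mul_assoc, ← phiInv_mul_comul3]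
      rw [← mul_assoc _ Q.phiInv, ← phiInv_mul_comul3, mul_assoc, ← mul_assoc _ Q.phiInv,
        ← phiInv_mul_comul3, mul_assoc]
  have h1 : ∀ x y, (l₁ ⊚ ((l₂' ⊚ l₃ ⊚ mid k H) y ▸▸ (Q.comul3.toLinearMap ◂
      Q.comul3 (Q.Sinv Q.beta))) ⊚ (last k H ∘ₗ Q.Sinv)) x = M (padLeft k H y * Q.d3 x) := by
    intro x y
    induction x using tensor3_induction with
    | add x y hx hy => simp only [map_add, mul_add, hx, hy]
    | tmul a b c =>
      induction y using tensor3_induction with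
      | add x y hx hy =>
        simp only [map_add, mul_add, add_mul, rchain_tmul, lmul_apply] at hx hy ⊢
        rw [hx, hy]
      | tmul y1 y2 y3 =>
        rw [d3_tmul, comulSnd_tmul, padLeft_apply, Algebra.TensorProduct.tmul_mul_tmul,
          Algebra.TensorProduct.tmul_mul_tmul, one_mul]
        have e : (l₃ ⊚ mid k H) (y2 ⊗ₜ y3 * Q.comul c) = _ := (hl _).trans
          (congrArg _ (Q.V_cov_mul _ _))
        have e' := hl (y2 ⊗ₜ y3)
        rw [rchain_tmul] at e'
        simp only [M, rchain_tmul, e, lmul_apply, e']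
        simp only [l₂, l₂', rmul_apply, lmul_apply, LinearMap.comp_apply, map_mul, inr_mul,
          mul_assoc, last, AlgHom.toLinearMap_apply]
  have h2 : ∀ x y, M (Q.d2 x * padRight k H y) =
      (((inr k H (H ⊗[k] H) Q.V * Q.comulSnd (F y)) ▸▸ (Q.comul3.toLinearMap ∘ₗ Q.Sinv)) ⊚
        inl k H (H ⊗[k] H) ⊚ mid k H) x := by
    intro x y
    induction x using tensor3_induction with
    | add x y hx hy => simp only [map_add, add_mul, hx, hy]
    | tmul a b c =>
      induction y using tensor3_induction with
      | add x y hx hy =>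
        simp only [map_add, mul_add, add_mul, rchain_tmul, lmul_apply] at hx hy ⊢
        rw [hx, hy]
      | tmul y1 y2 y3 =>
        rw [d2_tmul, comulFst_tmul, padRight_tmul, Algebra.TensorProduct.tmul_mul_tmul,
          ← TensorProduct.assoc_tmul, ← assoc_mul, Algebra.TensorProduct.tmul_mul_tmul, mul_one]
        simp only [M]
        rw [rchain_tmul, rchain_assoc, hc, qR_cov_mul]
        have e : Q.comulSnd (b ⊗ₜ[k] (1 : H)) = inl k H (H ⊗[k] H) b := by
          rw [comulSnd_tmul, map_one]; rfl
        have e' : ∀ u, Q.comulSnd (1 ⊗ₜ u) = inr k H (H ⊗[k] H) (Q.comul u) := fun u => rfl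
        have e'' : ∀ u, Q.comulSnd (Q.comul u) = Q.comul3 u := fun u => rfl
        simp only [F, l₁, rchain_tmul, lmul_apply, rmul_apply, LinearMap.comp_apply, map_mul,
          inr_apply, e, e', e'', Delta_apply, AlgHom.toLinearMap_apply, Sinv_mul, mul_assoc]
        simp only [← inr_apply, inr_mul_inl_mul]
  have hβ : Q.RightInv (l₁ ⊚ (Q.comul3.toLinearMap ◂ Q.comul3 (Q.Sinv Q.beta))) :=
    Q.rightInv_beta_inv Q.comul3
  have hβ' : Q.RightInv (l₁ ⊚ l₂) := fun a t => by
    rw [rchain_mul_left, rchain_mul_left, hβ, mul_smul_comm]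
  conv_lhs => rw [V_eq]
  refine (h0 _).trans ?_
  rw [comulFst_qR_mul_phiInv]
  refine (h1 _ _).trans ?_
  rw [padLeft_inv_mul_d3]
  refine (hβ'.rchain_d1 Q.e1_phiInv _).trans ?_
  refine (h2 _ _).trans ?_
  rw [V_eq]

/-- `φ⁻¹ (id ⊗ Δ)(U) (1 ⊗ U) = (Δ ⊗ id)(Δ(S(X)) U) (Y ⊗ Z ⊗ 1)`. -/
lemma explicitU_coassoc :
    Q.phiInv * (Q.comulSnd Q.explicitU * inr k H (H ⊗[k] H) Q.explicitU) =
    (((Q.comulFst.toLinearMap ∘ₗ Q.Delta ∘ₗ Q.S) ◂ Q.comulFst Q.explicitU) ⊛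
      inl k H (H ⊗[k] H) ⊛ mid k H) Q.phi := by
  let C : H ⊗[k] (H ⊗[k] H) → (H ⊗[k] (H ⊗[k] H) →ₗ[k] H ⊗[k] (H ⊗[k] H)) := fun w =>
    ((Q.comul3.toLinearMap ∘ₗ Q.S) ◂ w) ⊛ inl k H (H ⊗[k] H) ⊛ mid k H
  have h1 : ∀ w x y, C (C w y) x = C w (y * x) := by
    intro w x y
    induction x using tensor3_induction with
    | add x y hx hy => simp only [map_add, mul_add, hx, hy]
    | tmul a b c =>
      induction y using tensor3_induction with
      | add x y hx hy =>
        simp only [C, map_add, mul_add, add_mul, chain_tmul, rmul_apply] at hx hy ⊢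
        rw [hx, hy]
      | tmul y1 y2 y3 =>
        simp only [C, mid, chain_tmul, rmul_apply, LinearMap.comp_apply, S_mul, map_mul,
          AlgHom.toLinearMap_apply, Algebra.TensorProduct.tmul_mul_tmul, inl_mul, inr_mul, mul_assoc,
          inr_mul_inl_mul]
  have h2 : ∀ x, Q.phi * (((Q.comulFst.toLinearMap ∘ₗ Q.Delta ∘ₗ Q.S) ◂ Q.comulFst Q.explicitU) ⊛
      inl k H (H ⊗[k] H) ⊛ mid k H) x = C (Q.phi * Q.comulFst Q.explicitU) x := by
    intro x
    induction x using tensor3_induction with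
    | add x y hx hy => simp only [map_add, mul_add, hx, hy]
    | tmul a b c =>
      simp only [C, chain_tmul, rmul_apply, LinearMap.comp_apply, AlgHom.toLinearMap_apply,
        Delta_apply, ← mul_assoc, ← comul3_mul_phi]
  have h3 : ∀ w, C w 1 = w := by
    intro w
    simp [C, Algebra.TensorProduct.one_def, mid]
    simp [← Algebra.TensorProduct.one_def]
  have h := h2 Q.phi
  rw [phi_mul_comulFst_explicitU] at h
  have h' := h.trans (h1 _ _ _)
  rw [phiInv_mul_phi, h3] at h'
  rw [← h', ← mul_assoc, phiInv_mul_phi, one_mul]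

/-- `(Δ ⊗ id)(V) = (Y ⊗ Z ⊗ 1) (1 ⊗ V) (id ⊗ Δ)(V Δ(S⁻¹(X))) φ`. -/
lemma V_coassoc : Q.comulFst Q.V =
    (((inr k H (H ⊗[k] H) Q.V * Q.comulSnd Q.V) ▸▸ (Q.comul3.toLinearMap ∘ₗ Q.Sinv)) ⊚
      inl k H (H ⊗[k] H) ⊚ mid k H) Q.phi * Q.phi := by
  rw [← comulFst_V_mul_phiInv, mul_assoc, phiInv_mul_phi, mul_one]

lemma counitFst_explicitU : Q.counitFst H Q.explicitU = 1 := by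
  rw [explicitU]
  refine Eq.trans ?_ Q.zigzag'_phiInv
  have hp : Q.counitFst H Q.pR = Q.beta := by
    have : ∀ x, Q.counitFst H (Q.pRMap x) = sandwichRight Q.S Q.beta (Q.e1 x) := by
      intro x
      induction x using tensor3_induction with
      | add x y hx hy => simp only [map_add, hx, hy]
      | tmul a b c => simp
    rw [pR_eq, this, e1_phiInv]
    simp [Algebra.TensorProduct.one_def]
  generalize Q.phiInv = x
  induction x using tensor3_induction with
  | add x y hx hy => simp only [map_add, hx, hy]
  | tmul a b c => simp [hp, mul_assoc]

lemma counitFst_V : Q.counitFst H Q.V = 1 := by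
  rw [V_eq]
  have hp : Q.counitFst H Q.qR = Q.Sinv Q.alpha := by
    have : ∀ x, Q.counitFst H (Q.qRMap x) =
        ((Q.Sinv Q.alpha ▸▸ LinearMap.id) ⊚ Q.Sinv) (Q.e1 x) := by
      intro x
      induction x using tensor3_induction with
      | add x y hx hy => simp only [map_add, hx, hy]
      | tmul a b c => simp [mul_assoc]
    rw [qR_eq, this, e1_phi]
    simp [Algebra.TensorProduct.one_def]
  have h : ∀ x, Q.counitFst H (((Q.Delta ∘ₗ Q.Sinv) ⊚
      ((Q.qR ▸▸ Q.Delta) ◂ Q.comul (Q.Sinv Q.beta)) ⊚ (inr k H H ∘ₗ Q.Sinv)) x) =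
      Q.Sinv (Q.zigzag x) := by
    intro x
    induction x using tensor3_induction with
    | add x y hx hy => simp only [map_add, hx, hy]
    | tmul a b c => simp [hp, mul_assoc]
  rw [h, zigzag_phi, Sinv_one]

end QuasiHopfAlgebra

/-! ### The slotwise actions on `M ⊗ C` -/

section Actions

variable {k H M C : Type*} [Field k] [Ring H] [Algebra k H] [AddCommGroup M] [Module k M]
  [Ring C] [Algebra k C] (B : BimoduleStr k H M)

namespace BimoduleStr

variable (C) in
/-- The left action of `H ⊗ C` on `M ⊗ C`. -/
def actL : H ⊗[k] C →ₗ[k] M ⊗[k] C →ₗ[k] M ⊗[k] C := slotAct B.left (LinearMap.mul k C)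

variable (C) in
/-- The right action of `H ⊗ C` on `M ⊗ C`. -/
def actR : H ⊗[k] C →ₗ[k] M ⊗[k] C →ₗ[k] M ⊗[k] C := slotAct B.right (LinearMap.mul k C).flip

@[simp] lemma actL_tmul (a : H) (c : C) (m : M) (d : C) :
    B.actL C (a ⊗ₜ c) (m ⊗ₜ d) = B.left a m ⊗ₜ (c * d) := rfl

@[simp] lemma actR_tmul (a : H) (c : C) (m : M) (d : C) :
    B.actR C (a ⊗ₜ c) (m ⊗ₜ d) = B.right a m ⊗ₜ (d * c) := rfl

lemma actL_mul (x y : H ⊗[k] C) (t : M ⊗[k] C) :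
    B.actL C (x * y) t = B.actL C x (B.actL C y t) := by
  induction x using TensorProduct.induction_on with
  | zero => simp
  | add x x' hx hx' => simp only [add_mul, map_add, LinearMap.add_apply, hx, hx']
  | tmul a c =>
    induction y using TensorProduct.induction_on with
    | zero => simp
    | add y y' hy hy' => simp only [mul_add, map_add, LinearMap.add_apply, hy, hy']
    | tmul a' c' =>
      induction t using TensorProduct.induction_on with
      | zero => simp
      | add t t' ht ht' => simp only [map_add, ht, ht']
      | tmul m d => simp [B.left_mul, mul_assoc]

lemma actR_actL (x y : H ⊗[k] C) (t : M ⊗[k] C) :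
    B.actR C x (B.actL C y t) = B.actL C y (B.actR C x t) := by
  induction x using TensorProduct.induction_on with
  | zero => simp
  | add x x' hx hx' => simp only [map_add, LinearMap.add_apply, hx, hx']
  | tmul a c =>
    induction y using TensorProduct.induction_on with
    | zero => simp
    | add y y' hy hy' => simp only [map_add, LinearMap.add_apply, hy, hy']
    | tmul a' c' =>
      induction t using TensorProduct.induction_on with
      | zero => simp
      | add t t' ht ht' => simp only [map_add, ht, ht']
      | tmul m d => simp [B.left_right_comm, mul_assoc]

lemma actL_one (t : M ⊗[k] C) : B.actL C 1 t = t := by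
  rw [Algebra.TensorProduct.one_def]
  induction t using TensorProduct.induction_on with
  | zero => simp
  | add t t' ht ht' => simp only [map_add, ht, ht']
  | tmul m d => simp [B.left_one]

/-- The map `m ⊗ h ↦ m · h`. -/
def contract : M ⊗[k] H →ₗ[k] M := TensorProduct.lift B.right.flip

@[simp] lemma contract_tmul (m : M) (h : H) : B.contract (m ⊗ₜ h) = B.right h m := rfl

end BimoduleStr

end Actions

namespace QuasiHopfAlgebra

/-! ### Quasi-Hopf bimodules and their coinvariants -/

variable {k H : Type*} [Field k] [Ring H] [Algebra k H] (Q : QuasiHopfAlgebra k H)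
  {M : Type*} [AddCommGroup M] [Module k M] (B : BimoduleStr k H M) (ρ : M →ₗ[k] M ⊗[k] H)

/-- `M` is a (right) quasi-Hopf bimodule: the coaction `ρ` is a counital map of bimodules, and it is
coassociative up to conjugation by the reassociator. -/
structure IsHopfBimodule : Prop where
  left : ∀ a m, ρ (B.left a m) = B.actL H (Q.comul a) (ρ m)
  right : ∀ a m, ρ (B.right a m) = B.actR H (Q.comul a) (ρ m)
  counit : ∀ m,
    TensorProduct.rid k M (TensorProduct.map LinearMap.id Q.counit.toLinearMap (ρ m)) = m
  coassoc : ∀ m, B.actL (H ⊗[k] H) Q.phi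
      (TensorProduct.assoc k M H H (TensorProduct.map ρ LinearMap.id (ρ m))) =
    B.actR (H ⊗[k] H) Q.phi (TensorProduct.map LinearMap.id Q.Delta (ρ m))

/-- The map `m ⊗ h ↦ m · β S(h)`, which occurs in `E`. -/
def antipodeContract : M ⊗[k] H →ₗ[k] M :=
  TensorProduct.lift ((B.right ∘ₗ LinearMap.mulLeft k Q.beta ∘ₗ Q.S).flip)

@[simp] lemma antipodeContract_tmul (m : M) (h : H) :
    Q.antipodeContract B (m ⊗ₜ h) = B.right (Q.beta * Q.S h) m := rfl

lemma coinvProj_apply (m : M) :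
    Q.coinvProj B ρ m = Q.antipodeContract B (B.actL H Q.qR (ρ m)) := rfl

variable {Q B ρ}

namespace IsHopfBimodule

lemma coinvProj_right (hM : Q.IsHopfBimodule B ρ) (a : H) (m : M) :
    Q.coinvProj B ρ (B.right a m) = Q.counit a • Q.coinvProj B ρ m := by
  rw [coinvProj_apply, coinvProj_apply, hM.right, ← B.actR_actL]
  generalize B.actL H Q.qR (ρ m) = t
  induction t using TensorProduct.induction_on with
  | zero => simp
  | add t t' ht ht' => simp only [map_add, smul_add, ht, ht']
  | tmul m h =>
    have key : ∀ d, Q.antipodeContract B (B.actR H d (m ⊗ₜ h)) =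
        B.right (sandwichRight Q.S Q.beta d * Q.S h) m := by
      intro d
      induction d using TensorProduct.induction_on with
      | zero => simp
      | add x y hx hy => simp only [map_add, add_mul, LinearMap.add_apply, hx, hy]
      | tmul a b => simp [B.right_mul, S_mul, mul_assoc]
    rw [key, sandwichRight_comul, smul_mul_assoc, map_smul, LinearMap.smul_apply,
      antipodeContract_tmul]

lemma map_coinvProj_actR (hM : Q.IsHopfBimodule B ρ) {C : Type*} [Ring C] [Algebra k C]
    (d : H ⊗[k] C) (t : M ⊗[k] C) :
    TensorProduct.map (Q.coinvProj B ρ) LinearMap.id (B.actR C d t) =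
      TensorProduct.map LinearMap.id (LinearMap.mulRight k (Q.counitFst C d))
        (TensorProduct.map (Q.coinvProj B ρ) LinearMap.id t) := by
  induction t using TensorProduct.induction_on with
  | zero => simp
  | add t t' ht ht' => simp only [map_add, ht, ht']
  | tmul m c =>
    rw [TensorProduct.map_tmul, TensorProduct.map_tmul]
    induction d using TensorProduct.induction_on with
    | zero => simp
    | add x y hx hy =>
      simp only [map_add, LinearMap.add_apply, hx, hy, LinearMap.mulRight_apply, mul_add,
        TensorProduct.tmul_add]
    | tmul a b => simp [hM.coinvProj_right, TensorProduct.smul_tmul']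

lemma map_coinvProj_actR_of_eq_one (hM : Q.IsHopfBimodule B ρ) {C : Type*} [Ring C] [Algebra k C]
    {d : H ⊗[k] C} (hd : Q.counitFst C d = 1) (t : M ⊗[k] C) :
    TensorProduct.map (Q.coinvProj B ρ) LinearMap.id (B.actR C d t) =
      TensorProduct.map (Q.coinvProj B ρ) LinearMap.id t := by
  rw [hM.map_coinvProj_actR, hd]
  simp

/-- The reconstruction formula `E(m₀) · m₁ = m`. -/
lemma contract_coinvProj (hM : Q.IsHopfBimodule B ρ) (m : M) :
    B.contract (TensorProduct.map (Q.coinvProj B ρ) LinearMap.id (ρ m)) = m := by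
  let Z : M ⊗[k] (H ⊗[k] H) →ₗ[k] M := B.contract ∘ₗ
    TensorProduct.map LinearMap.id (LinearMap.mulLeft k Q.beta ∘ₗ sandwichLeft Q.S Q.alpha)
  have h1 : ∀ x t h, B.contract (Q.antipodeContract B (B.actL H (Q.qRMap x) t) ⊗ₜ h) =
      Z (B.actL (H ⊗[k] H) x (TensorProduct.assoc k M H H (t ⊗ₜ h))) := by
    intro x t h
    induction t using TensorProduct.induction_on with
    | zero => simp
    | add t t' ht ht' => simp only [map_add, TensorProduct.add_tmul, ht, ht']
    | tmul m g =>
      induction x using tensor3_induction with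
      | add x y hx hy => simp only [map_add, LinearMap.add_apply, TensorProduct.add_tmul, hx, hy]
      | tmul a b c => simp [Z, B.right_mul, S_mul, mul_assoc]
  have h2 : ∀ t, B.contract (TensorProduct.map (Q.coinvProj B ρ) LinearMap.id t) =
      Z (B.actL (H ⊗[k] H) Q.phi
        (TensorProduct.assoc k M H H (TensorProduct.map ρ LinearMap.id t))) := by
    intro t
    induction t using TensorProduct.induction_on with
    | zero => simp
    | add t t' ht ht' => simp only [map_add, ht, ht']
    | tmul m h =>
      rw [TensorProduct.map_tmul, TensorProduct.map_tmul, coinvProj_apply, qR_eq,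
        LinearMap.id_apply, h1]
  have h3 : ∀ x t, Z (B.actR (H ⊗[k] H) x (TensorProduct.map LinearMap.id Q.Delta t)) =
      B.right (Q.zigzag x)
        (TensorProduct.rid k M (TensorProduct.map LinearMap.id Q.counit.toLinearMap t)) := by
    intro x t
    induction t using TensorProduct.induction_on with
    | zero => simp
    | add t t' ht ht' => simp only [map_add, ht, ht']
    | tmul m h =>
      induction x using tensor3_induction with
      | add x y hx hy => simp only [map_add, LinearMap.add_apply, hx, hy]
      | tmul a b c =>
        have key : ∀ d, Z (B.actR (H ⊗[k] H) (a ⊗ₜ (b ⊗ₜ c)) (m ⊗ₜ d)) =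
            B.right (a * (Q.beta * (Q.S b * sandwichLeft Q.S Q.alpha d * c))) m := by
          intro d
          induction d using TensorProduct.induction_on with
          | zero => simp
          | add x y hx hy => simp only [map_add, TensorProduct.tmul_add, mul_add, add_mul,
              LinearMap.add_apply, hx, hy]
          | tmul e f => simp [Z, B.right_mul, S_mul, mul_assoc]
        rw [TensorProduct.map_tmul, LinearMap.id_apply, Delta_apply, key, sandwichLeft_comul]
        simp [mul_assoc]
  rw [h2, hM.coassoc, h3, zigzag_phi, B.right_one, hM.counit]

/-- `E(a · E(m)) = E(a · m)`. -/
lemma coinvProj_left_coinvProj (hM : Q.IsHopfBimodule B ρ) (a : H) (m : M) :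
    Q.coinvProj B ρ (B.left a (Q.coinvProj B ρ m)) = Q.coinvProj B ρ (B.left a m) := by
  have key : ∀ x t, Q.coinvProj B ρ (B.left a (Q.antipodeContract B (B.actL H (Q.qRMap x) t))) =
      (Q.counit Q.alpha * Q.counit Q.beta) • Q.coinvProj B ρ (B.left a (B.left
        (Q.counitSnd (Q.e3 x)) (TensorProduct.rid k M
          (TensorProduct.map LinearMap.id Q.counit.toLinearMap t)))) := by
    intro x t
    induction t using TensorProduct.induction_on with
    | zero => simp
    | add t t' ht ht' => simp only [map_add, ht, ht', smul_add]
    | tmul m h =>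
      induction x using tensor3_induction with
      | add x y hx hy => simp only [map_add, LinearMap.add_apply, hx, hy, smul_add]
      | tmul b c d =>
        simp [← B.left_right_comm, hM.coinvProj_right, smul_smul]
        congr 1
        ring
  conv_lhs => rw [coinvProj_apply Q B ρ m, qR_eq, key, e3_phi, map_one, B.left_one, hM.counit,
    counit_alpha_mul_beta, one_smul]

lemma coinvProj_coinvProj (hM : Q.IsHopfBimodule B ρ) (m : M) :
    Q.coinvProj B ρ (Q.coinvProj B ρ m) = Q.coinvProj B ρ m := by
  simpa only [B.left_one] using hM.coinvProj_left_coinvProj 1 m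

variable (Q) in
/-- The contraction `a ⊗ b ⊗ c ↦ a ⊗ b β S(c)` takes `(Δ ⊗ id)(q_R) φ⁻¹` to `1 ⊗ 1`. -/
lemma sandwichRight_comulFst_qR : TensorProduct.map LinearMap.id (sandwichRight Q.S Q.beta)
    (Q.comulFst Q.qR * Q.phiInv) = 1 := by
  rw [← Q.qR_pR_cancel, qR_eq, pR_eq]
  generalize Q.phi = x
  generalize Q.phiInv = y
  induction x using tensor3_induction with
  | add x x' hx hx' => simp only [map_add, add_mul, hx, hx']
  | tmul a b c =>
    rw [qRMap_tmul, comulFst_tmul, chain_tmul, rmul_apply, Delta_apply]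
    generalize Q.comul a = d
    induction d using TensorProduct.induction_on with
    | zero => simp
    | add d d' hd hd' => simp only [map_add, TensorProduct.add_tmul, add_mul, hd, hd']
    | tmul e f =>
      induction y using tensor3_induction with
      | add x x' hx hx' => simp only [map_add, add_mul, mul_add, hx, hx']
      | tmul u v w => simp [S_mul, mul_assoc]

/-- `E(E(m)₀) ⊗ E(m)₁ = E(m) ⊗ 1`. -/
lemma map_coinvProj_coinvProj (hM : Q.IsHopfBimodule B ρ) (m : M) :
    TensorProduct.map (Q.coinvProj B ρ) LinearMap.id (ρ (Q.coinvProj B ρ m)) =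
      Q.coinvProj B ρ m ⊗ₜ 1 := by
  let E := Q.coinvProj B ρ
  let W : M ⊗[k] (H ⊗[k] H) →ₗ[k] M ⊗[k] H :=
    TensorProduct.map LinearMap.id (sandwichRight Q.S Q.beta)
  have hW : ∀ t, TensorProduct.map E LinearMap.id (W t) =
      W (TensorProduct.map E LinearMap.id t) := by
    intro t
    rw [← LinearMap.comp_apply, ← LinearMap.comp_apply, ← TensorProduct.map_comp,
      ← TensorProduct.map_comp]
    rfl
  have h1 : ∀ q t, TensorProduct.map E LinearMap.id (ρ (Q.antipodeContract B (B.actL H q t))) =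
      TensorProduct.map E LinearMap.id (W (B.actL (H ⊗[k] H) (Q.comulFst q)
        (TensorProduct.assoc k M H H (TensorProduct.map ρ LinearMap.id t)))) := by
    intro q t
    induction t using TensorProduct.induction_on with
    | zero => simp
    | add t t' ht ht' => simp only [map_add, ht, ht']
    | tmul m h =>
      induction q using TensorProduct.induction_on with
      | zero => simp
      | add x y hx hy => simp only [map_add, LinearMap.add_apply, hx, hy]
      | tmul a b =>
        rw [B.actL_tmul, antipodeContract_tmul, hM.right, hM.left, hM.map_coinvProj_actR,
          counitFst_comul, comulFst_tmul, TensorProduct.map_tmul, LinearMap.id_apply]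
        generalize ρ m = s
        generalize Q.comul a = d
        induction s using TensorProduct.induction_on with
        | zero => simp
        | add t t' ht ht' => simp only [map_add, TensorProduct.add_tmul, ht, ht']
        | tmul n g =>
          induction d using TensorProduct.induction_on with
          | zero => simp
          | add x y hx hy => simp only [map_add, TensorProduct.add_tmul, LinearMap.add_apply, hx, hy]
          | tmul e f => simp [W, E, mul_assoc]
  have h2 : ∀ z t, W (B.actL (H ⊗[k] H) z (TensorProduct.map LinearMap.id Q.Delta t)) =
      B.actL H (TensorProduct.map LinearMap.id (sandwichRight Q.S Q.beta) z)
        (TensorProduct.rid k M (TensorProduct.map LinearMap.id Q.counit.toLinearMap t) ⊗ₜ 1) := by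
    intro z t
    induction t using TensorProduct.induction_on with
    | zero => simp
    | add t t' ht ht' => simp only [map_add, TensorProduct.add_tmul, ht, ht']
    | tmul m h =>
      induction z using tensor3_induction with
      | add x y hx hy => simp only [map_add, LinearMap.add_apply, hx, hy]
      | tmul a b c =>
        have key : ∀ d, W (B.actL (H ⊗[k] H) (a ⊗ₜ (b ⊗ₜ c)) (m ⊗ₜ d)) =
            B.left a m ⊗ₜ (b * sandwichRight Q.S Q.beta d * Q.S c) := by
          intro d
          induction d using TensorProduct.induction_on with
          | zero => simp
          | add x y hx hy => simp only [map_add, TensorProduct.tmul_add, mul_add, add_mul, hx, hy]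
          | tmul e f => simp [W, S_mul, mul_assoc]
        rw [TensorProduct.map_tmul, LinearMap.id_apply, Delta_apply, key, sandwichRight_comul]
        simp [TensorProduct.smul_tmul']
  have h3 : TensorProduct.assoc k M H H (TensorProduct.map ρ LinearMap.id (ρ m)) =
      B.actR (H ⊗[k] H) Q.phi
        (B.actL (H ⊗[k] H) Q.phiInv (TensorProduct.map LinearMap.id Q.Delta (ρ m))) := by
    rw [B.actR_actL, ← hM.coassoc, ← B.actL_mul, phiInv_mul_phi, B.actL_one]
  have he : Q.counitFst (H ⊗[k] H) Q.phi = 1 := Q.e1_phi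
  conv_lhs => rw [coinvProj_apply Q B ρ m]
  refine (h1 _ _).trans ?_
  rw [h3, ← B.actR_actL, hW, hM.map_coinvProj_actR_of_eq_one he, ← B.actL_mul, ← hW, h2,
    sandwichRight_comulFst_qR, B.actL_one, hM.counit]
  rfl

lemma map_coinvProj_of_coinvariant (hM : Q.IsHopfBimodule B ρ) {n : M}
    (hn : Q.coinvProj B ρ n = n) :
    TensorProduct.map (Q.coinvProj B ρ) LinearMap.id (ρ n) = n ⊗ₜ 1 := by
  have h := hM.map_coinvProj_coinvProj n
  rwa [hn] at h

lemma map_coinvProj_actL (hM : Q.IsHopfBimodule B ρ) {C : Type*} [Ring C] [Algebra k C]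
    (d : H ⊗[k] C) (t : M ⊗[k] C) :
    TensorProduct.map (Q.coinvProj B ρ) LinearMap.id (B.actL C d t) =
      TensorProduct.map (Q.coinvProj B ρ) LinearMap.id (B.actL C d
        (TensorProduct.map (Q.coinvProj B ρ) LinearMap.id t)) := by
  induction t using TensorProduct.induction_on with
  | zero => simp
  | add t t' ht ht' => simp only [map_add, ht, ht']
  | tmul m c =>
    induction d using TensorProduct.induction_on with
    | zero => simp
    | add x y hx hy => simp only [map_add, LinearMap.add_apply, hx, hy]
    | tmul a b => simp [hM.coinvProj_left_coinvProj]

lemma map_coinvProj_right (hM : Q.IsHopfBimodule B ρ) {n : M} (hn : Q.coinvProj B ρ n = n) (b : H) :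
    TensorProduct.map (Q.coinvProj B ρ) LinearMap.id (ρ (B.right b n)) = n ⊗ₜ b := by
  rw [hM.right, hM.map_coinvProj_actR, hM.map_coinvProj_of_coinvariant hn, counitFst_comul]
  simp

/-- If `E(c · n) = χ(c) n` for a coinvariant `n`, then `c · n = E(c₁ · n) · c₂ = n · (c ↼ χ)`. -/
lemma left_coinvariant (hM : Q.IsHopfBimodule B ρ) {n : M} (hn : Q.coinvProj B ρ n = n)
    {χ : H →ₐ[k] k} (hχ : ∀ c, Q.coinvProj B ρ (B.left c n) = χ c • n) (c : H) :
    B.left c n = B.right (Q.hit χ c) n := by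
  have key : ∀ d, B.contract (TensorProduct.map (Q.coinvProj B ρ) LinearMap.id
      (B.actL H d (n ⊗ₜ 1))) = B.right (TensorProduct.lid k H
        (TensorProduct.map χ.toLinearMap LinearMap.id d)) n := by
    intro d
    induction d using TensorProduct.induction_on with
    | zero => simp
    | add x y hx hy => simp only [map_add, LinearMap.add_apply, hx, hy]
    | tmul a b => simp [hχ]
  conv_lhs => rw [← hM.contract_coinvProj (B.left c n), hM.left, hM.map_coinvProj_actL,
    hM.map_coinvProj_of_coinvariant hn, key]
  rfl

/-- If `E(c · n) = χ(c) n` for a coinvariant `n`, then `ρ(n) = E(x · n) · y ⊗ z = n · T_χ¹ ⊗ T_χ²`.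
-/
lemma coaction_coinvariant (hM : Q.IsHopfBimodule B ρ) {n : M} (hn : Q.coinvProj B ρ n = n)
    {χ : H →ₐ[k] k} (hχ : ∀ c, Q.coinvProj B ρ (B.left c n) = χ c • n) :
    ρ n = TensorProduct.map (B.right.flip n) LinearMap.id (Q.T χ) := by
  let E := Q.coinvProj B ρ
  let K : M ⊗[k] (H ⊗[k] H) →ₗ[k] M ⊗[k] H :=
    TensorProduct.map B.contract LinearMap.id ∘ₗ (TensorProduct.assoc k M H H).symm.toLinearMap
  have h1 : ∀ t, t = K (TensorProduct.map E LinearMap.id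
      (TensorProduct.assoc k M H H (TensorProduct.map ρ LinearMap.id t))) := by
    intro t
    induction t using TensorProduct.induction_on with
    | zero => simp
    | add t t' ht ht' =>
      rw [map_add, map_add, map_add, map_add, ← ht, ← ht']
    | tmul m h =>
      have : ∀ s, K (TensorProduct.map E LinearMap.id (TensorProduct.assoc k M H H (s ⊗ₜ h))) =
          B.contract (TensorProduct.map E LinearMap.id s) ⊗ₜ h := by
        intro s
        induction s using TensorProduct.induction_on with
        | zero => simp
        | add t t' ht ht' => simp only [map_add, TensorProduct.add_tmul, ht, ht']
        | tmul m g => simp [K]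
      rw [TensorProduct.map_tmul, LinearMap.id_apply, this, hM.contract_coinvProj]
  have h2 : TensorProduct.assoc k M H H (TensorProduct.map ρ LinearMap.id (ρ n)) =
      B.actR (H ⊗[k] H) Q.phi
        (B.actL (H ⊗[k] H) Q.phiInv (TensorProduct.map LinearMap.id Q.Delta (ρ n))) := by
    rw [B.actR_actL, ← hM.coassoc, ← B.actL_mul, phiInv_mul_phi, B.actL_one]
  have h3 : TensorProduct.map E LinearMap.id (TensorProduct.map LinearMap.id Q.Delta (ρ n)) =
      n ⊗ₜ 1 := by
    have : TensorProduct.map E LinearMap.id (TensorProduct.map LinearMap.id Q.Delta (ρ n)) =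
        TensorProduct.map LinearMap.id Q.Delta (TensorProduct.map E LinearMap.id (ρ n)) := by
      generalize ρ n = t
      rw [← LinearMap.comp_apply, ← LinearMap.comp_apply, ← TensorProduct.map_comp,
        ← TensorProduct.map_comp]
      rfl
    rw [this, hM.map_coinvProj_of_coinvariant hn]
    simp [Delta_apply]
  have h4 : ∀ x, K (TensorProduct.map E LinearMap.id (B.actL (H ⊗[k] H) x (n ⊗ₜ 1))) =
      TensorProduct.map (B.right.flip n) LinearMap.id (TensorProduct.lid k (H ⊗[k] H)
        (TensorProduct.map χ.toLinearMap LinearMap.id x)) := by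
    intro x
    induction x using tensor3_induction with
    | add x y hx hy => simp only [map_add, LinearMap.add_apply, hx, hy]
    | tmul a b c => simp [K, E, hχ, TensorProduct.smul_tmul']
  have he : Q.counitFst (H ⊗[k] H) Q.phi = 1 := Q.e1_phi
  rw [h1 (ρ n), h2, hM.map_coinvProj_actR_of_eq_one he, hM.map_coinvProj_actL]
  refine (congrArg (fun z => K (TensorProduct.map E LinearMap.id
    (B.actL (H ⊗[k] H) Q.phiInv z))) h3).trans ?_
  exact h4 _

/-- An element on which the left action and the coaction are twisted by a character is
coinvariant. -/
lemma coinvariant_of_twisted {n : M} {χ : H →ₐ[k] k} (hl : ∀ c, B.left c n = B.right (Q.hit χ c) n)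
    (hρ : ρ n = TensorProduct.map (B.right.flip n) LinearMap.id (Q.T χ)) :
    Q.coinvProj B ρ n = n := by
  let F : H ⊗[k] (H ⊗[k] H) →ₗ[k] H := (TensorProduct.lid k H).toLinearMap ∘ₗ
    TensorProduct.map χ.toLinearMap (sandwichRight Q.S Q.beta)
  have h1 : ∀ q x, Q.antipodeContract B (B.actL H q
      (TensorProduct.map (B.right.flip n) LinearMap.id (TensorProduct.lid k (H ⊗[k] H)
        (TensorProduct.map χ.toLinearMap LinearMap.id x)))) = B.right (F (Q.comulFst q * x)) n := by
    intro q x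
    induction q using TensorProduct.induction_on with
    | zero => simp
    | add x y hx hy => simp only [map_add, LinearMap.add_apply, add_mul, hx, hy]
    | tmul a b =>
      induction x using tensor3_induction with
      | add x y hx hy => simp only [map_add, LinearMap.add_apply, mul_add, hx, hy]
      | tmul u v w =>
        have : ∀ d, F (TensorProduct.assoc k H H H (d ⊗ₜ b) * (u ⊗ₜ (v ⊗ₜ w))) =
            χ u • (TensorProduct.lid k H (TensorProduct.map χ.toLinearMap LinearMap.id d) *
              (v * (Q.beta * Q.S (b * w)))) := by
          intro d
          induction d using TensorProduct.induction_on with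
          | zero => simp
          | add x y hx hy => simp only [map_add, TensorProduct.add_tmul, add_mul, smul_add, hx, hy]
          | tmul e f => simp [F, mul_assoc, smul_smul, mul_comm]
        rw [comulFst_tmul, this]
        have e : TensorProduct.lid k H (TensorProduct.map χ.toLinearMap LinearMap.id (Q.comul a)) =
          Q.hit χ a := rfl
        simp [hl, e, B.right_mul, ← B.left_right_comm]
  have h2 : ∀ z, F z = TensorProduct.lid k H (TensorProduct.map χ.toLinearMap LinearMap.id
      (TensorProduct.map LinearMap.id (sandwichRight Q.S Q.beta) z)) := by
    intro z
    rw [← LinearMap.comp_apply (TensorProduct.map _ _), ← TensorProduct.map_comp]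
    rfl
  rw [coinvProj_apply, hρ]
  refine (h1 _ _).trans ?_
  rw [h2, sandwichRight_comulFst_qR, Algebra.TensorProduct.one_def]
  simp [B.right_one]

/-- The structure theorem: `n ⊗ h ↦ n · h` identifies a quasi-Hopf bimodule with the free right
module on its coinvariants. The inverse is `m ↦ E(m₀) ⊗ m₁`. -/
lemma bijective_contract (hM : Q.IsHopfBimodule B ρ) :
    Function.Bijective (B.contract ∘ₗ
      TensorProduct.map (Q.coinvariants B ρ).subtype (LinearMap.id : H →ₗ[k] H)) := by
  constructor
  · have h : ∀ t, TensorProduct.map (Q.coinvProj B ρ) LinearMap.id (ρ (B.contract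
        (TensorProduct.map (Q.coinvariants B ρ).subtype (LinearMap.id : H →ₗ[k] H) t))) =
        (Q.coinvariants B ρ).subtype.rTensor H t := by
      intro t
      induction t using TensorProduct.induction_on with
      | zero => simp
      | add t t' ht ht' => simp only [map_add, ht, ht']
      | tmul n b => simp [hM.map_coinvProj_right n.2]
    intro s t hst
    apply Module.Flat.rTensor_preserves_injective_linearMap (M := H) _
      (Q.coinvariants B ρ).injective_subtype
    rw [← h, ← h]
    exact congrArg _ (congrArg ρ hst)
  · intro m
    let E' : M →ₗ[k] Q.coinvariants B ρ :=
      (Q.coinvProj B ρ).codRestrict _ fun m => hM.coinvProj_coinvProj m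
    refine ⟨TensorProduct.map E' LinearMap.id (ρ m), ?_⟩
    conv_rhs => rw [← hM.contract_coinvProj m]
    rw [LinearMap.comp_apply, ← LinearMap.comp_apply (TensorProduct.map _ _),
      ← TensorProduct.map_comp]
    rfl

lemma finrank_coinvariants_mul (hM : Q.IsHopfBimodule B ρ) :
    Module.finrank k (Q.coinvariants B ρ) * Module.finrank k H = Module.finrank k M := by
  rw [← Module.finrank_tensorProduct]
  exact (LinearEquiv.ofBijective _ hM.bijective_contract).finrank_eq

end IsHopfBimodule

end QuasiHopfAlgebra

namespace QuasiHopfAlgebra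

variable {k H : Type*} [Field k] [Ring H] [Algebra k H] (Q : QuasiHopfAlgebra k H)

/-! ### The quasi-Hopf bimodule `H^*` -/

/-- The bimodule `H^*`. -/
abbrev dualB : BimoduleStr k H (Module.Dual k H) := Q.dualBimodule (BimoduleStr.regular k H)

/-- The coaction on `H^*`. -/
abbrev dualRho [Module.Finite k H] : Module.Dual k H →ₗ[k] Module.Dual k H ⊗[k] H :=
  Q.dualCoaction (BimoduleStr.regular k H) Q.Delta

@[simp] lemma dualB_left (a : H) (ψ : Module.Dual k H) (c : H) :
    Q.dualB.left a ψ c = ψ (Q.Sinv a * c) := rfl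

@[simp] lemma dualB_right (a : H) (ψ : Module.Dual k H) (c : H) :
    Q.dualB.right a ψ c = ψ (c * Q.S a) := rfl

lemma dualTensorHom_injective [Module.Finite k H] (C : Type*) [AddCommGroup C] [Module k C] :
    Function.Injective (dualTensorHom k H C) := by
  intro s t h
  exact (dualTensorHomEquiv k H C).injective (by simpa using h)

lemma dualTensorHom_actL {C : Type*} [Ring C] [Algebra k C] (x : H ⊗[k] C)
    (t : Module.Dual k H ⊗[k] C) (h : H) :
    dualTensorHom k H C (Q.dualB.actL C x t) h =
      ((dualTensorHom k H C t ∘ₗ LinearMap.mulRight k h ∘ₗ Q.Sinv) ⊚ LinearMap.id) x := by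
  induction x using TensorProduct.induction_on with
  | zero => simp
  | add x y hx hy => simp only [map_add, LinearMap.add_apply, hx, hy]
  | tmul a c =>
    induction t using TensorProduct.induction_on with
    | zero => simp
    | add t t' ht ht' =>
      simp only [rchain_tmul, LinearMap.comp_apply] at ht ht' ⊢
      simp only [map_add, LinearMap.add_apply, mul_add, ht, ht']
    | tmul ψ d => simp

lemma dualTensorHom_actR {C : Type*} [Ring C] [Algebra k C] (x : H ⊗[k] C)
    (t : Module.Dual k H ⊗[k] C) (h : H) :
    dualTensorHom k H C (Q.dualB.actR C x t) h =
      ((dualTensorHom k H C t ∘ₗ LinearMap.mulLeft k h ∘ₗ Q.S) ⊛ LinearMap.id) x := by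
  induction x using TensorProduct.induction_on with
  | zero => simp
  | add x y hx hy => simp only [map_add, LinearMap.add_apply, hx, hy]
  | tmul a c =>
    induction t using TensorProduct.induction_on with
    | zero => simp
    | add t t' ht ht' =>
      simp only [chain_tmul, LinearMap.comp_apply] at ht ht' ⊢
      simp only [map_add, LinearMap.add_apply, add_mul, ht, ht']
    | tmul ψ d => simp

variable (H) in
/-- The map `id ⊗ ψ`. -/
def slice (ψ : Module.Dual k H) : H ⊗[k] H →ₗ[k] H :=
  (TensorProduct.rid k H).toLinearMap ∘ₗ TensorProduct.map LinearMap.id ψ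

@[simp] lemma slice_tmul (ψ : Module.Dual k H) (a b : H) : slice H ψ (a ⊗ₜ b) = ψ b • a := by
  simp [slice]

lemma slice_inl_mul (ψ : Module.Dual k H) (a : H) (x : H ⊗[k] H) :
    slice H ψ (inl k H H a * x) = a * slice H ψ x := by
  induction x using TensorProduct.induction_on with
  | zero => simp
  | add x y hx hy => simp only [map_add, mul_add, hx, hy]
  | tmul b c => simp

lemma slice_mul_inl (ψ : Module.Dual k H) (a : H) (x : H ⊗[k] H) :
    slice H ψ (x * inl k H H a) = slice H ψ x * a := by
  induction x using TensorProduct.induction_on with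
  | zero => simp
  | add x y hx hy => simp only [map_add, add_mul, hx, hy]
  | tmul b c => simp

lemma slice_inr_mul (ψ : Module.Dual k H) (a : H) (x : H ⊗[k] H) :
    slice H ψ (inr k H H (Q.Sinv a) * x) = slice H (Q.dualB.left a ψ) x := by
  induction x using TensorProduct.induction_on with
  | zero => simp
  | add x y hx hy => simp only [map_add, mul_add, hx, hy]
  | tmul b c => simp

lemma slice_mul_inr (ψ : Module.Dual k H) (a : H) (x : H ⊗[k] H) :
    slice H ψ (x * inr k H H (Q.S a)) = slice H (Q.dualB.right a ψ) x := by
  induction x using TensorProduct.induction_on with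
  | zero => simp
  | add x y hx hy => simp only [map_add, add_mul, hx, hy]
  | tmul b c => simp

variable [Module.Finite k H]

/-- The coaction of `H^*`, with values in `Hom(H, H)`. -/
lemma dualTensorHom_dualRho (ψ : Module.Dual k H) (c : H) :
    dualTensorHom k H H (Q.dualRho ψ) c = slice H ψ (Q.V * Q.comul c * Q.explicitU) := by
  have h : dualTensorHom k H H (Q.dualRho ψ) = slice H ψ ∘ₗ
      Q.deformedCoaction (BimoduleStr.regular k H) Q.Delta := by
    exact (dualTensorHomEquiv k H H).apply_symm_apply
      (slice H ψ ∘ₗ Q.deformedCoaction (BimoduleStr.regular k H) Q.Delta)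
  have h1 : ∀ u v x : H ⊗[k] H, slotAct (LinearMap.mul k H) (BimoduleStr.regular k H).left v
      (slotAct (LinearMap.mul k H).flip (BimoduleStr.regular k H).right u x) = v * x * u := by
    intro u v x
    rw [mul_assoc]
    have h2 : slotAct (LinearMap.mul k H).flip (BimoduleStr.regular k H).right u x = x * u := by
      induction u using TensorProduct.induction_on with
      | zero => simp
      | add u u' hu hu' => simp only [map_add, LinearMap.add_apply, mul_add, hu, hu']
      | tmul a b =>
        induction x using TensorProduct.induction_on with
        | zero => simp
        | add x x' hx hx' => simp only [map_add, add_mul, hx, hx']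
        | tmul c d => simp [slotAct, BimoduleStr.regular]
    have h3 : ∀ y, slotAct (LinearMap.mul k H) (BimoduleStr.regular k H).left v y = v * y := by
      intro y
      induction v using TensorProduct.induction_on with
      | zero => simp
      | add u u' hu hu' => simp only [map_add, LinearMap.add_apply, add_mul, hu, hu']
      | tmul a b =>
        induction y using TensorProduct.induction_on with
        | zero => simp
        | add x x' hx hx' => simp only [map_add, mul_add, hx, hx']
        | tmul c d => simp [slotAct, BimoduleStr.regular]
    rw [h2, h3]
  rw [h, LinearMap.comp_apply, ← U_eq]
  exact congrArg _ (h1 _ _ _)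

/-- `H^*` is a quasi-Hopf bimodule. The compatibility of the coaction with the two actions is the
covariance of `V` and `U`, and its coassociativity is that of `V` and `U`. -/
theorem isHopfBimodule_dual : Q.IsHopfBimodule Q.dualB Q.dualRho where
  left a ψ := by
    apply dualTensorHom_injective
    ext c
    rw [dualTensorHom_dualRho, dualTensorHom_actL, ← slice_inr_mul]
    have h : ∀ d, ((dualTensorHom k H H (Q.dualRho ψ) ∘ₗ LinearMap.mulRight k c ∘ₗ Q.Sinv) ⊚
        LinearMap.id) d = slice H ψ (((Q.V ▸▸ (Q.Delta ∘ₗ Q.Sinv)) ⊚ inl k H H) d *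
          (Q.comul c * Q.explicitU)) := by
      intro d
      induction d using TensorProduct.induction_on with
      | zero => simp
      | add x y hx hy => simp only [map_add, add_mul, hx, hy]
      | tmul a b =>
        simp only [rchain_tmul, LinearMap.comp_apply, dualTensorHom_dualRho, lmul_apply,
          LinearMap.id_apply, LinearMap.mulRight_apply, mul_assoc, slice_inl_mul, map_mul,
          Delta_apply]
    rw [h, V_cov]
    simp only [mul_assoc, inr_apply]
  right b ψ := by
    apply dualTensorHom_injective
    ext c
    rw [dualTensorHom_dualRho, dualTensorHom_actR, ← slice_mul_inr]
    have h : ∀ d, ((dualTensorHom k H H (Q.dualRho ψ) ∘ₗ LinearMap.mulLeft k c ∘ₗ Q.S) ⊛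
        LinearMap.id) d = slice H ψ (Q.V * Q.comul c *
          (((Q.Delta ∘ₗ Q.S) ◂ Q.explicitU) ⊛ inl k H H) d) := by
      intro d
      induction d using TensorProduct.induction_on with
      | zero => simp
      | add x y hx hy => simp only [map_add, mul_add, hx, hy]
      | tmul a b =>
        simp only [chain_tmul, LinearMap.comp_apply, dualTensorHom_dualRho, rmul_apply,
          LinearMap.id_apply, LinearMap.mulLeft_apply, ← mul_assoc, slice_mul_inl, map_mul,
          Delta_apply]
    rw [h, explicitU_cov]
    simp only [mul_assoc, inr_apply]
  counit ψ := by
    have h : ∀ t : Module.Dual k H ⊗[k] H, ∀ c, (TensorProduct.rid k _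
        (TensorProduct.map LinearMap.id Q.counit.toLinearMap t)) c =
        Q.counit (dualTensorHom k H H t c) := by
      intro t c
      induction t using TensorProduct.induction_on with
      | zero => simp
      | add t t' ht ht' => simp only [map_add, LinearMap.add_apply, ht, ht']
      | tmul χ d => simp [mul_comm]
    have h' : ∀ x, Q.counit (slice H ψ x) = ψ (Q.counitFst H x) := by
      intro x
      induction x using TensorProduct.induction_on with
      | zero => simp
      | add t t' ht ht' => simp only [map_add, ht, ht']
      | tmul a b => simp [mul_comm]
    ext c
    rw [h, dualTensorHom_dualRho, h', map_mul (Q.counitFst H), map_mul (Q.counitFst H), counitFst_V,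
      counitFst_explicitU, counitFst_comul, one_mul, mul_one]
  coassoc ψ := by
    let P : H ⊗[k] (H ⊗[k] H) →ₗ[k] H ⊗[k] H := TensorProduct.map LinearMap.id (slice H ψ)
    have hP1 : ∀ b c x, P ((mid k H c * inl k H (H ⊗[k] H) b) * x) = (b ⊗ₜ c) * P x := by
      intro b c x
      induction x using tensor3_induction with
      | add x y hx hy => simp only [map_add, mul_add, hx, hy]
      | tmul a b c => simp [P, mid]
    have hP2 : ∀ b c x, P (x * (inl k H (H ⊗[k] H) b * mid k H c)) = P x * (b ⊗ₜ c) := by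
      intro b c x
      induction x using tensor3_induction with
      | add x y hx hy => simp only [map_add, add_mul, hx, hy]
      | tmul a b c => simp [P, mid]
    have h1 : ∀ h, dualTensorHom k H (H ⊗[k] H) (TensorProduct.assoc k _ H H
        (TensorProduct.map Q.dualRho LinearMap.id (Q.dualRho ψ))) h =
        P (inr k H (H ⊗[k] H) Q.V * Q.comulSnd (Q.V * Q.comul h * Q.explicitU) *
          inr k H (H ⊗[k] H) Q.explicitU) := by
      intro h
      have e1 : ∀ t : Module.Dual k H ⊗[k] H, dualTensorHom k H (H ⊗[k] H)
          (TensorProduct.assoc k _ H H (TensorProduct.map Q.dualRho LinearMap.id t)) h =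
          TensorProduct.map LinearMap.id (dualTensorHom k H H t)
            (Q.V * Q.comul h * Q.explicitU) := by
        intro t
        induction t using TensorProduct.induction_on with
        | zero => simp
        | add t t' ht ht' =>
          simp only [map_add, LinearMap.add_apply, ht, ht', TensorProduct.map_add_right]
        | tmul χ g =>
          have e2 : ∀ s : Module.Dual k H ⊗[k] H, dualTensorHom k H (H ⊗[k] H)
              (TensorProduct.assoc k _ H H (s ⊗ₜ g)) h = dualTensorHom k H H s h ⊗ₜ g := by
            intro s
            induction s using TensorProduct.induction_on with
            | zero => simp
            | add t t' ht ht' =>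
              simp only [map_add, LinearMap.add_apply, ht, ht', TensorProduct.add_tmul]
            | tmul ξ u => simp [TensorProduct.smul_tmul']
          rw [TensorProduct.map_tmul, LinearMap.id_apply, e2, dualTensorHom_dualRho]
          generalize Q.V * Q.comul h * Q.explicitU = x
          induction x using TensorProduct.induction_on with
          | zero => simp
          | add t t' ht ht' => simp only [map_add, ht, ht', TensorProduct.add_tmul]
          | tmul a b => simp [TensorProduct.smul_tmul']
      rw [e1]
      generalize Q.V * Q.comul h * Q.explicitU = x
      induction x using TensorProduct.induction_on with
      | zero => simp
      | add t t' ht ht' => simp only [map_add, ht, ht', mul_add, add_mul]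
      | tmul a b =>
        rw [TensorProduct.map_tmul, dualTensorHom_dualRho]
        simp [P, comulSnd_tmul]
    have h2 : ∀ h, dualTensorHom k H (H ⊗[k] H)
        (TensorProduct.map LinearMap.id Q.Delta (Q.dualRho ψ)) h =
        P (Q.comulFst (Q.V * Q.comul h * Q.explicitU)) := by
      intro h
      have e1 : ∀ t : Module.Dual k H ⊗[k] H, dualTensorHom k H (H ⊗[k] H)
          (TensorProduct.map LinearMap.id Q.Delta t) h = Q.comul (dualTensorHom k H H t h) := by
        intro t
        induction t using TensorProduct.induction_on with
        | zero => simp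
        | add t t' ht ht' => simp only [map_add, LinearMap.add_apply, ht, ht']
        | tmul χ g => simp [Delta_apply]
      rw [e1, dualTensorHom_dualRho]
      generalize Q.V * Q.comul h * Q.explicitU = x
      induction x using TensorProduct.induction_on with
      | zero => simp
      | add t t' ht ht' => simp only [map_add, ht, ht']
      | tmul a b =>
        rw [comulFst_tmul, slice_tmul, map_smul]
        generalize Q.comul a = d
        induction d using TensorProduct.induction_on with
        | zero => simp
        | add t t' ht ht' => simp only [map_add, smul_add, TensorProduct.add_tmul, ht, ht']
        | tmul e f => simp [P]
    apply dualTensorHom_injective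
    ext c
    rw [dualTensorHom_actL, dualTensorHom_actR]
    have h3 : ∀ x, ((dualTensorHom k H (H ⊗[k] H) (TensorProduct.assoc k _ H H
        (TensorProduct.map Q.dualRho LinearMap.id (Q.dualRho ψ))) ∘ₗ LinearMap.mulRight k c ∘ₗ
          Q.Sinv) ⊚ LinearMap.id) x =
        P ((((inr k H (H ⊗[k] H) Q.V * Q.comulSnd Q.V) ▸▸ (Q.comul3.toLinearMap ∘ₗ Q.Sinv)) ⊚
          inl k H (H ⊗[k] H) ⊚ mid k H) x *
          (Q.comul3 c * (Q.comulSnd Q.explicitU * inr k H (H ⊗[k] H) Q.explicitU))) := by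
      intro x
      induction x using tensor3_induction with
      | add x y hx hy => simp only [map_add, add_mul, hx, hy]
      | tmul a b d =>
        rw [rchain_tmul, LinearMap.comp_apply, h1, LinearMap.id_apply, ← hP1]
        simp only [rchain_tmul, LinearMap.comp_apply, LinearMap.mulRight_apply, lmul_apply,
          map_mul, mul_assoc, comul3, AlgHom.toLinearMap_apply, AlgHom.comp_apply]
    have h4 : ∀ x, ((dualTensorHom k H (H ⊗[k] H)
        (TensorProduct.map LinearMap.id Q.Delta (Q.dualRho ψ)) ∘ₗ LinearMap.mulLeft k c ∘ₗ Q.S) ⊛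
          LinearMap.id) x = P (Q.comulFst Q.V * Q.comulFst (Q.comul c) *
        ((((Q.comulFst.toLinearMap ∘ₗ Q.Delta ∘ₗ Q.S) ◂ Q.comulFst Q.explicitU) ⊛
          inl k H (H ⊗[k] H) ⊛ mid k H) x)) := by
      intro x
      induction x using tensor3_induction with
      | add x y hx hy => simp only [map_add, mul_add, hx, hy]
      | tmul a b d =>
        rw [chain_tmul, LinearMap.comp_apply, h2, LinearMap.id_apply, ← hP2]
        simp only [chain_tmul, LinearMap.comp_apply, LinearMap.mulLeft_apply, rmul_apply,
          map_mul, mul_assoc, AlgHom.toLinearMap_apply, Delta_apply]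
    rw [h3, h4, ← explicitU_coassoc, V_coassoc]
    congr 1
    simp only [mul_assoc]
    rw [← mul_assoc (Q.comulFst (Q.comul c)), ← phiInv_mul_comul3, ← mul_assoc Q.phi,
      ← mul_assoc Q.phi, phi_mul_phiInv, one_mul]

end QuasiHopfAlgebra

namespace QuasiHopfAlgebra

variable {k H : Type*} [Field k] [Ring H] [Algebra k H] (Q : QuasiHopfAlgebra k H)

/-! ### Integrals and the modulus -/

lemma nontrivial (Q : QuasiHopfAlgebra k H) : Nontrivial H := by
  refine ⟨⟨0, 1, fun h => ?_⟩⟩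
  have := congrArg Q.counit h
  rw [map_zero, map_one] at this
  exact zero_ne_one this

/-- Characters `χ, ν, μ` of `H` with `χ * ν = ε = ν * μ` satisfy `χ = μ`: the reassociator acts by
an invertible scalar. -/
lemma eq_of_convolution_inverse {χ ν μ : H →ₐ[k] k} (h1 : ∀ c, ν (Q.hit χ c) = Q.counit c)
    (h2 : ∀ c, μ (Q.hit ν c) = Q.counit c) : χ = μ := by
  let G : H ⊗[k] (H ⊗[k] H) →ₐ[k] k := Algebra.TensorProduct.lift χ
    (Algebra.TensorProduct.lift ν μ fun _ _ => Commute.all _ _) fun _ _ => Commute.all _ _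
  have e1 : ∀ d, G (Q.comulSnd d) = χ (Q.counitSnd d) := by
    intro d
    induction d using TensorProduct.induction_on with
    | zero => simp
    | add x y hx hy => simp only [map_add, hx, hy]
    | tmul a b =>
      rw [counitSnd_tmul, map_smul, ← h2, hit, comulSnd_tmul, AlgHom.comp_apply]
      generalize Q.comul b = d
      induction d using TensorProduct.induction_on with
      | zero => simp
      | add x y hx hy => simp only [map_add, TensorProduct.tmul_add, hx, hy, add_smul]
      | tmul e f => simp [G]; ring
  have e2 : ∀ d, G (Q.comulFst d) = μ (Q.counitFst H d) := by
    intro d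
    induction d using TensorProduct.induction_on with
    | zero => simp
    | add x y hx hy => simp only [map_add, hx, hy]
    | tmul a b =>
      rw [counitFst_tmul, map_smul, ← h1, hit, comulFst_tmul, AlgHom.comp_apply]
      generalize Q.comul a = d
      induction d using TensorProduct.induction_on with
      | zero => simp
      | add x y hx hy => simp only [map_add, TensorProduct.add_tmul, hx, hy, add_smul]
      | tmul e f => simp [G]; ring
  have hφ : G Q.phi ≠ 0 := fun h => by
    have := congrArg G Q.phi_mul_phiInv
    rw [map_mul, h, zero_mul, map_one] at this
    exact zero_ne_one this
  ext c
  have h := congrArg G (Q.comulSnd_comul c)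
  rw [map_mul, map_mul, e1, e2, counitSnd_comul, counitFst_comul, mul_comm] at h
  exact mul_left_cancel₀ hφ h

/-- The character `μ ∘ S`. -/
def characterS (μ : H →ₐ[k] k) : H →ₐ[k] k :=
  AlgHom.ofLinearMap (μ.toLinearMap ∘ₗ Q.S) (by simp) (fun a b => by simp [S_mul, mul_comm])

@[simp] lemma characterS_apply (μ : H →ₐ[k] k) (a : H) : Q.characterS μ a = μ (Q.S a) := rfl

/-- `μ ∘ S` is a left convolution inverse of `μ`. -/
lemma map_hit_characterS (μ : H →ₐ[k] k) (c : H) : μ (Q.hit (Q.characterS μ) c) = Q.counit c := by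
  have h : ∀ d, μ (sandwichLeft Q.S Q.alpha d) = μ Q.alpha * μ (TensorProduct.lid k H
      (TensorProduct.map (Q.characterS μ).toLinearMap LinearMap.id d)) := by
    intro d
    induction d using TensorProduct.induction_on with
    | zero => simp
    | add x y hx hy => simp only [map_add, mul_add, hx, hy]
    | tmul a b => simp; ring
  have h' := h (Q.comul c)
  rw [sandwichLeft_comul, map_smul, smul_eq_mul, mul_comm] at h'
  exact (mul_left_cancel₀ (Q.map_alpha_ne_zero μ) h').symm

variable [Module.Finite k H]

/-- The structure theorem gives `dim 𝓛 · dim H = dim H^* = dim H`. -/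
lemma finrank_leftCointegrals : Module.finrank k Q.leftCointegrals = 1 := by
  have := Q.nontrivial
  have h := Q.isHopfBimodule_dual.finrank_coinvariants_mul
  rw [Subspace.dual_finrank_eq] at h
  exact Nat.eq_of_mul_eq_mul_right Module.finrank_pos (h.trans (one_mul _).symm)

/-- A nonzero left cointegral generates `H^*` freely as a right module. -/
lemma bijective_right_of_ne_zero {lam : Module.Dual k H} (hlam : lam ∈ Q.leftCointegrals)
    (h0 : lam ≠ 0) : Function.Bijective (Q.dualB.right.flip lam) := by
  have hinj : Function.Injective (Q.dualB.right.flip lam) := by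
    rw [injective_iff_map_eq_zero]
    intro b hb
    obtain ⟨x, hx⟩ : ∃ x, lam x ≠ 0 := by
      by_contra! h
      exact h0 (LinearMap.ext h)
    have h := Q.isHopfBimodule_dual.map_coinvProj_right (n := lam) hlam b
    rw [LinearMap.flip_apply] at hb
    rw [hb, map_zero, map_zero] at h
    have h' := congrArg (fun t => dualTensorHom k H H t x) h
    simp only [map_zero, LinearMap.zero_apply, dualTensorHom_apply] at h'
    exact (smul_eq_zero.mp h'.symm).resolve_left hx
  exact ⟨hinj, (LinearMap.injective_iff_surjective_of_finrank_eq_finrank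
    Subspace.dual_finrank_eq.symm).mp hinj⟩

/-- A nonzero left cointegral is a nondegenerate form. -/
lemma eq_zero_of_forall_mul {lam : Module.Dual k H} (hlam : lam ∈ Q.leftCointegrals)
    (h0 : lam ≠ 0) {y : H} (hy : ∀ x, lam (x * y) = 0) : y = 0 := by
  have h : Q.dualB.right.flip lam (Q.Sinv y) = 0 := by
    ext x
    simp [hy]
  have h1 := (Q.bijective_right_of_ne_zero hlam h0).1 (h.trans (map_zero _).symm)
  rw [← Q.S_Sinv y, h1, map_zero]

lemma exists_ne_zero_leftCointegral : ∃ lam ∈ Q.leftCointegrals, lam ≠ 0 := by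
  have : Nontrivial Q.leftCointegrals := Module.nontrivial_of_finrank_pos (R := k) (by
    rw [finrank_leftCointegrals]; exact one_pos)
  obtain ⟨⟨v, hv⟩, h⟩ := exists_ne (0 : Q.leftCointegrals)
  exact ⟨v, hv, fun h' => h (Subtype.ext h')⟩

/-- The element `l` dual to a nonzero left cointegral `λ`; every left integral is a multiple of it.
-/
lemma exists_leftIntegral {lam : Module.Dual k H} (hlam : lam ∈ Q.leftCointegrals) (h0 : lam ≠ 0) :
    ∃ l : H, (∀ x, lam (x * l) = Q.counit x) ∧
      ∀ l', (∀ a, a * l' = Q.counit a • l') → l' = lam l' • l := by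
  obtain ⟨b, hb⟩ := (Q.bijective_right_of_ne_zero hlam h0).2 Q.counit.toLinearMap
  have hl : ∀ x, lam (x * Q.S b) = Q.counit x := fun x => LinearMap.congr_fun hb x
  refine ⟨Q.S b, hl, fun l' hl' => ?_⟩
  rw [← sub_eq_zero]
  refine Q.eq_zero_of_forall_mul hlam h0 fun x => ?_
  rw [mul_sub, hl', mul_smul_comm, map_sub, map_smul, map_smul, hl, smul_eq_mul, smul_eq_mul,
    mul_comm, sub_self]

/-- A modulus exists: the element `l` dual to a left cointegral is a left integral, so `l a` is one
as well, and hence is a multiple of `l`. -/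
lemma isModulus_modulus : Q.IsModulus Q.modulus := by
  have hex : ∃ μ : H →ₐ[k] k, Q.IsModulus μ := by
    obtain ⟨lam, hlam, h0⟩ := Q.exists_ne_zero_leftCointegral
    obtain ⟨l, hl, hl'⟩ := Q.exists_leftIntegral hlam h0
    have h1 : lam l = 1 := by simpa using hl 1
    have hint : ∀ a, a * l = Q.counit a • l := by
      intro a
      rw [← sub_eq_zero]
      refine Q.eq_zero_of_forall_mul hlam h0 fun x => ?_
      rw [mul_sub, ← mul_assoc, mul_smul_comm, map_sub, map_smul, hl, hl, map_mul, smul_eq_mul,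
        mul_comm, sub_self]
    have hμ : ∀ a, l * a = lam (l * a) • l := fun a => hl' _ fun b => by
      rw [← mul_assoc, hint, smul_mul_assoc]
    refine ⟨AlgHom.ofLinearMap (lam ∘ₗ LinearMap.mulLeft k l) (by simpa using h1) fun a b => ?_,
      l, ?_, hint, hμ⟩
    · simp only [LinearMap.comp_apply, LinearMap.mulLeft_apply]
      rw [← mul_assoc, hμ a, smul_mul_assoc, map_smul, map_smul, h1, smul_eq_mul, smul_eq_mul,
        mul_one]
    · rintro rfl
      simp at h1
  rw [modulus, dif_pos hex]
  exact hex.choose_spec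

/-- On left cointegrals `c ↦ E(c · -)` is a character, since they form a line and `E(a · E(m)) = E(a
· m)`. -/
lemma exists_character : ∃ χ : H →ₐ[k] k, ∀ lam ∈ Q.leftCointegrals, ∀ c,
    Q.coinvProj Q.dualB Q.dualRho (Q.dualB.left c lam) = χ c • lam := by
  have hM := Q.isHopfBimodule_dual
  obtain ⟨lam, hlam, h0⟩ := Q.exists_ne_zero_leftCointegral
  have hspan : ∀ w ∈ Q.leftCointegrals, ∃ c : k, c • lam = w := by
    intro w hw
    obtain ⟨c, hc⟩ := (finrank_eq_one_iff_of_nonzero' (⟨lam, hlam⟩ : Q.leftCointegrals)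
      (fun h => h0 (congrArg Subtype.val h))).mp Q.finrank_leftCointegrals ⟨w, hw⟩
    exact ⟨c, congrArg Subtype.val hc⟩
  obtain ⟨x, hx⟩ : ∃ x, lam x ≠ 0 := by
    by_contra! h
    exact h0 (LinearMap.ext h)
  let χ : H →ₗ[k] k := (lam x)⁻¹ • (Module.Dual.eval k H x ∘ₗ Q.coinvProj Q.dualB Q.dualRho ∘ₗ
    Q.dualB.left.flip lam)
  have hχ : ∀ c, Q.coinvProj Q.dualB Q.dualRho (Q.dualB.left c lam) = χ c • lam := by
    intro c
    obtain ⟨r, hr⟩ := hspan _ (show Q.coinvProj Q.dualB Q.dualRho (Q.dualB.left c lam) ∈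
      Q.leftCointegrals from hM.coinvProj_coinvProj _)
    have : χ c = r := by
      simp only [χ, LinearMap.smul_apply, LinearMap.comp_apply, LinearMap.flip_apply, ← hr,
        Module.Dual.eval_apply, smul_eq_mul]
      field_simp
    rw [this, hr]
  have hinj : ∀ r s : k, r • lam = s • lam → r = s := fun r s h => smul_left_injective k h0 h
  refine ⟨AlgHom.ofLinearMap χ (hinj _ _ ?_) fun a b => hinj _ _ ?_, fun w hw c => ?_⟩
  · rw [← hχ, Q.dualB.left_one, one_smul]
    exact hlam
  · rw [← hχ, Q.dualB.left_mul, ← hM.coinvProj_left_coinvProj, hχ, map_smul, map_smul, hχ,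
      smul_smul, mul_comm]
  · obtain ⟨r, rfl⟩ := hspan w hw
    rw [map_smul, map_smul, hχ, smul_comm]
    rfl

/-- The character through which `H` acts on left cointegrals is the modulus. -/
lemma coinvProj_left_leftCointegral {lam : Module.Dual k H} (hlam : lam ∈ Q.leftCointegrals)
    (c : H) : Q.coinvProj Q.dualB Q.dualRho (Q.dualB.left c lam) = Q.modulus c • lam := by
  have hM := Q.isHopfBimodule_dual
  obtain ⟨χ, hχ⟩ := Q.exists_character
  suffices h : χ = Q.modulus by rw [hχ lam hlam, h]
  obtain ⟨lam, hlam, h0⟩ := Q.exists_ne_zero_leftCointegral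
  obtain ⟨l, hl, hl'⟩ := Q.exists_leftIntegral hlam h0
  obtain ⟨l', hl0, hint, hμ⟩ := Q.isModulus_modulus
  have e := hl' l' hint
  have hμl : ∀ a, l * a = Q.modulus a • l := by
    intro a
    have hne : lam l' ≠ 0 := fun h => hl0 (by rw [e, h, zero_smul])
    have h := hμ a
    rw [e, smul_mul_assoc, smul_comm] at h
    exact smul_right_injective H hne h
  refine Q.eq_of_convolution_inverse (ν := Q.characterS Q.modulus) (fun c => ?_)
    (Q.map_hit_characterS _)
  -- Evaluating `c · λ = λ · (c ↼ χ)` at the left integral `l` gives `ε(c) = μ(S(c ↼ χ))`.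
  have h := LinearMap.congr_fun (hM.left_coinvariant hlam (hχ lam hlam) c) l
  rw [dualB_left, dualB_right, hl, counit_Sinv, hμl, map_smul] at h
  have h1 : lam l = 1 := by simpa using hl 1
  rw [characterS_apply, h, h1, smul_eq_mul, mul_one]

/-- Left cointegrals are the forms on which the left action and the coaction are twisted by the
modulus. -/
lemma mem_leftCointegrals_iff {lam : Module.Dual k H} : lam ∈ Q.leftCointegrals ↔
    (∀ c, Q.dualB.left c lam = Q.dualB.right (Q.hit Q.modulus c) lam) ∧
      Q.dualRho lam = TensorProduct.map (Q.dualB.right.flip lam) LinearMap.id (Q.T Q.modulus) :=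
  ⟨fun h => ⟨Q.isHopfBimodule_dual.left_coinvariant h (Q.coinvProj_left_leftCointegral h),
    Q.isHopfBimodule_dual.coaction_coinvariant h (Q.coinvProj_left_leftCointegral h)⟩,
    fun h => IsHopfBimodule.coinvariant_of_twisted h.1 h.2⟩

end QuasiHopfAlgebra

/-! ### Slotwise actions as products -/

section

variable {k : Type*} [Field k] {A B C D : Type*} [Ring A] [Algebra k A] [Ring B] [Algebra k B]
  [AddCommGroup C] [Module k C] [AddCommGroup D] [Module k D]

lemma slotAct_mul_right (q : D →ₗ[k] B) :
    slotAct (LinearMap.mul k A) (LinearMap.mul k B ∘ₗ q) =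
      LinearMap.mul k (A ⊗[k] B) ∘ₗ TensorProduct.map LinearMap.id q := by
  ext
  simp [slotAct]

lemma slotAct_mul_left (p : C →ₗ[k] A) :
    slotAct (LinearMap.mul k A ∘ₗ p) (LinearMap.mul k B) =
      LinearMap.mul k (A ⊗[k] B) ∘ₗ TensorProduct.map p LinearMap.id := by
  ext
  simp [slotAct]

lemma slotAct_mul_flip :
    slotAct (LinearMap.mul k A).flip (LinearMap.mul k B).flip =
      (LinearMap.mul k (A ⊗[k] B)).flip := by
  ext
  simp [slotAct]

end

namespace QuasiHopfAlgebra

variable {k H : Type*} [Field k] [Ring H] [Algebra k H] (Q : QuasiHopfAlgebra k H)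

/-! ### Forms on `H ⊗ H_μ` -/

variable (μ : H →ₐ[k] k) (Sig : Module.Dual k (H ⊗[k] H))

/-- `a ⊗ b ↦ a ⊗ (b ↼ μ)`. -/
def hitSnd : H ⊗[k] H →ₐ[k] H ⊗[k] H := Algebra.TensorProduct.map (AlgHom.id k H) (Q.hit μ)

/-- `a ⊗ b ⊗ c ↦ a ⊗ b ⊗ (c ↼ μ)`. -/
def hitThd : H ⊗[k] (H ⊗[k] H) →ₐ[k] H ⊗[k] (H ⊗[k] H) :=
  Algebra.TensorProduct.map (AlgHom.id k H) (Q.hitSnd μ)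

/-- `a ⊗ b ⊗ c ↦ a ⊗ (b ↼ μ) ⊗ c`. -/
def hitMid : H ⊗[k] (H ⊗[k] H) →ₐ[k] H ⊗[k] (H ⊗[k] H) :=
  Algebra.TensorProduct.map (AlgHom.id k H) (Algebra.TensorProduct.map (Q.hit μ) (AlgHom.id k H))

@[simp] lemma hitSnd_tmul (a b : H) : Q.hitSnd μ (a ⊗ₜ b) = a ⊗ₜ Q.hit μ b := rfl

@[simp] lemma hitThd_tmul (a : H) (t : H ⊗[k] H) : Q.hitThd μ (a ⊗ₜ t) = a ⊗ₜ Q.hitSnd μ t := rfl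

@[simp] lemma hitMid_tmul (a b c : H) :
    Q.hitMid μ (a ⊗ₜ (b ⊗ₜ c)) = a ⊗ₜ (Q.hit μ b ⊗ₜ c) := rfl

variable (k H) in
/-- `x ↦ x ⊗ 1`. -/
def padEnd : H ⊗[k] H →ₐ[k] H ⊗[k] (H ⊗[k] H) :=
  Algebra.TensorProduct.map (AlgHom.id k H) Algebra.TensorProduct.includeLeft

@[simp] lemma padEnd_tmul (a b : H) : padEnd k H (a ⊗ₜ b) = a ⊗ₜ (b ⊗ₜ 1) := rfl

/-- `id ⊗ Σ`. -/
def evalSnd : H ⊗[k] (H ⊗[k] H) →ₗ[k] H :=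
  (TensorProduct.rid k H).toLinearMap ∘ₗ TensorProduct.map LinearMap.id Sig

/-- `Σ ⊗ id`. -/
def evalFst : H ⊗[k] (H ⊗[k] H) →ₗ[k] H :=
  (TensorProduct.lid k H).toLinearMap ∘ₗ TensorProduct.map Sig LinearMap.id ∘ₗ
    (TensorProduct.assoc k H H H).symm.toLinearMap

@[simp] lemma evalSnd_tmul (a : H) (t : H ⊗[k] H) : evalSnd Sig (a ⊗ₜ t) = Sig t • a := by
  simp [evalSnd]

@[simp] lemma evalFst_tmul (a b c : H) : evalFst Sig (a ⊗ₜ (b ⊗ₜ c)) = Sig (a ⊗ₜ b) • c := by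
  simp [evalFst]

lemma regular_left : (BimoduleStr.regular k H).left = LinearMap.mul k H := rfl

lemma regular_right : (BimoduleStr.regular k H).right = (LinearMap.mul k H).flip := rfl

lemma twistedBimodule_left :
    (Q.twistedBimodule μ).left = LinearMap.mul k H ∘ₗ (Q.hit μ).toLinearMap := rfl

lemma twistedBimodule_right : (Q.twistedBimodule μ).right = (LinearMap.mul k H).flip := rfl

lemma map_id_hit : TensorProduct.map LinearMap.id (Q.hit μ).toLinearMap =
    (Q.hitSnd μ).toLinearMap := rfl

lemma map_id_hitSnd : TensorProduct.map LinearMap.id (Q.hitSnd μ).toLinearMap =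
    (Q.hitThd μ).toLinearMap := rfl

lemma map_id_map_hit : TensorProduct.map LinearMap.id
    (TensorProduct.map (Q.hit μ).toLinearMap (LinearMap.id : H →ₗ[k] H)) =
    (Q.hitMid μ).toLinearMap := rfl

/-- Biinvariance of a form on `H ⊗ H_μ`, spelled out in the algebra `H ⊗ H`. -/
lemma isBiinvariant_iff :
    Q.IsBiinvariant (BimoduleStr.regular k H) (Q.twistedBimodule μ) Sig ↔
      (∀ a t, Sig (t * Q.comul a) = Q.counit a * Sig t) ∧
        ∀ a t, Sig (Q.hitSnd μ (Q.comul a) * t) = Q.counit a * Sig t := by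
  simp only [IsBiinvariant, regular_left, regular_right, twistedBimodule_left,
    twistedBimodule_right, slotAct_mul_flip, slotAct_mul_right, map_id_hit]
  constructor
  · intro h
    refine ⟨fun a t => ?_, fun a t => ?_⟩
    · induction t using TensorProduct.induction_on with
      | zero => simp
      | add x y hx hy => simp only [map_add, add_mul, mul_add, hx, hy]
      | tmul x m => exact (h a x m).1
    · induction t using TensorProduct.induction_on with
      | zero => simp
      | add x y hx hy => simp only [map_add, mul_add, hx, hy]
      | tmul x m => exact (h a x m).2
  · rintro ⟨h1, h2⟩ a x m
    exact ⟨h1 a _, h2 a _⟩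

/-- Cocentrality of a form on `H ⊗ H_μ`, spelled out in the algebra `H ⊗ H ⊗ H`. -/
lemma isCocentral_iff :
    Q.IsCocentral (BimoduleStr.regular k H) Q.Delta (Q.twistedBimodule μ) (Q.twistedCoaction μ)
      Sig ↔ ∀ t, evalSnd Sig (Q.hitThd μ Q.phi * (Q.comulFst t * Q.phiInv)) =
        evalFst Sig (Q.hitMid μ Q.phiInv *
          (inr k H (H ⊗[k] H) (Q.T μ) * Q.comulSnd t * Q.phi)) := by
  have h9 : ∀ x m : H, x ⊗ₜ[k] Q.twistedCoaction μ m =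
      inr k H (H ⊗[k] H) (Q.T μ) * Q.comulSnd (x ⊗ₜ m) := by
    intro x m
    simp [twistedCoaction, comulSnd_tmul, Delta_apply]
  simp only [IsCocentral, regular_left, regular_right, twistedBimodule_left,
    twistedBimodule_right, slotAct_mul_flip, slotAct_mul_right, slotAct_mul_left, map_id_hit,
    map_id_hitSnd, map_id_map_hit, h9]
  constructor
  · intro h t
    induction t using TensorProduct.induction_on with
    | zero => simp
    | add x y hx hy => simp only [map_add, add_mul, mul_add, hx, hy]
    | tmul x m => exact h x m
  · intro h x m
    exact h (x ⊗ₜ m)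

lemma mem_forms_iff : Sig ∈ Q.cocentralBiinvariantForms (BimoduleStr.regular k H) Q.Delta
      (Q.twistedBimodule μ) (Q.twistedCoaction μ) ↔
    ((∀ a t, Sig (t * Q.comul a) = Q.counit a * Sig t) ∧
      ∀ a t, Sig (Q.hitSnd μ (Q.comul a) * t) = Q.counit a * Sig t) ∧
    ∀ t, evalSnd Sig (Q.hitThd μ Q.phi * (Q.comulFst t * Q.phiInv)) =
        evalFst Sig (Q.hitMid μ Q.phiInv *
          (inr k H (H ⊗[k] H) (Q.T μ) * Q.comulSnd t * Q.phi)) := by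
  rw [← isBiinvariant_iff, ← isCocentral_iff]
  rfl

/-! ### The form of a cointegral -/

/-- `a ⊗ b ↦ S⁻¹(α) a β S(b)`, so that `Σ_λ` is `λ ∘ formContract`. -/
def formContract : H ⊗[k] H →ₗ[k] H := ((Q.Sinv Q.alpha ▸▸ LinearMap.id) ◂ Q.beta) ⊛ Q.S

@[simp] lemma formContract_tmul (a b : H) :
    Q.formContract (a ⊗ₜ b) = Q.Sinv Q.alpha * a * Q.beta * Q.S b := by simp [formContract]

variable {μ} {lam : Module.Dual k H}

/-- The form of any functional is right invariant. -/
lemma form_mul_comul (a : H) (t : H ⊗[k] H) :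
    lam (Q.formContract (t * Q.comul a)) = Q.counit a * lam (Q.formContract t) := by
  induction t using TensorProduct.induction_on with
  | zero => simp
  | add x y hx hy => simp only [map_add, mul_add, add_mul, hx, hy]
  | tmul u v =>
    have h : ∀ d, Q.formContract ((u ⊗ₜ v) * d) =
        Q.Sinv Q.alpha * u * sandwichRight Q.S Q.beta d * Q.S v := by
      intro d
      induction d using TensorProduct.induction_on with
      | zero => simp
      | add x y hx hy => simp only [map_add, mul_add, add_mul, hx, hy]
      | tmul e f => simp [S_mul, mul_assoc]
    rw [h, sandwichRight_comul]
    simp [mul_assoc]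

/-- If `c · λ = λ · (c ↼ μ)`, the second leg of `d_μ` in `Σ_λ(d_μ t)` can be moved to the front. -/
lemma form_hitSnd_mul (hl : ∀ c x, lam (Q.Sinv c * x) = lam (x * Q.S (Q.hit μ c)))
    (d t : H ⊗[k] H) : lam (Q.formContract (Q.hitSnd μ d * t)) =
      lam (Q.Sinv (sandwichLeft Q.S Q.alpha d) *
        (((LinearMap.id ◂ Q.beta) ⊛ Q.S) t)) := by
  induction t using TensorProduct.induction_on with
  | zero => simp
  | add x y hx hy => simp only [map_add, mul_add, hx, hy]
  | tmul u v =>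
    induction d using TensorProduct.induction_on with
    | zero => simp
    | add x y hx hy => simp only [map_add, add_mul, hx, hy]
    | tmul e f =>
      have := hl f (Q.Sinv Q.alpha * e * u * Q.beta * Q.S v)
      simp [S_mul, Sinv_mul, mul_assoc] at this ⊢
      exact this.symm

lemma formContract_eq (t : H ⊗[k] H) :
    Q.formContract t = Q.Sinv Q.alpha * ((LinearMap.id ◂ Q.beta) ⊛ Q.S) t := by
  induction t using TensorProduct.induction_on with
  | zero => simp
  | add x y hx hy => simp only [map_add, mul_add, hx, hy]
  | tmul u v => simp [mul_assoc]

/-- If `ρ(λ) = λ · T_μ¹ ⊗ T_μ²`, then `ρ(λ · m) = λ · (T_μ Δ(m))¹ ⊗ (T_μ Δ(m))²`. -/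
lemma dualRho_right [Module.Finite k H]
    (hρ : Q.dualRho lam = TensorProduct.map (Q.dualB.right.flip lam) LinearMap.id (Q.T μ)) (m : H) :
    Q.dualRho (Q.dualB.right m lam) =
      TensorProduct.map (Q.dualB.right.flip lam) LinearMap.id (Q.T μ * Q.comul m) := by
  rw [Q.isHopfBimodule_dual.right, hρ]
  generalize Q.T μ = t
  generalize Q.comul m = d
  induction t using TensorProduct.induction_on with
  | zero => simp
  | add x y hx hy => simp only [map_add, add_mul, hx, hy]
  | tmul u v =>
    induction d using TensorProduct.induction_on with
    | zero => simp
    | add x y hx hy => simp only [map_add, mul_add, LinearMap.add_apply, hx, hy]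
    | tmul e f => simp [BimoduleStr.right_mul]

/-- For `t = x ⊗ m` both sides of cocentrality are `id ⊗ (λ · m)` of `q_R Δ(x) p_R`: the left side
directly, and the right side because the coaction on `λ · m` brings in `V` and `U`, which contract
to `q_R` and `p_R`. -/
lemma form_cocentral [Module.Finite k H]
    (hl : ∀ c x, lam (Q.Sinv c * x) = lam (x * Q.S (Q.hit μ c)))
    (hρ : Q.dualRho lam = TensorProduct.map (Q.dualB.right.flip lam) LinearMap.id (Q.T μ))
    (t : H ⊗[k] H) :
    evalSnd (lam ∘ₗ Q.formContract) (Q.hitThd μ Q.phi * (Q.comulFst t * Q.phiInv)) =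
      evalFst (lam ∘ₗ Q.formContract) (Q.hitMid μ Q.phiInv *
        (inr k H (H ⊗[k] H) (Q.T μ) * Q.comulSnd t * Q.phi)) := by
  induction t using TensorProduct.induction_on with
  | zero => simp
  | add x y hx hy => simp only [map_add, add_mul, mul_add, hx, hy]
  | tmul x m =>
    have h1 : ∀ p q d, evalSnd (lam ∘ₗ Q.formContract) (Q.hitThd μ p *
        (TensorProduct.assoc k H H H (d ⊗ₜ m) * q)) =
        slice H (Q.dualB.right m lam) (Q.qRMap p * d * Q.pRMap q) := by
      intro p q d
      induction d using TensorProduct.induction_on with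
      | zero => simp
      | add x y hx hy => simp only [map_add, TensorProduct.add_tmul, add_mul, mul_add, hx, hy]
      | tmul e f =>
        induction p using tensor3_induction with
        | add x y hx hy => simp only [map_add, add_mul, hx, hy]
        | tmul a b c =>
          induction q using tensor3_induction with
          | add x y hx hy => simp only [map_add, mul_add, hx, hy]
          | tmul u v w =>
            have := hl c (Q.Sinv Q.alpha * b * f * v * Q.beta * Q.S w * Q.S m)
            simp [S_mul, mul_assoc] at this ⊢
            rw [this]
    have h2 : ∀ c, dualTensorHom k H H (TensorProduct.map (Q.dualB.right.flip lam) LinearMap.id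
        (Q.T μ * Q.comul m)) c =
        slice H (Q.dualB.right m lam) (Q.V * Q.comul c * Q.explicitU) := by
      intro c
      rw [← Q.dualRho_right hρ, dualTensorHom_dualRho]
    have h3 : ∀ p q, evalFst (lam ∘ₗ Q.formContract) (Q.hitMid μ p *
        (x ⊗ₜ (Q.T μ * Q.comul m) * q)) = slice H (Q.dualB.right m lam)
          (((Q.comul (Q.Sinv Q.alpha) ▸▸ Q.Delta) ⊚ (Q.V ▸▸ (Q.Delta ∘ₗ Q.Sinv)) ⊚ inl k H H) p *
            Q.comul x *
          ((Q.Delta ◂ Q.comul Q.beta) ⊛ ((Q.Delta ∘ₗ Q.S) ◂ Q.explicitU) ⊛ inl k H H) q) := by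
      intro p q
      induction p using tensor3_induction with
      | add x y hx hy => simp only [map_add, add_mul, hx, hy]
      | tmul a b c =>
        induction q using tensor3_induction with
        | add x y hx hy => simp only [map_add, mul_add, hx, hy]
        | tmul u v w =>
          have h4 : ∀ s, evalFst (lam ∘ₗ Q.formContract) (Q.hitMid μ (a ⊗ₜ (b ⊗ₜ c)) *
              (x ⊗ₜ s * (u ⊗ₜ (v ⊗ₜ w)))) =
              c * dualTensorHom k H H (TensorProduct.map (Q.dualB.right.flip lam) LinearMap.id s)
                (Q.Sinv b * Q.Sinv Q.alpha * a * x * u * Q.beta * Q.S v) * w := by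
            intro s
            induction s using TensorProduct.induction_on with
            | zero => simp
            | add x y hx hy =>
              simp only [map_add, TensorProduct.tmul_add, add_mul, mul_add, LinearMap.add_apply,
                hx, hy]
            | tmul s1 s2 =>
              have := hl b (Q.Sinv Q.alpha * a * x * u * Q.beta * Q.S v * Q.S s1)
              simp [S_mul, mul_assoc] at this ⊢
              rw [this]
          rw [h4, h2, ← slice_inl_mul, ← slice_mul_inl]
          simp only [rchain_tmul, chain_tmul, lmul_apply, rmul_apply, LinearMap.comp_apply,
            Delta_apply, map_mul, mul_assoc]
    have h5 : inr k H (H ⊗[k] H) (Q.T μ) * Q.comulSnd (x ⊗ₜ m) = x ⊗ₜ (Q.T μ * Q.comul m) := by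
      simp [comulSnd_tmul]
    rw [h5, comulFst_tmul, h1, h3, V_contract, explicitU_contract, qR_eq, pR_eq]

end QuasiHopfAlgebra

namespace QuasiHopfAlgebra

variable {k H : Type*} [Field k] [Ring H] [Algebra k H] (Q : QuasiHopfAlgebra k H)

/-! ### Recovering a cointegral from its form -/

lemma sandwichLeft_pR : sandwichLeft Q.S Q.alpha Q.pR = 1 := by
  rw [pR_eq]
  refine Eq.trans ?_ Q.zigzag'_phiInv
  generalize Q.phiInv = x
  induction x using tensor3_induction with
  | add x y hx hy => simp only [map_add, hx, hy]
  | tmul a b c => simp [mul_assoc]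

lemma sandwichLeft_pL : sandwichLeft Q.S Q.alpha Q.pL = 1 := by
  rw [pL_eq]
  refine Eq.trans ?_ Q.zigzag_phi
  generalize Q.phi = x
  induction x using tensor3_induction with
  | add x y hx hy => simp only [map_add, hx, hy]
  | tmul a b c => simp [S_mul, mul_assoc]

lemma sandwichRight_qR : sandwichRight Q.S Q.beta Q.qR = 1 := by
  rw [qR_eq]
  refine Eq.trans ?_ Q.zigzag_phi
  generalize Q.phi = x
  induction x using tensor3_induction with
  | add x y hx hy => simp only [map_add, hx, hy]
  | tmul a b c => simp [S_mul, mul_assoc]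

lemma sandwichRight_qL : sandwichRight Q.S Q.beta Q.qL = 1 := by
  rw [qL_eq]
  refine Eq.trans ?_ Q.zigzag'_phiInv
  generalize Q.phiInv = x
  induction x using tensor3_induction with
  | add x y hx hy => simp only [map_add, hx, hy]
  | tmul a b c => simp [mul_assoc]

variable {μ : H →ₐ[k] k} {lam : Module.Dual k H} {Sig : Module.Dual k (H ⊗[k] H)}

/-- `λ` is recovered from its form by any `p` and `q` with `S(p¹) α p² = 1` and `q¹ β S(q²) = 1`. -/
lemma form_apply_of_sandwich (hl : ∀ c x, lam (Q.Sinv c * x) = lam (x * Q.S (Q.hit μ c)))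
    {p q : H ⊗[k] H} (hp : sandwichLeft Q.S Q.alpha p = 1) (hq : sandwichRight Q.S Q.beta q = 1)
    (a : H) : lam (Q.formContract (Q.hitSnd μ p * (a ⊗ₜ 1) * q)) = lam a := by
  have h : ∀ q, ((LinearMap.id ◂ Q.beta) ⊛ Q.S) ((a ⊗ₜ 1) * q) =
      a * sandwichRight Q.S Q.beta q := by
    intro q
    induction q using TensorProduct.induction_on with
    | zero => simp
    | add x y hx hy => simp only [map_add, mul_add, hx, hy]
    | tmul u v => simp [mul_assoc]
  rw [mul_assoc, Q.form_hitSnd_mul hl, hp, h, hq]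
  simp

/-! ### The cointegral of a form -/

/-- Modulo right invariance, `(1 ⊗ b) q_L` is `(S(b) ⊗ 1) q_L`. -/
lemma apply_mul_tmul_mul_qL (hr : ∀ a t, Sig (t * Q.comul a) = Q.counit a * Sig t)
    (t : H ⊗[k] H) (b : H) :
    Sig (t * (1 ⊗ₜ b) * Q.qL) = Sig (t * (Q.S b ⊗ₜ 1) * Q.qL) := by
  rw [mul_assoc, ← Q.qL_cov]
  have h : ∀ d, Sig (t * (((inl k H H ∘ₗ Q.S) ◂ Q.qL) ⊛ Q.Delta) d) =
      Sig (t * (Q.S (Q.counitSnd d) ⊗ₜ 1) * Q.qL) := by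
    intro d
    induction d using TensorProduct.induction_on with
    | zero => simp
    | add x y hx hy => simp only [map_add, mul_add, add_mul, TensorProduct.add_tmul, hx, hy]
    | tmul u v =>
      rw [chain_tmul, Delta_apply, ← mul_assoc, hr]
      simp [← TensorProduct.smul_tmul', mul_assoc]
  rw [h, counitSnd_comul]

/-- Modulo right invariance, `(a β S(b) ⊗ 1) q_L` is `a ⊗ b`. -/
lemma apply_mul_beta_mul_qL (hr : ∀ a t, Sig (t * Q.comul a) = Q.counit a * Sig t)
    (t : H ⊗[k] H) (a b : H) :
    Sig (t * ((a * Q.beta * Q.S b) ⊗ₜ 1) * Q.qL) = Sig (t * (a ⊗ₜ b)) := by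
  have h : ∀ x, Sig (t * (a ⊗ₜ b) *
      ((inl k H H ◂ (Q.beta ⊗ₜ 1)) ⊛ ((inl k H H ∘ₗ Q.S) ◂ Q.qL) ⊛ Q.Delta) x) =
      Sig (t * ((a * sandwichRight Q.S Q.beta (Q.e3 x) * Q.S b) ⊗ₜ 1) * Q.qL) := by
    intro x
    induction x using tensor3_induction with
    | add x y hx hy => simp only [map_add, mul_add, add_mul, TensorProduct.add_tmul, hx, hy]
    | tmul u v w =>
      have e : t * (a ⊗ₜ b) * ((inl k H H ◂ (Q.beta ⊗ₜ 1)) ⊛ ((inl k H H ∘ₗ Q.S) ◂ Q.qL) ⊛ Q.Delta)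
          (u ⊗ₜ (v ⊗ₜ w)) = (t * ((a * u * Q.beta * Q.S v) ⊗ₜ 1)) * (1 ⊗ₜ b) * Q.qL *
            Q.comul w := by
        simp only [chain_tmul, rmul_apply, LinearMap.comp_apply, inl_apply, Delta_apply,
          ← mul_assoc]
        simp [mul_assoc]
      rw [e, hr, Q.apply_mul_tmul_mul_qL hr]
      simp [← TensorProduct.smul_tmul', mul_assoc]
  have h' := h Q.phi
  rw [pL_qL_cancel, e3_phi, mul_one, Algebra.TensorProduct.one_def, sandwichRight_tmul] at h'
  simpa using h'.symm

/-- Modulo left invariance, `p_L (S⁻¹(c) ⊗ 1)` is `p_L (1 ⊗ c)`. -/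
lemma apply_hitSnd_pL_mul (hl : ∀ a t, Sig (Q.hitSnd μ (Q.comul a) * t) = Q.counit a * Sig t)
    (t : H ⊗[k] H) (c : H) :
    Sig (Q.hitSnd μ (Q.pL * (Q.Sinv c ⊗ₜ 1)) * t) = Sig (Q.hitSnd μ (Q.pL * (1 ⊗ₜ c)) * t) := by
  rw [← Q.pL_cov]
  have h : ∀ d, Sig (Q.hitSnd μ (((Q.pL ▸▸ (inl k H H ∘ₗ Q.Sinv)) ⊚ Q.Delta) d) * t) =
      Sig (Q.hitSnd μ (Q.pL * (Q.Sinv (Q.counitSnd d) ⊗ₜ 1)) * t) := by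
    intro d
    induction d using TensorProduct.induction_on with
    | zero => simp
    | add x y hx hy => simp only [map_add, mul_add, add_mul, TensorProduct.add_tmul, hx, hy]
    | tmul u v =>
      rw [rchain_tmul, Delta_apply, map_mul (Q.hitSnd μ), mul_assoc, hl]
      simp [← TensorProduct.smul_tmul', mul_assoc]
  rw [h, counitSnd_comul]

/-- Modulo left invariance, `p_L (S⁻¹(c) S⁻¹(α) b ⊗ 1)` is `b ⊗ c`. -/
lemma apply_hitSnd_pL_alpha_mul
    (hl : ∀ a t, Sig (Q.hitSnd μ (Q.comul a) * t) = Q.counit a * Sig t)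
    (t : H ⊗[k] H) (b c : H) :
    Sig (Q.hitSnd μ (Q.pL * ((Q.Sinv c * Q.Sinv Q.alpha * b) ⊗ₜ 1)) * t) =
      Sig (Q.hitSnd μ (b ⊗ₜ c) * t) := by
  have h : ∀ x t, Sig (Q.hitSnd μ ((((Q.Sinv Q.alpha ⊗ₜ 1) ▸▸ inl k H H) ⊚
      (Q.pL ▸▸ (inl k H H ∘ₗ Q.Sinv)) ⊚ Q.Delta) x) * t) =
      Sig (Q.hitSnd μ (Q.pL * (((LinearMap.mulLeft k (Q.Sinv Q.alpha)) ⊚ Q.Sinv) (Q.e3 x) ⊗ₜ 1)) *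
        t) := by
    intro x t
    induction x using tensor3_induction with
    | add x y hx hy => simp only [map_add, mul_add, add_mul, TensorProduct.add_tmul, hx, hy]
    | tmul u v w =>
      rw [rchain_tmul, rchain_tmul, Delta_apply, mul_assoc, map_mul (Q.hitSnd μ), mul_assoc, hl]
      simp [← TensorProduct.smul_tmul', mul_assoc]
  have h1 : ∀ t, Sig (Q.hitSnd μ (Q.pL * (Q.Sinv Q.alpha ⊗ₜ 1)) * t) = Sig t := by
    intro t
    have h' := h Q.phiInv t
    rw [qL_pL_cancel, e3_phiInv, map_one, one_mul, Algebra.TensorProduct.one_def,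
      rchain_tmul] at h'
    simpa using h'.symm
  have e1 : Q.pL * ((Q.Sinv c * Q.Sinv Q.alpha * b) ⊗ₜ 1) =
      Q.pL * (Q.Sinv c ⊗ₜ 1) * ((Q.Sinv Q.alpha * b) ⊗ₜ 1) := by simp [mul_assoc]
  have e2 : Q.pL * (1 ⊗ₜ c) * ((Q.Sinv Q.alpha * b) ⊗ₜ 1) =
      Q.pL * (Q.Sinv Q.alpha ⊗ₜ 1) * (b ⊗ₜ c) := by simp [mul_assoc]
  rw [e1, map_mul (Q.hitSnd μ), mul_assoc, Q.apply_hitSnd_pL_mul hl, ← mul_assoc,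
    ← map_mul (Q.hitSnd μ), e2, map_mul (Q.hitSnd μ), mul_assoc, h1]

variable (μ Sig) in
/-- The form `a ↦ Σ(p_{L,μ} (a ⊗ 1) q_L)`. -/
def cointegralOf : Module.Dual k H :=
  Sig ∘ₗ LinearMap.mulRight k Q.qL ∘ₗ LinearMap.mulLeft k (Q.hitSnd μ Q.pL) ∘ₗ inl k H H

lemma cointegralOf_apply (a : H) :
    Q.cointegralOf μ Sig a = Sig (Q.hitSnd μ Q.pL * (a ⊗ₜ 1) * Q.qL) := rfl

/-- A biinvariant form is the form of its cointegral. -/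
lemma cointegralOf_formContract (hr : ∀ a t, Sig (t * Q.comul a) = Q.counit a * Sig t)
    (hl : ∀ a t, Sig (Q.hitSnd μ (Q.comul a) * t) = Q.counit a * Sig t) :
    Q.cointegralOf μ Sig ∘ₗ Q.formContract = Sig := by
  ext a b
  have e : Q.hitSnd μ Q.pL * ((Q.Sinv Q.alpha * a * Q.beta * Q.S b) ⊗ₜ 1) =
      Q.hitSnd μ (Q.pL * (Q.Sinv Q.alpha ⊗ₜ 1)) * ((a * Q.beta * Q.S b) ⊗ₜ 1) := by
    simp [mul_assoc]
  have h := Q.apply_hitSnd_pL_alpha_mul hl (a ⊗ₜ b) 1 1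
  rw [← Algebra.TensorProduct.one_def, map_one (Q.hitSnd μ), one_mul, Sinv_one, one_mul,
    mul_one] at h
  simp only [TensorProduct.AlgebraTensorModule.curry_apply, TensorProduct.curry_apply,
    LinearMap.coe_restrictScalars, LinearMap.comp_apply, formContract_tmul, cointegralOf_apply]
  rw [e, Q.apply_mul_beta_mul_qL hr, h]

lemma cointegralOf_left (hr : ∀ a t, Sig (t * Q.comul a) = Q.counit a * Sig t)
    (hl : ∀ a t, Sig (Q.hitSnd μ (Q.comul a) * t) = Q.counit a * Sig t) (c x : H) :
    Q.cointegralOf μ Sig (Q.Sinv c * x) = Q.cointegralOf μ Sig (x * Q.S (Q.hit μ c)) := by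
  rw [cointegralOf_apply, cointegralOf_apply]
  have e : ∀ u v : H, (u * v) ⊗ₜ[k] (1 : H) = (u ⊗ₜ 1) * (v ⊗ₜ 1) := by simp
  have e1 : Q.hitSnd μ Q.pL * ((Q.Sinv c * x) ⊗ₜ 1) * Q.qL =
      Q.hitSnd μ (Q.pL * (Q.Sinv c ⊗ₜ 1)) * ((x ⊗ₜ 1) * Q.qL) := by
    rw [e]
    simp only [mul_assoc, map_mul, hitSnd_tmul, map_one]
  have e2 : Q.hitSnd μ (Q.pL * (1 ⊗ₜ c)) * ((x ⊗ₜ 1) * Q.qL) =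
      Q.hitSnd μ Q.pL * (x ⊗ₜ 1) * (1 ⊗ₜ Q.hit μ c) * Q.qL := by
    rw [map_mul, hitSnd_tmul, ← mul_assoc, mul_assoc _ _ (x ⊗ₜ[k] (1 : H)),
      mul_assoc _ (x ⊗ₜ[k] (1 : H))]
    simp
  rw [e1, Q.apply_hitSnd_pL_mul hl, e2, Q.apply_mul_tmul_mul_qL hr, e]
  simp only [mul_assoc]

lemma evalSnd_mul_beta_mul_qL (hr : ∀ a t, Sig (t * Q.comul a) = Q.counit a * Sig t)
    (w : H ⊗[k] (H ⊗[k] H)) (u a b : H) :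
    evalSnd Sig (w * (u ⊗ₜ ((a * Q.beta * Q.S b) ⊗ₜ 1)) * inr k H (H ⊗[k] H) Q.qL) =
      evalSnd Sig (w * (u ⊗ₜ (a ⊗ₜ b))) := by
  induction w using TensorProduct.induction_on with
  | zero => simp
  | add x y hx hy => simp only [map_add, add_mul, hx, hy]
  | tmul v t =>
    simp only [inr_apply, Algebra.TensorProduct.tmul_mul_tmul, evalSnd_tmul, mul_one]
    rw [Q.apply_mul_beta_mul_qL hr]

lemma evalSnd_hitThd_mul (hl : ∀ a t, Sig (Q.hitSnd μ (Q.comul a) * t) = Q.counit a * Sig t)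
    (w : H ⊗[k] (H ⊗[k] H)) (u b c : H) :
    evalSnd Sig (Q.hitThd μ (inr k H (H ⊗[k] H) Q.pL *
      (u ⊗ₜ ((Q.Sinv c * Q.Sinv Q.alpha * b) ⊗ₜ 1))) * w) =
      evalSnd Sig (Q.hitThd μ (u ⊗ₜ (b ⊗ₜ c)) * w) := by
  induction w using TensorProduct.induction_on with
  | zero => simp
  | add x y hx hy => simp only [map_add, mul_add, hx, hy]
  | tmul v t =>
    simp only [inr_apply, Algebra.TensorProduct.tmul_mul_tmul, evalSnd_tmul, one_mul, hitThd_tmul]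
    rw [Q.apply_hitSnd_pL_alpha_mul hl]

/-- Modulo right invariance, `(Δ ⊗ id)(q_L) φ⁻¹` is `(U ⊗ 1) (1 ⊗ q_L)`. -/
lemma evalSnd_mul_explicitU (hr : ∀ a t, Sig (t * Q.comul a) = Q.counit a * Sig t)
    (w : H ⊗[k] (H ⊗[k] H)) :
    evalSnd Sig (w * padEnd k H Q.explicitU * inr k H (H ⊗[k] H) Q.qL) =
      evalSnd Sig (w * (Q.comulFst Q.qL * Q.phiInv)) := by
  have h : ∀ x y, evalSnd Sig (w * padEnd k H ((((Q.Delta ∘ₗ Q.S) ◂ Q.comul Q.alpha) ⊛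
      (Q.Delta ◂ Q.pRMap y) ⊛ (inr k H H ∘ₗ Q.S)) x) * inr k H (H ⊗[k] H) Q.qL) =
      evalSnd Sig (w * (Q.comulFst (Q.qLMap x) * y)) := by
    intro x y
    induction x using tensor3_induction with
    | add x y hx hy => simp only [map_add, mul_add, add_mul, hx, hy]
    | tmul a b c =>
      induction y using tensor3_induction with
      | add x y hx hy =>
        simp only [chain_tmul, rmul_apply, map_add, mul_add, add_mul] at hx hy ⊢
        rw [hx, hy]
      | tmul u v z =>
        have e1 : ∀ d : H ⊗[k] H, TensorProduct.assoc k H H H (d ⊗ₜ c) =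
            padEnd k H d * (1 ⊗ₜ (1 ⊗ₜ c)) := by
          intro d
          induction d using TensorProduct.induction_on with
          | zero => simp
          | add x y hx hy => simp only [map_add, TensorProduct.add_tmul, add_mul, hx, hy]
          | tmul e f => simp
        have e2 : Q.comulFst (Q.qLMap (a ⊗ₜ (b ⊗ₜ c))) * (u ⊗ₜ (v ⊗ₜ z)) =
            padEnd k H (Q.comul (Q.S a * Q.alpha * b)) * (u ⊗ₜ (v ⊗ₜ (c * z))) := by
          rw [qLMap_tmul, comulFst_tmul, e1, mul_assoc]
          simp
        have e3 : padEnd k H ((((Q.Delta ∘ₗ Q.S) ◂ Q.comul Q.alpha) ⊛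
            (Q.Delta ◂ Q.pRMap (u ⊗ₜ (v ⊗ₜ z))) ⊛ (inr k H H ∘ₗ Q.S)) (a ⊗ₜ (b ⊗ₜ c))) =
            padEnd k H (Q.comul (Q.S a * Q.alpha * b)) *
              (u ⊗ₜ ((v * Q.beta * Q.S (c * z)) ⊗ₜ 1)) := by
          rw [← padEnd_tmul, ← map_mul]
          congr 1
          simp only [chain_tmul, rmul_apply, LinearMap.comp_apply, Delta_apply, map_mul, inr_apply,
            pRMap_tmul, S_mul, mul_assoc, Algebra.TensorProduct.tmul_mul_tmul, mul_one]
        rw [e2, e3, ← mul_assoc, Q.evalSnd_mul_beta_mul_qL hr, mul_assoc]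
  rw [qL_eq, ← h, ← qL_eq, ← pR_eq]
  rfl

/-- Modulo left invariance, `φ (Δ ⊗ id)(p_L)` is `(1 ⊗ p_L) (V ⊗ 1)`. -/
lemma evalSnd_V_mul (hl : ∀ a t, Sig (Q.hitSnd μ (Q.comul a) * t) = Q.counit a * Sig t)
    (w : H ⊗[k] (H ⊗[k] H)) :
    evalSnd Sig (Q.hitThd μ (inr k H (H ⊗[k] H) Q.pL * padEnd k H Q.V) * w) =
      evalSnd Sig (Q.hitThd μ (Q.phi * Q.comulFst Q.pL) * w) := by
  have h : ∀ x y, evalSnd Sig (Q.hitThd μ (inr k H (H ⊗[k] H) Q.pL * padEnd k H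
      (((Q.Delta ∘ₗ Q.Sinv) ⊚ ((Q.qRMap y ▸▸ Q.Delta) ◂ Q.comul (Q.Sinv Q.beta)) ⊚
        (inr k H H ∘ₗ Q.Sinv)) x)) * w) =
      evalSnd Sig (Q.hitThd μ (y * Q.comulFst (Q.pLMap x)) * w) := by
    intro x y
    induction x using tensor3_induction with
    | add x y hx hy => simp only [map_add, mul_add, add_mul, hx, hy]
    | tmul a b c =>
      induction y using tensor3_induction with
      | add x y hx hy =>
        simp only [rchain_tmul, lmul_apply, rmul_apply, map_add, mul_add, add_mul] at hx hy ⊢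
        rw [hx, hy]
      | tmul u v z =>
        have e1 : ∀ d : H ⊗[k] H, TensorProduct.assoc k H H H (d ⊗ₜ c) =
            (1 ⊗ₜ (1 ⊗ₜ c)) * padEnd k H d := by
          intro d
          induction d using TensorProduct.induction_on with
          | zero => simp
          | add x y hx hy => simp only [map_add, TensorProduct.add_tmul, mul_add, hx, hy]
          | tmul e f => simp
        have e2 : (u ⊗ₜ (v ⊗ₜ z)) * Q.comulFst (Q.pLMap (a ⊗ₜ (b ⊗ₜ c))) =
            (u ⊗ₜ (v ⊗ₜ (z * c))) * padEnd k H (Q.comul (b * Q.Sinv Q.beta * Q.Sinv a)) := by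
          rw [pLMap_tmul, comulFst_tmul, e1, ← mul_assoc]
          simp
        have e3 : padEnd k H (((Q.Delta ∘ₗ Q.Sinv) ⊚
            ((Q.qRMap (u ⊗ₜ (v ⊗ₜ z)) ▸▸ Q.Delta) ◂ Q.comul (Q.Sinv Q.beta)) ⊚
            (inr k H H ∘ₗ Q.Sinv)) (a ⊗ₜ (b ⊗ₜ c))) =
            (u ⊗ₜ ((Q.Sinv (z * c) * Q.Sinv Q.alpha * v) ⊗ₜ 1)) *
              padEnd k H (Q.comul (b * Q.Sinv Q.beta * Q.Sinv a)) := by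
          rw [← padEnd_tmul, ← map_mul]
          congr 1
          simp only [rchain_tmul, lmul_apply, rmul_apply, LinearMap.comp_apply, Delta_apply,
            map_mul, inr_apply, qRMap_tmul, Sinv_mul, ← mul_assoc,
            Algebra.TensorProduct.tmul_mul_tmul, one_mul]
        rw [e2, e3, ← mul_assoc, map_mul (Q.hitThd μ), mul_assoc, Q.evalSnd_hitThd_mul hl,
          ← mul_assoc, ← map_mul (Q.hitThd μ)]
  rw [pL_eq, ← h, ← pL_eq, ← qR_eq, ← V_eq]

lemma evalFst_mul_padEnd_comul (hr : ∀ a t, Sig (t * Q.comul a) = Q.counit a * Sig t)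
    (w : H ⊗[k] (H ⊗[k] H)) (a : H) :
    evalFst Sig (w * padEnd k H (Q.comul a)) = Q.counit a • evalFst Sig w := by
  induction w using tensor3_induction with
  | add x y hx hy => simp only [map_add, add_mul, smul_add, hx, hy]
  | tmul u v z =>
    have h : ∀ d, evalFst Sig ((u ⊗ₜ (v ⊗ₜ z)) * padEnd k H d) = Sig ((u ⊗ₜ v) * d) • z := by
      intro d
      induction d using TensorProduct.induction_on with
      | zero => simp
      | add x y hx hy => simp only [map_add, mul_add, add_smul, hx, hy]
      | tmul e f => simp
    rw [h, hr, evalFst_tmul, smul_smul]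

lemma evalFst_hitMid_padEnd_comul_mul
    (hl : ∀ a t, Sig (Q.hitSnd μ (Q.comul a) * t) = Q.counit a * Sig t)
    (w : H ⊗[k] (H ⊗[k] H)) (a : H) :
    evalFst Sig (Q.hitMid μ (padEnd k H (Q.comul a)) * w) = Q.counit a • evalFst Sig w := by
  induction w using tensor3_induction with
  | add x y hx hy => simp only [map_add, mul_add, smul_add, hx, hy]
  | tmul u v z =>
    have h : ∀ d, evalFst Sig (Q.hitMid μ (padEnd k H d) * (u ⊗ₜ (v ⊗ₜ z))) =
        Sig (Q.hitSnd μ d * (u ⊗ₜ v)) • z := by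
      intro d
      induction d using TensorProduct.induction_on with
      | zero => simp
      | add x y hx hy => simp only [map_add, add_mul, add_smul, hx, hy]
      | tmul e f => simp
    rw [h, hl, evalFst_tmul, smul_smul]

end QuasiHopfAlgebra

/-! ### The coaction on the cointegral of a form -/

namespace QuasiHopfAlgebra

variable {k H : Type*} [Field k] [Ring H] [Algebra k H] (Q : QuasiHopfAlgebra k H)
  {μ : H →ₐ[k] k} {Sig : Module.Dual k (H ⊗[k] H)}

lemma leftInv_alpha_first : Q.LeftInv (((inl k H (H ⊗[k] H) ∘ₗ Q.S) ◂ inl k H (H ⊗[k] H) Q.alpha) ⊛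
    inl k H (H ⊗[k] H)) :=
  Q.leftInv_alpha (Algebra.TensorProduct.includeLeft : H →ₐ[k] H ⊗[k] (H ⊗[k] H))

lemma rightInv_beta_inv_first : Q.RightInv ((inl k H (H ⊗[k] H) ∘ₗ Q.Sinv) ⊚
    (inl k H (H ⊗[k] H) ◂ inl k H (H ⊗[k] H) (Q.Sinv Q.beta))) :=
  Q.rightInv_beta_inv (Algebra.TensorProduct.includeLeft : H →ₐ[k] H ⊗[k] (H ⊗[k] H))

/-- Modulo right invariance in the first two factors, `(id ⊗ Δ)(q_L) φ` is `q_L ⊗ 1`. -/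
lemma evalFst_mul_comulSnd_qL (hr : ∀ a t, Sig (t * Q.comul a) = Q.counit a * Sig t)
    (w : H ⊗[k] (H ⊗[k] H)) :
    evalFst Sig (w * (Q.comulSnd Q.qL * Q.phi)) = evalFst Sig (w * padEnd k H Q.qL) := by
  let M := ((inl k H (H ⊗[k] H) ∘ₗ Q.S) ◂ inl k H (H ⊗[k] H) Q.alpha) ⊛ inl k H (H ⊗[k] H) ⊛
    (mid k H ⊛ last k H)
  have h1 : ∀ x y, Q.comulSnd (Q.qLMap x) * y = M (Q.d3 x * padLeft k H y) := by
    intro x y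
    induction x using tensor3_induction with
    | add x y hx hy => simp only [map_add, add_mul, hx, hy]
    | tmul a b c =>
      rw [qLMap_tmul, comulSnd_tmul, d3_tmul, comulSnd_tmul]
      generalize Q.comul c = d
      induction d using TensorProduct.induction_on with
      | zero => simp
      | add x y hx hy => simp only [map_add, add_mul, TensorProduct.tmul_add, hx, hy]
      | tmul e f =>
        induction y using tensor3_induction with
        | add x y hx hy => simp only [map_add, mul_add, hx, hy]
        | tmul u v z => simp [M, mid, last, mul_assoc]
  have h2 : ∀ x y, evalFst Sig (w * M (padRight k H x * Q.d2 y)) =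
      evalFst Sig (w * (((inl k H (H ⊗[k] H) ∘ₗ Q.S) ◂ padEnd k H (Q.qLMap x)) ⊛ last k H)
        (Q.e2 y)) := by
    intro x y
    induction y using tensor3_induction with
    | add x y hx hy => simp only [map_add, mul_add, hx, hy]
    | tmul a b c =>
      have e : ∀ d, M (padRight k H x * (a ⊗ₜ TensorProduct.assoc k H H H (d ⊗ₜ c))) =
          (((inl k H (H ⊗[k] H) ∘ₗ Q.S) ◂ padEnd k H (Q.qLMap x)) ⊛ last k H) (a ⊗ₜ c) *
            padEnd k H d := by
        intro d
        induction d using TensorProduct.induction_on with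
        | zero => simp
        | add u v hu hv => simp only [map_add, mul_add, TensorProduct.add_tmul,
            TensorProduct.tmul_add, hu, hv]
        | tmul e f =>
          induction x using tensor3_induction with
          | add u v hu hv =>
            simp only [chain_tmul, rmul_apply, map_add, mul_add, add_mul] at hu hv ⊢
            rw [hu, hv]
          | tmul u v z => simp [M, mid, last, S_mul, mul_assoc]
      rw [d2_tmul, comulFst_tmul, e, ← mul_assoc, Q.evalFst_mul_padEnd_comul hr, e2_tmul,
        counitFst_tmul, TensorProduct.tmul_smul, map_smul, mul_smul_comm, map_smul]
  rw [qL_eq, h1, d3_inv_mul_padLeft, mul_assoc]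
  refine (congrArg (fun z => evalFst Sig (w * z))
    (Q.leftInv_alpha_first.chain_d1 Q.e1_phi _)).trans ((h2 _ _).trans ?_)
  rw [e2_phiInv, Algebra.TensorProduct.one_def, chain_tmul, ← qL_eq]
  simp [last, ← Algebra.TensorProduct.one_def]

/-- Modulo left invariance in the first two factors, `φ⁻¹ (id ⊗ Δ)(p_L)` is `p_L ⊗ 1`. -/
lemma evalFst_comulSnd_pL_mul (hl : ∀ a t, Sig (Q.hitSnd μ (Q.comul a) * t) = Q.counit a * Sig t)
    (w : H ⊗[k] (H ⊗[k] H)) :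
    evalFst Sig (Q.hitMid μ (Q.phiInv * Q.comulSnd Q.pL) * w) =
      evalFst Sig (Q.hitMid μ (padEnd k H Q.pL) * w) := by
  let M := (inl k H (H ⊗[k] H) ∘ₗ Q.Sinv) ⊚
    (inl k H (H ⊗[k] H) ◂ inl k H (H ⊗[k] H) (Q.Sinv Q.beta)) ⊚ (mid k H ⊛ last k H)
  have h1 : ∀ x y, y * Q.comulSnd (Q.pLMap x) = M (padLeft k H y * Q.d3 x) := by
    intro x y
    induction x using tensor3_induction with
    | add x y hx hy => simp only [map_add, mul_add, hx, hy]
    | tmul a b c =>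
      rw [pLMap_tmul, comulSnd_tmul, d3_tmul, comulSnd_tmul]
      generalize Q.comul c = d
      induction d using TensorProduct.induction_on with
      | zero => simp
      | add x y hx hy => simp only [map_add, mul_add, TensorProduct.tmul_add, hx, hy]
      | tmul e f =>
        induction y using tensor3_induction with
        | add x y hx hy => simp only [map_add, add_mul, hx, hy]
        | tmul u v z => simp [M, mid, last, mul_assoc]
  have h2 : ∀ x y, evalFst Sig (Q.hitMid μ (M (Q.d2 y * padRight k H x)) * w) =
      evalFst Sig (Q.hitMid μ (((padEnd k H (Q.pLMap x) ▸▸ (inl k H (H ⊗[k] H) ∘ₗ Q.Sinv)) ⊚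
        last k H) (Q.e2 y)) * w) := by
    intro x y
    induction y using tensor3_induction with
    | add x y hx hy => simp only [map_add, add_mul, hx, hy]
    | tmul a b c =>
      have e : ∀ d, M ((a ⊗ₜ TensorProduct.assoc k H H H (d ⊗ₜ c)) * padRight k H x) =
          padEnd k H d * ((padEnd k H (Q.pLMap x) ▸▸ (inl k H (H ⊗[k] H) ∘ₗ Q.Sinv)) ⊚ last k H)
            (a ⊗ₜ c) := by
        intro d
        induction d using TensorProduct.induction_on with
        | zero => simp
        | add u v hu hv => simp only [map_add, add_mul, TensorProduct.add_tmul,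
            TensorProduct.tmul_add, hu, hv]
        | tmul e f =>
          induction x using tensor3_induction with
          | add u v hu hv =>
            simp only [rchain_tmul, lmul_apply, map_add, mul_add, add_mul] at hu hv ⊢
            rw [hu, hv]
          | tmul u v z => simp [M, mid, last, Sinv_mul, mul_assoc]
      rw [d2_tmul, comulFst_tmul, e, map_mul (Q.hitMid μ), mul_assoc,
        Q.evalFst_hitMid_padEnd_comul_mul hl, e2_tmul,
        counitFst_tmul, TensorProduct.tmul_smul, map_smul, map_smul, smul_mul_assoc, map_smul]
  rw [pL_eq, h1, padLeft_inv_mul_d3]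
  refine (congrArg (fun z => evalFst Sig (Q.hitMid μ z * w))
    (Q.rightInv_beta_inv_first.rchain_d1 Q.e1_phiInv _)).trans ((h2 _ _).trans ?_)
  rw [e2_phi, Algebra.TensorProduct.one_def, rchain_tmul, ← pL_eq]
  simp [last, ← Algebra.TensorProduct.one_def]

variable (μ) in
/-- `T_μ Δ(a ↼ μ) = ((a₁ ↼ μ) ⊗ a₂) T_μ`: quasi-coassociativity with `μ` applied to the
first leg. -/
lemma T_mul_comul_hit (a : H) : Q.T μ * Q.comul (Q.hit μ a) =
    Algebra.TensorProduct.map (Q.hit μ) (AlgHom.id k H) (Q.comul a) * Q.T μ := by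
  let F : H ⊗[k] (H ⊗[k] H) →ₐ[k] H ⊗[k] H :=
    (Algebra.TensorProduct.lid k (H ⊗[k] H)).toAlgHom.comp
      (Algebra.TensorProduct.map μ (AlgHom.id k (H ⊗[k] H)))
  have h1 : ∀ d, F (Q.comulSnd d) = Q.comul (TensorProduct.lid k H
      (TensorProduct.map μ.toLinearMap LinearMap.id d)) := by
    intro d
    induction d using TensorProduct.induction_on with
    | zero => simp
    | add x y hx hy => simp only [map_add, hx, hy]
    | tmul e f => simp [F, comulSnd_tmul]
  have h2 : ∀ d, F (Q.comulFst d) =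
      Algebra.TensorProduct.map (Q.hit μ) (AlgHom.id k H) d := by
    intro d
    induction d using TensorProduct.induction_on with
    | zero => simp
    | add x y hx hy => simp only [map_add, hx, hy]
    | tmul e f =>
      have e' : Q.hit μ e = TensorProduct.lid k H
          (TensorProduct.map μ.toLinearMap LinearMap.id (Q.comul e)) := rfl
      rw [comulFst_tmul, Algebra.TensorProduct.map_tmul, e', AlgHom.id_apply]
      generalize Q.comul e = d
      induction d using TensorProduct.induction_on with
      | zero => simp
      | add x y hx hy => simp only [map_add, TensorProduct.add_tmul, hx, hy]
      | tmul u v => simp [F, TensorProduct.smul_tmul']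
  have h := congrArg F (Q.phiInv_mul_comulSnd a)
  rw [map_mul, map_mul, h1, h2] at h
  exact h

variable (μ) in
lemma inr_T_mul_comulSnd_hitSnd (p : H ⊗[k] H) :
    inr k H (H ⊗[k] H) (Q.T μ) * Q.comulSnd (Q.hitSnd μ p) =
      Q.hitMid μ (Q.comulSnd p) * inr k H (H ⊗[k] H) (Q.T μ) := by
  induction p using TensorProduct.induction_on with
  | zero => simp
  | add x y hx hy => simp only [map_add, mul_add, add_mul, hx, hy]
  | tmul u v =>
    have h : Q.hitMid μ (u ⊗ₜ Q.comul v) =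
        u ⊗ₜ Algebra.TensorProduct.map (Q.hit μ) (AlgHom.id k H) (Q.comul v) := rfl
    rw [hitSnd_tmul, comulSnd_tmul, comulSnd_tmul, h]
    simp [T_mul_comul_hit]

variable (μ) in
lemma comulFst_hitSnd (p : H ⊗[k] H) :
    Q.comulFst (Q.hitSnd μ p) = Q.hitThd μ (Q.comulFst p) := by
  induction p using TensorProduct.induction_on with
  | zero => simp
  | add x y hx hy => simp only [map_add, hx, hy]
  | tmul u v =>
    rw [hitSnd_tmul, comulFst_tmul, comulFst_tmul]
    generalize Q.comul u = d
    induction d using TensorProduct.induction_on with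
    | zero => simp
    | add x y hx hy => simp only [map_add, TensorProduct.add_tmul, hx, hy]
    | tmul e f => simp

variable (μ) in
lemma hitThd_padEnd (t : H ⊗[k] H) : Q.hitThd μ (padEnd k H t) = padEnd k H t := by
  induction t using TensorProduct.induction_on with
  | zero => simp
  | add x y hx hy => simp only [map_add, hx, hy]
  | tmul e f => simp

lemma comulFst_tmul_one (c : H) : Q.comulFst (c ⊗ₜ 1) = padEnd k H (Q.comul c) := by
  rw [comulFst_tmul]
  generalize Q.comul c = d
  induction d using TensorProduct.induction_on with
  | zero => simp
  | add x y hx hy => simp only [map_add, TensorProduct.add_tmul, hx, hy]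
  | tmul e f => simp

lemma evalFst_padEnd (c a b : H) (p q : H ⊗[k] H) :
    evalFst Sig (Q.hitMid μ (padEnd k H p) * (c ⊗ₜ (a ⊗ₜ b)) * padEnd k H q) =
      Sig (Q.hitSnd μ p * (c ⊗ₜ a) * q) • b := by
  induction p using TensorProduct.induction_on with
  | zero => simp
  | add x y hx hy => simp only [map_add, add_mul, add_smul, hx, hy]
  | tmul e f =>
    induction q using TensorProduct.induction_on with
    | zero => simp
    | add x y hx hy => simp only [map_add, mul_add, add_smul, hx, hy]
    | tmul u v => simp

/-- The coaction on the cointegral of a form is twisted by `T_μ`: cocentrality is evaluated at `p_μ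
(c ⊗ 1) q` with `p = p_L` and `q = q_L`. -/
lemma dualRho_cointegralOf [Module.Finite k H]
    (hr : ∀ a t, Sig (t * Q.comul a) = Q.counit a * Sig t)
    (hl : ∀ a t, Sig (Q.hitSnd μ (Q.comul a) * t) = Q.counit a * Sig t)
    (hc : ∀ t, evalSnd Sig (Q.hitThd μ Q.phi * (Q.comulFst t * Q.phiInv)) =
        evalFst Sig (Q.hitMid μ Q.phiInv *
          (inr k H (H ⊗[k] H) (Q.T μ) * Q.comulSnd t * Q.phi))) :
    Q.dualRho (Q.cointegralOf μ Sig) =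
      TensorProduct.map (Q.dualB.right.flip (Q.cointegralOf μ Sig)) LinearMap.id (Q.T μ) := by
  apply dualTensorHom_injective
  ext c
  have h1 : ∀ y, slice H (Q.cointegralOf μ Sig) y = evalSnd Sig
      (Q.hitThd μ (inr k H (H ⊗[k] H) Q.pL) * padEnd k H y * inr k H (H ⊗[k] H) Q.qL) := by
    intro y
    induction y using TensorProduct.induction_on with
    | zero => simp
    | add x y hx hy => simp only [map_add, mul_add, add_mul, hx, hy]
    | tmul u v => simp [cointegralOf_apply]
  have h2 : ∀ s, evalFst Sig (Q.hitMid μ (padEnd k H Q.pL) *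
      (inr k H (H ⊗[k] H) s * inl k H (H ⊗[k] H) c) * padEnd k H Q.qL) =
      dualTensorHom k H H
        (TensorProduct.map (Q.dualB.right.flip (Q.cointegralOf μ Sig)) LinearMap.id s) c := by
    intro s
    induction s using TensorProduct.induction_on with
    | zero => simp
    | add x y hx hy => simp only [map_add, mul_add, add_mul, LinearMap.add_apply, hx, hy]
    | tmul a b =>
      have e : inr k H (H ⊗[k] H) (a ⊗ₜ b) * inl k H (H ⊗[k] H) c = c ⊗ₜ (a ⊗ₜ b) := by simp
      have e1 : c ⊗ₜ[k] a = (c ⊗ₜ 1) * (1 ⊗ₜ a) := by simp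
      have e2 : (c * Q.S a) ⊗ₜ[k] (1 : H) = (c ⊗ₜ 1) * (Q.S a ⊗ₜ 1) := by simp
      rw [e, evalFst_padEnd, e1, ← mul_assoc, Q.apply_mul_tmul_mul_qL hr, TensorProduct.map_tmul,
        dualTensorHom_apply, LinearMap.flip_apply, dualB_right, cointegralOf_apply, e2,
        ← mul_assoc, LinearMap.id_apply]
  rw [dualTensorHom_dualRho, h1, ← h2]
  have e1 : Q.hitThd μ (inr k H (H ⊗[k] H) Q.pL) * padEnd k H (Q.V * Q.comul c * Q.explicitU) *
      inr k H (H ⊗[k] H) Q.qL = Q.hitThd μ (inr k H (H ⊗[k] H) Q.pL * padEnd k H Q.V) *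
        padEnd k H (Q.comul c) * padEnd k H Q.explicitU * inr k H (H ⊗[k] H) Q.qL := by
    rw [map_mul (padEnd k H), map_mul (padEnd k H), map_mul (Q.hitThd μ), hitThd_padEnd]
    simp only [mul_assoc]
  have e2 : Q.hitThd μ (Q.phi * Q.comulFst Q.pL) * (padEnd k H (Q.comul c) *
      (Q.comulFst Q.qL * Q.phiInv)) = Q.hitThd μ Q.phi *
        (Q.comulFst (Q.hitSnd μ Q.pL * (c ⊗ₜ 1) * Q.qL) * Q.phiInv) := by
    rw [map_mul Q.comulFst, map_mul Q.comulFst, comulFst_tmul_one, comulFst_hitSnd,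
      map_mul (Q.hitThd μ)]
    simp only [mul_assoc]
  have e3 : Q.hitMid μ Q.phiInv * (inr k H (H ⊗[k] H) (Q.T μ) *
      Q.comulSnd (Q.hitSnd μ Q.pL * (c ⊗ₜ 1) * Q.qL) * Q.phi) =
      Q.hitMid μ (Q.phiInv * Q.comulSnd Q.pL) * (inr k H (H ⊗[k] H) (Q.T μ) *
        inl k H (H ⊗[k] H) c) * (Q.comulSnd Q.qL * Q.phi) := by
    have e : Q.comulSnd (c ⊗ₜ 1) = inl k H (H ⊗[k] H) c := by
      rw [comulSnd_tmul, map_one]; rfl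
    rw [map_mul Q.comulSnd, map_mul Q.comulSnd, e, map_mul (Q.hitMid μ), ← mul_assoc (inr k H _ _),
      ← mul_assoc (inr k H _ _), inr_T_mul_comulSnd_hitSnd]
    simp only [mul_assoc]
  rw [e1, Q.evalSnd_mul_explicitU hr, mul_assoc, Q.evalSnd_V_mul hl, e2, hc, e3,
    Q.evalFst_mul_comulSnd_qL hr, mul_assoc, Q.evalFst_comulSnd_pL_mul hl]
  simp only [mul_assoc]

/-! ### The bijection -/

variable [Module.Finite k H]

/-- The form `Σ_λ`, as a linear map from left cointegrals to cocentral biinvariant forms. -/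
def formOf : Q.leftCointegrals →ₗ[k] Q.modularForms :=
  (Q.formContract.dualMap ∘ₗ Q.leftCointegrals.subtype).codRestrict Q.modularForms (by
    rintro ⟨lam, hlam⟩
    obtain ⟨h1, h2⟩ := Q.mem_leftCointegrals_iff.mp hlam
    have hl : ∀ c x, lam (Q.Sinv c * x) = lam (x * Q.S (Q.hit Q.modulus c)) :=
      fun c x => LinearMap.congr_fun (h1 c) x
    refine (Q.mem_forms_iff Q.modulus _).mpr ⟨⟨fun a t => Q.form_mul_comul a t, fun a t => ?_⟩,
      Q.form_cocentral hl h2⟩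
    change lam (Q.formContract _) = _ * lam (Q.formContract _)
    rw [Q.form_hitSnd_mul hl, sandwichLeft_comul, map_smul, smul_mul_assoc, map_smul,
      formContract_eq, smul_eq_mul])

lemma formOf_apply (lam : Q.leftCointegrals) (t : H ⊗[k] H) :
    (Q.formOf lam : Module.Dual k (H ⊗[k] H)) t =
      (lam : Module.Dual k H) (Q.formContract t) := rfl

/-- Any `p` and `q` with `S(p¹) α p² = 1` and `q¹ β S(q²) = 1` invert `λ ↦ Σ_λ`. -/
lemma formOf_modularTwist (lam : Q.leftCointegrals) {p q : H ⊗[k] H}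
    (hp : sandwichLeft Q.S Q.alpha p = 1) (hq : sandwichRight Q.S Q.beta q = 1) (a : H) :
    (Q.formOf lam : Module.Dual k (H ⊗[k] H)) (Q.modularTwist p * (a ⊗ₜ[k] (1 : H)) * q) =
      (lam : Module.Dual k H) a :=
  Q.form_apply_of_sandwich
    (fun c x => LinearMap.congr_fun ((Q.mem_leftCointegrals_iff.mp lam.2).1 c) x) hp hq a

lemma bijective_formOf : Function.Bijective Q.formOf := by
  constructor
  · intro s t hst
    ext a
    rw [← Q.formOf_modularTwist s Q.sandwichLeft_pL Q.sandwichRight_qL, hst,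
      Q.formOf_modularTwist t Q.sandwichLeft_pL Q.sandwichRight_qL]
  · rintro ⟨Sig, hSig⟩
    obtain ⟨⟨hr, hl⟩, hc⟩ := (Q.mem_forms_iff Q.modulus Sig).mp hSig
    refine ⟨⟨Q.cointegralOf Q.modulus Sig, Q.mem_leftCointegrals_iff.mpr ⟨fun c => ?_,
      Q.dualRho_cointegralOf hr hl hc⟩⟩, Subtype.ext (Q.cointegralOf_formContract hr hl)⟩
    ext x
    exact Q.cointegralOf_left hr hl c x

end QuasiHopfAlgebra

end

theorem corollary7 {k H : Type*} [Field k] [Ring H] [Algebra k H] [Module.Finite k H]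
    (Q : QuasiHopfAlgebra k H) :
    (∃ e : Q.leftCointegrals ≃ₗ[k] Q.modularForms,
      (∀ (lam : Q.leftCointegrals) (a b : H),
        (e lam : Module.Dual k (H ⊗[k] H)) (a ⊗ₜ[k] b) =
          (lam : Module.Dual k H)
            (Q.antipode.symm Q.alpha * a * Q.beta * Q.antipode b)) ∧
      (∀ p ∈ ({Q.pL, Q.pR} : Set (H ⊗[k] H)), ∀ q ∈ ({Q.qL, Q.qR} : Set (H ⊗[k] H)),
        ∀ (Sig : Q.modularForms) (a : H),
          (e.symm Sig : Module.Dual k H) a =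
            (Sig : Module.Dual k (H ⊗[k] H))
              (Q.modularTwist p * (a ⊗ₜ[k] (1 : H)) * q))) ∧
    Module.finrank k Q.modularForms = 1 := by
  let e := LinearEquiv.ofBijective Q.formOf Q.bijective_formOf
  refine ⟨⟨e, fun lam a b => ?_, fun p hp q hq Sig a => ?_⟩, ?_⟩
  · exact (Q.formOf_apply lam _).trans (congrArg _ (Q.formContract_tmul a b))
  · have hp' : sandwichLeft Q.S Q.alpha p = 1 := by
      rcases hp with rfl | rfl
      exacts [Q.sandwichLeft_pL, Q.sandwichLeft_pR]
    have hq' : sandwichRight Q.S Q.beta q = 1 := by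
      rcases hq with rfl | rfl
      exacts [Q.sandwichRight_qL, Q.sandwichRight_qR]
    have h := Q.formOf_modularTwist (e.symm Sig) hp' hq' a
    rw [← h]
    exact congrArg (fun s : Q.modularForms => (s : Module.Dual k (H ⊗[k] H)) _)
      (e.apply_symm_apply Sig)
  · rw [← e.finrank_eq, Q.finrank_leftCointegrals]
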